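/- Let $T>0$ and let $\lambda\in C^1([0,1]\times[0,\infty))$ with $\lambda>0$. For $\rho_0\in L^\infty(0,1)$ and $u\in L^\infty(0,T)$, both nonnegative almost everywhere, consider the Cauchy problem $$\rho_t(t,x)+\big(\rho(t,x)\,\lambda(x,W(t))\big)_x=0,\qquad W(t)=\int_0^1\rho(t,x)\,dx,\qquad \rho(0,x)=\rho_0(x),\qquad \rho(t,0)\lambda(0,W(t))=u(t),$$ for $0\le t\le T$, $0\le x\le 1$. A weak solution is a function $\rho\in C^0([0,T];L^1(0,1))\cap L^\infty((0,T)\times(0,1))$ with $W(t)\ge 0$ on $[0,T]$ such that for every $\tau\in[0,T]$ and every $\varphi\in C^1([0,\tau]\times[0,1])$ with $\varphi(\tau,\cdot)=0$ and $\varphi(\cdot,1)=0$, $$\int_0^\tau\!\!\int_0^1\rho\,\big(\varphi_t+\lambda(x,W(t))\varphi_x\big)\,dx\,dt+\int_0^\tau u(t)\varphi(t,0)\,dt+\int_0^1\rho_0(x)\varphi(0,x)\,dx=0 .$$ The out-flux of $\rho$ is $y(t)=\rho(t,1)\lambda(1,W(t))$, $t\in(0,T)$, where $\rho(\cdot,1)$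 is the value at $x=1$ of the representative of $\rho$ in $\bigcap_{1\le p<\infty}C^0([0,1];L^p(0,T))$ (as a function of $x$). Theorem. Fix $\lambda$, $T$ and nonnegative data $\rho_0\in L^\infty(0,1)$, $u\in L^\infty(0,T)$. For every $\varepsilon>0$, every $p\in[1,\infty)$ and every $K$ with $\|\rho_0\|_{L^\infty(0,1)}+\|u\|_{L^\infty(0,T)}\le K$ there exists $\eta>0$ such that the following holds for all nonnegative data $\bar\rho_0\in L^\infty(0,1)$, $\bar u\in L^\infty(0,T)$ with $\|\bar\rho_0\|_{L^\infty(0,1)}+\|\bar u\|_{L^\infty(0,T)}\le K$: if $$\|\bar\rho_0-\rho_0\|_{L^p(0,1)}+\|\bar u-u\|_{L^p(0,T)}<\eta ,$$ and $\rho$, $\bar\rho$ are weak solutions for the data $(\rho_0,u)$, $(\bar\rho_0,\bar u)$, then their out-fluxes $y$, $\bar y$ exist and $$\|\bar y-y\|_{L^p(0,T)}<\varepsilon .$$ The number $\eta$ does not depend on $(\bar\rho_0,\bar u)$. -/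

import Mathlib

open MeasureTheory Set Filter Topology
open scoped ENNReal NNReal

/-- Lebesgue measure on the interval `(0, a)`. -/
noncomputable def volIoo (a : ℝ) : Measure ℝ := volume.restrict (Ioo 0 a)

/-- The total mass `W(t) = ∫₀¹ ρ(t,x) dx`. -/
noncomputable def totalMass (ρ : ℝ → ℝ → ℝ) (t : ℝ) : ℝ := ∫ x in (0 : ℝ)..1, ρ t x

/-- Admissible velocities: `λ ∈ C¹([0,1] × [0,∞))` and `λ > 0` there. The values of `lam`
outside `[0,1] × [0,∞)` play no role. -/
structure IsVelocity (lam : ℝ → ℝ → ℝ) : Prop where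
  contDiffOn : ContDiffOn ℝ 1 (fun q : ℝ × ℝ => lam q.1 q.2) (Icc 0 1 ×ˢ Ici 0)
  pos : ∀ x ∈ Icc (0 : ℝ) 1, ∀ w ∈ Ici (0 : ℝ), 0 < lam x w

/-- `f ∈ L^∞_+(0,a)`: measurable, essentially bounded and nonnegative almost everywhere. -/
structure MemLInftyPlus (a : ℝ) (f : ℝ → ℝ) : Prop where
  memLp : MemLp f ∞ (volIoo a)
  nonneg : ∀ᵐ s ∂(volIoo a), 0 ≤ f s

/-- Test functions `φ ∈ C¹([0,τ] × [0,1])` with `φ(τ,x) = 0` for `x ∈ [0,1]` and `φ(t,1) = 0` for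
`t ∈ [0,τ]`. -/
structure IsTestFunction (τ : ℝ) (φ : ℝ → ℝ → ℝ) : Prop where
  contDiffOn : ContDiffOn ℝ 1 (fun q : ℝ × ℝ => φ q.1 q.2) (Icc 0 τ ×ˢ Icc 0 1)
  final : ∀ x ∈ Icc (0 : ℝ) 1, φ τ x = 0
  right : ∀ t ∈ Icc (0 : ℝ) τ, φ t 1 = 0

/-- Weak solutions `ρ ∈ C⁰([0,T]; L¹(0,1)) ∩ L^∞((0,T) × (0,1))` of
`ρ_t + (ρ λ(x,W(t)))_x = 0`, `ρ(0,x) = ρ₀(x)`, `ρ(t,0) λ(0,W(t)) = u(t)`. -/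
structure IsWeakSolution (lam : ℝ → ℝ → ℝ) (T : ℝ) (ρ₀ u : ℝ → ℝ) (ρ : ℝ → ℝ → ℝ) : Prop where
  memLp_one : ∀ t ∈ Icc (0 : ℝ) T, MemLp (ρ t) 1 (volIoo 1)
  continuous_L1 : ∀ s ∈ Icc (0 : ℝ) T,
    Tendsto (fun t => eLpNorm (fun x => ρ t x - ρ s x) 1 (volIoo 1)) (𝓝[Icc 0 T] s) (𝓝 0)
  memLp_top : MemLp (fun q : ℝ × ℝ => ρ q.1 q.2) ∞ (volume.restrict (Ioo 0 T ×ˢ Ioo 0 1))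
  /-- The velocity is defined on `[0,1] × [0,∞)` only, so `λ(x,W(t))` needs `W(t) ≥ 0`. -/
  mass_nonneg : ∀ t ∈ Icc (0 : ℝ) T, 0 ≤ totalMass ρ t
  weak : ∀ τ ∈ Icc (0 : ℝ) T, ∀ φ : ℝ → ℝ → ℝ, IsTestFunction τ φ →
    (∫ t in (0 : ℝ)..τ, ∫ x in (0 : ℝ)..1,
        ρ t x * (derivWithin (fun s => φ s x) (Icc 0 τ) t
          + lam x (totalMass ρ t) * derivWithin (fun z => φ t z) (Icc 0 1) x))
      + (∫ t in (0 : ℝ)..τ, u t * φ t 0)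
      + (∫ x in (0 : ℝ)..1, ρ₀ x * φ 0 x) = 0

/-- `r` is a representative of `ρ` (as a function on `(0,T) × (0,1)` up to null sets) that belongs
to `C⁰([0,1]; L^p(0,T))`, as a function of `x`, for every `p ∈ [1,∞)`. -/
structure IsSpaceContinuousRep (T : ℝ) (ρ r : ℝ → ℝ → ℝ) : Prop where
  ae_eq : (fun q : ℝ × ℝ => r q.1 q.2)
    =ᵐ[volume.restrict (Ioo 0 T ×ˢ Ioo 0 1)] (fun q : ℝ × ℝ => ρ q.1 q.2)
  memLp : ∀ p : ℝ≥0∞, 1 ≤ p → p ≠ ∞ → ∀ x ∈ Icc (0 : ℝ) 1, MemLp (fun t => r t x) p (volIoo T)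
  continuous_Lp : ∀ p : ℝ≥0∞, 1 ≤ p → p ≠ ∞ → ∀ x ∈ Icc (0 : ℝ) 1,
    Tendsto (fun z => eLpNorm (fun t => r t z - r t x) p (volIoo T)) (𝓝[Icc 0 1] x) (𝓝 0)

/-- `y` is the out-flux `y(t) = ρ(t,1) λ(1,W(t))`, `t ∈ (0,T)` (up to a null set), where `ρ(·,1)`
is the value at `x = 1` of the continuous function `x ↦ ρ(·,x) ∈ L^p(0,T)`. -/
def IsOutflux (lam : ℝ → ℝ → ℝ) (T : ℝ) (ρ : ℝ → ℝ → ℝ) (y : ℝ → ℝ) : Prop :=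
  ∃ r : ℝ → ℝ → ℝ, IsSpaceContinuousRep T ρ r ∧
    ∀ᵐ t ∂(volIoo T), y t = r t 1 * lam 1 (totalMass ρ t)

/-! The velocity depends on the solution only through its total mass `W`, so once `W` is known the
equation is a linear transport equation, solved along the characteristics `ξ' = λ(ξ, W)`. The
velocity is first extended to the plane (`RegularVelocity`), constant in `x` for `x ≤ 0`.
Characteristics then exist for all times, and each is determined by its position `σ` at time `0`,
its foot. It crosses `x = 0` at an entry time `e(σ)`, which is negative if `σ > 0`. As the data are
extended by zero, one formula in `σ` covers both the particles present initially and those that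
enter later.

Testing the weak formulation with smoothed indicators of the region left of a characteristic gives
the mass balance (`integral_eq_primitive`) `∫₀ˣ ρ(t,z) dz = G₀(σ) + Gᵤ(t) - Gᵤ(e(σ))`, where `σ` is
the foot of the characteristic through `(t,x)` and `G₀`, `Gᵤ` are primitives of the data. It is used
twice.

At `x = 1` it expresses `W` through the data and the history of `W`. The primitives are Lipschitz
and feet and entry times depend on `W` in a Lipschitz way, so Gronwall bounds the uniform distance
of two masses by the `L¹` distance of the data (`abs_totalMass_sub_le`).

Its derivative in `x` is an explicit formula for `ρ` (`charRep`), which makes sense for every `x`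
and provides the representative whose trace is the out-flux. In it the merely bounded data are
composed with `t ↦ σ` and `t ↦ e(σ)`. These maps satisfy `|s - t| ≤ C |S s - S t|` with `C`
independent of the mass, so composition is uniformly bounded in `L¹`. After approximation of the
data by continuous functions, convergence of data and mass implies convergence of the compositions
(`tendsto_eLpNorm_comp`). Uniform bounds upgrade `L¹` to `Lᵖ`. This approximation has no rate, so
`η` comes from a sequential argument by contradiction. -/

/-! ### Gronwall's inequality -/

/-- Gronwall's inequality in integral form. -/
theorem le_mul_exp_of_le_add_mul_integral {f : ℝ → ℝ} (hf : Continuous f) {A C a b : ℝ} (hC : 0 ≤ C)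
    (hab : a ≤ b) (h : ∀ r ∈ Icc a b, f r ≤ A + C * ∫ s in a..r, f s) :
    f b ≤ A * Real.exp (C * (b - a)) := by
  -- The right-hand side times its integrating factor; the hypothesis makes its derivative
  -- nonpositive.
  set G : ℝ → ℝ := fun r => (A + C * ∫ s in a..r, f s) * Real.exp (-C * (r - a)) with hG
  have hd : ∀ r, HasDerivAt G ((C * f r) * Real.exp (-C * (r - a))
      + (A + C * ∫ s in a..r, f s) * (Real.exp (-C * (r - a)) * (-C * 1))) r := by
    intro r
    have h1 : HasDerivAt (fun r => A + C * ∫ s in a..r, f s) (C * f r) r :=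
      ((intervalIntegral.integral_hasDerivAt_right (hf.intervalIntegrable _ _)
        hf.aestronglyMeasurable.stronglyMeasurableAtFilter hf.continuousAt).const_mul C).const_add A
    have h2 : HasDerivAt (fun r => Real.exp (-C * (r - a))) (Real.exp (-C * (r - a)) * (-C * 1)) r :=
      (((hasDerivAt_id r).sub_const a).const_mul (-C)).exp
    exact h1.mul h2
  have hanti : AntitoneOn G (Icc a b) := by
    apply antitoneOn_of_deriv_nonpos (convex_Icc a b)
    · exact fun r _ => (hd r).continuousAt.continuousWithinAt
    · exact fun r _ => (hd r).differentiableAt.differentiableWithinAt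
    · intro r hr
      rw [interior_Icc] at hr
      rw [(hd r).deriv]
      have := h r (Ioo_subset_Icc_self hr)
      have h3 := (Real.exp_pos (-C * (r - a))).le
      have h4 : 0 ≤ C * (A + C * (∫ s in a..r, f s) - f r) * Real.exp (-C * (r - a)) :=
        mul_nonneg (mul_nonneg hC (by linarith)) h3
      nlinarith
  have h1 := hanti (left_mem_Icc.2 hab) (right_mem_Icc.2 hab) hab
  simp only [hG, intervalIntegral.integral_same, sub_self, mul_zero, add_zero, Real.exp_zero,
    mul_one] at h1
  have h2 := h b (right_mem_Icc.2 hab)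
  have h3 : Real.exp (-C * (b - a)) * Real.exp (C * (b - a)) = 1 := by
    rw [← Real.exp_add]; simp
  calc f b ≤ A + C * ∫ s in a..b, f s := h2
    _ = (A + C * ∫ s in a..b, f s) * Real.exp (-C * (b - a)) * Real.exp (C * (b - a)) := by
        rw [mul_assoc, h3, mul_one]
    _ ≤ A * Real.exp (C * (b - a)) := by gcongr

theorem le_mul_exp_abs_of_le_add_mul_abs_integral {f : ℝ → ℝ} (hf : Continuous f)
    (hf0 : ∀ r, 0 ≤ f r) {A C a b : ℝ} (hC : 0 ≤ C)
    (h : ∀ r ∈ uIcc a b, f r ≤ A + C * |∫ s in a..r, f s|) :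
    f b ≤ A * Real.exp (C * |b - a|) := by
  rcases le_total a b with hab | hab
  · rw [abs_of_nonneg (sub_nonneg.2 hab)]
    refine le_mul_exp_of_le_add_mul_integral hf hC hab fun r hr => ?_
    have := h r (by rwa [uIcc_of_le hab])
    rwa [abs_of_nonneg (intervalIntegral.integral_nonneg hr.1 fun s _ => hf0 s)] at this
  -- The case `b ≤ a` follows by time reversal.
  · have key := le_mul_exp_of_le_add_mul_integral (f := fun r => f (-r)) (A := A)
      (hf.comp continuous_neg) hC (neg_le_neg hab) (fun r hr => ?_)
    · rw [abs_of_nonpos (sub_nonpos.2 hab)]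
      simp only [neg_neg] at key
      convert key using 3
      ring
    · have hr' : -r ∈ Icc b a := ⟨by linarith [hr.2], by linarith [hr.1]⟩
      have := h (-r) (by rwa [uIcc_of_ge hab])
      rw [intervalIntegral.integral_symm, abs_neg,
        abs_of_nonneg (intervalIntegral.integral_nonneg hr'.2 fun s _ => hf0 s)] at this
      rwa [intervalIntegral.integral_comp_neg, neg_neg]

/-! ### Composition with anti-Lipschitz maps and convergence in `L¹` and `Lᵖ` -/

/-- Lebesgue measure on the line is the one-dimensional Hausdorff measure, which anti-Lipschitz maps
control on preimages. No differentiability of `S` or change of variables is needed. -/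
theorem volume_inter_preimage_le {A : Set ℝ} {S : ℝ → ℝ} {C : ℝ≥0}
    (hS : ∀ x ∈ A, ∀ y ∈ A, |x - y| ≤ C * |S x - S y|) (s : Set ℝ) :
    volume (A ∩ S ⁻¹' s) ≤ C * volume s := by
  have hanti : AntilipschitzWith C (fun a : A => S a) :=
    AntilipschitzWith.of_le_mul_dist fun x y => hS x x.2 y y.2
  have h1 := hanti.hausdorffMeasure_preimage_le (d := 1) zero_le_one s
  have h2 := (isometry_subtype_coe (s := A)).hausdorffMeasure_image (d := 1) (Or.inl zero_le_one)
    ((fun a : A => S a) ⁻¹' s)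
  rw [show ((↑) : A → ℝ) '' ((fun a : A => S a) ⁻¹' s) = A ∩ S ⁻¹' s by
    ext x; simp [and_comm]] at h2
  rw [← h2, hausdorffMeasure_real] at h1
  simpa using h1

theorem lintegral_comp_le {A : Set ℝ} (hA : MeasurableSet A) {S : ℝ → ℝ} {C : ℝ≥0}
    (hS : ∀ x ∈ A, ∀ y ∈ A, |x - y| ≤ C * |S x - S y|) (hm : AEMeasurable S (volume.restrict A))
    {g : ℝ → ℝ≥0∞} (hg : Measurable g) :
    ∫⁻ x in A, g (S x) ≤ C * ∫⁻ y, g y := by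
  have hle : (volume.restrict A).map S ≤ (C : ℝ≥0∞) • volume := by
    refine Measure.le_iff.2 fun s hs => ?_
    rw [Measure.map_apply_of_aemeasurable hm hs, Measure.restrict_apply' hA, inter_comm]
    exact volume_inter_preimage_le hS s
  calc ∫⁻ x in A, g (S x) = ∫⁻ y, g y ∂((volume.restrict A).map S) :=
        (lintegral_map' hg.aemeasurable hm).symm
    _ ≤ ∫⁻ y, g y ∂((C : ℝ≥0∞) • volume) := lintegral_mono' hle le_rfl
    _ = C * ∫⁻ y, g y := by rw [lintegral_smul_measure]; rfl

theorem ae_comp_of_antilipschitz {A : Set ℝ} (hA : MeasurableSet A) {S : ℝ → ℝ} {C : ℝ≥0}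
    (hS : ∀ x ∈ A, ∀ y ∈ A, |x - y| ≤ C * |S x - S y|) {P : ℝ → Prop} (hP : ∀ᵐ y, P y) :
    ∀ᵐ x ∂volume.restrict A, P (S x) := by
  rw [ae_restrict_iff' hA, ae_iff]
  have h := volume_inter_preimage_le hS {y | ¬ P y}
  rw [ae_iff.1 hP, mul_zero, nonpos_iff_eq_zero] at h
  refine measure_mono_null (fun x hx => ?_) h
  simpa using hx

theorem eLpNorm_comp_le {A : Set ℝ} (hA : MeasurableSet A) {S : ℝ → ℝ} {C : ℝ≥0}
    (hS : ∀ x ∈ A, ∀ y ∈ A, |x - y| ≤ C * |S x - S y|) (hm : AEMeasurable S (volume.restrict A))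
    {g : ℝ → ℝ} (hg : Measurable g) :
    eLpNorm (fun x => g (S x)) 1 (volume.restrict A) ≤ C * eLpNorm g 1 volume := by
  rw [eLpNorm_one_eq_lintegral_enorm, eLpNorm_one_eq_lintegral_enorm]
  exact lintegral_comp_le hA hS hm hg.enorm

/-- Dominated convergence, phrased as convergence in `L¹`. -/
theorem tendsto_eLpNorm_one_of_dominated {α ι : Type*} [MeasurableSpace α] {μ : Measure α}
    {l : Filter ι} [l.IsCountablyGenerated] {F : ι → α → ℝ} {f : α → ℝ}
    {bound : α → ℝ} (hb : Integrable bound μ) (hF : ∀ n, AEStronglyMeasurable (F n) μ)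
    (hf : AEStronglyMeasurable f μ)
    (hFb : ∀ᶠ n in l, ∀ᵐ x ∂μ, |F n x - f x| ≤ bound x)
    (hlim : ∀ᵐ x ∂μ, Tendsto (fun n => F n x) l (𝓝 (f x))) :
    Tendsto (fun n => eLpNorm (fun x => F n x - f x) 1 μ) l (𝓝 0) := by
  simp_rw [eLpNorm_one_eq_lintegral_enorm]
  have := tendsto_lintegral_filter_of_dominated_convergence' (l := l) (μ := μ)
    (F := fun n x => ‖F n x - f x‖ₑ) (f := fun _ => 0) (fun x => ‖bound x‖ₑ)
    (Eventually.of_forall fun n => ((hF n).sub hf).enorm) ?_ ?_ ?_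
  · simpa using this
  · filter_upwards [hFb] with n hn
    filter_upwards [hn] with x hx
    rw [enorm_le_iff_norm_le, Real.norm_eq_abs, Real.norm_eq_abs]
    exact hx.trans (le_abs_self _)
  · exact hb.2.ne
  · filter_upwards [hlim] with x hx
    have h1 : Tendsto (fun n => F n x - f x) l (𝓝 0) := by
      simpa using hx.sub_const (f x)
    simpa using h1.enorm

/-- Composition with `S n` is bounded on `L¹` uniformly in `n`, so `f₀` may be replaced by a
continuous function `h` with compact support. For `h`, pointwise convergence of `S n` and dominated
convergence suffice. -/
theorem tendsto_eLpNorm_comp {ι : Type*} {l : Filter ι} [l.IsCountablyGenerated]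
    {A : Set ℝ} (hA : MeasurableSet A) (hfin : volume A ≠ ∞) {C : ℝ≥0}
    {f : ι → ℝ → ℝ} {f₀ : ℝ → ℝ} (hfm : ∀ n, Measurable (f n)) (hf₀ : Integrable f₀)
    (hf₀m : Measurable f₀)
    (hfl : Tendsto (fun n => eLpNorm (fun y => f n y - f₀ y) 1 volume) l (𝓝 0))
    {S : ι → ℝ → ℝ} {S₀ : ℝ → ℝ}
    (hSm : ∀ n, AEMeasurable (S n) (volume.restrict A)) (hS₀m : AEMeasurable S₀ (volume.restrict A))
    (hS : ∀ n, ∀ x ∈ A, ∀ y ∈ A, |x - y| ≤ C * |S n x - S n y|)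
    (hS₀ : ∀ x ∈ A, ∀ y ∈ A, |x - y| ≤ C * |S₀ x - S₀ y|)
    (hSl : ∀ x ∈ A, Tendsto (fun n => S n x) l (𝓝 (S₀ x))) :
    Tendsto (fun n => eLpNorm (fun x => f n (S n x) - f₀ (S₀ x)) 1 (volume.restrict A)) l (𝓝 0) := by
  have : IsFiniteMeasure (volume.restrict A) := ⟨by simpa using hfin.lt_top⟩
  rw [ENNReal.tendsto_nhds_zero]
  intro ε hε
  rcases eq_or_ne ε ∞ with rfl | hεt
  · exact Eventually.of_forall fun _ => le_top
  -- One quarter of `ε` for each of the four terms of `hsplit`; `C + 1` avoids division by zero.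
  obtain ⟨δ, hδ, hδε⟩ : ∃ δ : ℝ≥0∞, 0 < δ ∧ C * δ + (C * δ + ε / 2 / 2 + C * δ) ≤ ε := by
    refine ⟨ε / 2 / 2 / (C + 1), ENNReal.div_pos (ENNReal.half_pos (ENNReal.half_pos hε.ne').ne').ne' (by simp), ?_⟩
    have : (C : ℝ≥0∞) * (ε / 2 / 2 / (C + 1)) ≤ ε / 2 / 2 := by
      calc (C : ℝ≥0∞) * (ε / 2 / 2 / (C + 1)) ≤ (C + 1) * (ε / 2 / 2 / (C + 1)) := by gcongr; simp
        _ = ε / 2 / 2 := ENNReal.mul_div_cancel (by simp) (by simp)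
    calc _ ≤ ε / 2 / 2 + (ε / 2 / 2 + ε / 2 / 2 + ε / 2 / 2) := by gcongr
      _ = ε := by
        rw [← add_assoc, ← add_assoc, ENNReal.add_halves, add_assoc, ENNReal.add_halves,
          ENNReal.add_halves]
  obtain ⟨h, hhs, hhc, hhcont, -⟩ :=
    (memLp_one_iff_integrable.2 hf₀).exists_hasCompactSupport_eLpNorm_sub_le ENNReal.one_ne_top hδ.ne'
  obtain ⟨M, hM⟩ := hhcont.bounded_above_of_compact_support hhs
  have hfh : ∀ {S' : ℝ → ℝ}, AEMeasurable S' (volume.restrict A) →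
      (∀ x ∈ A, ∀ y ∈ A, |x - y| ≤ C * |S' x - S' y|) →
      eLpNorm (fun x => f₀ (S' x) - h (S' x)) 1 (volume.restrict A) ≤ C * δ := fun hm hS' =>
    (eLpNorm_comp_le hA hS' hm (g := fun y => f₀ y - h y) (hf₀m.sub hhcont.measurable)).trans
      (by gcongr; exact hhc)
  have hhl : Tendsto (fun n => eLpNorm (fun x => h (S n x) - h (S₀ x)) 1 (volume.restrict A)) l
      (𝓝 0) := by
    refine tendsto_eLpNorm_one_of_dominated (bound := fun _ => M + M) (integrable_const _)
      (fun n => (hhcont.measurable.comp_aemeasurable (hSm n)).aestronglyMeasurable)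
      (hhcont.measurable.comp_aemeasurable hS₀m).aestronglyMeasurable
      (Eventually.of_forall fun n => Eventually.of_forall fun x =>
        (abs_sub _ _).trans (add_le_add (hM _) (hM _))) ?_
    rw [ae_restrict_iff' hA]
    exact Eventually.of_forall fun x hx => (hhcont.tendsto _).comp (hSl x hx)
  have e4 : (0 : ℝ≥0∞) < ε / 2 / 2 := ENNReal.half_pos (ENNReal.half_pos hε.ne').ne'
  filter_upwards [ENNReal.tendsto_nhds_zero.1 hhl _ e4, ENNReal.tendsto_nhds_zero.1 hfl _ hδ]
    with n hn1 hn2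
  refine le_trans ?_ hδε
  have m1 : AEStronglyMeasurable (fun x => f n (S n x) - f₀ (S n x)) (volume.restrict A) :=
    (((hfm n).sub hf₀m).comp_aemeasurable (hSm n)).aestronglyMeasurable
  have m2 : AEStronglyMeasurable (fun x => f₀ (S n x) - h (S n x)) (volume.restrict A) :=
    ((hf₀m.sub hhcont.measurable).comp_aemeasurable (hSm n)).aestronglyMeasurable
  have m3 : AEStronglyMeasurable (fun x => h (S n x) - h (S₀ x)) (volume.restrict A) :=
    ((hhcont.measurable.comp_aemeasurable (hSm n)).sub
      (hhcont.measurable.comp_aemeasurable hS₀m)).aestronglyMeasurable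
  have m4 : AEStronglyMeasurable (fun x => f₀ (S₀ x) - h (S₀ x)) (volume.restrict A) :=
    ((hf₀m.sub hhcont.measurable).comp_aemeasurable hS₀m).aestronglyMeasurable
  have hsplit : (fun x => f n (S n x) - f₀ (S₀ x)) =
      (fun x => f n (S n x) - f₀ (S n x)) + (((fun x => f₀ (S n x) - h (S n x))
        + (fun x => h (S n x) - h (S₀ x))) - (fun x => f₀ (S₀ x) - h (S₀ x))) := by
    ext x; simp
  rw [hsplit]
  refine (eLpNorm_add_le m1 ((m2.add m3).sub m4) le_rfl).trans (add_le_add ?_ ?_)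
  · exact (eLpNorm_comp_le hA (hS n) (hSm n) (g := fun y => f n y - f₀ y)
      ((hfm n).sub hf₀m)).trans (by gcongr)
  refine (eLpNorm_sub_le (m2.add m3) m4 le_rfl).trans (add_le_add ?_ (hfh hS₀m hS₀))
  exact (eLpNorm_add_le m2 m3 le_rfl).trans (add_le_add (hfh (hSm n) (hS n)) hn1)

/-- The factors `a n` are bounded by `M`, so the error of the composition is multiplied by at most
`M`; the error of the factors against the fixed `f₀ ∘ S₀` tends to zero by dominated convergence. -/
theorem tendsto_eLpNorm_mul_comp {ι : Type*} {l : Filter ι} [l.IsCountablyGenerated]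
    {A : Set ℝ} (hA : MeasurableSet A) (hfin : volume A ≠ ∞) {C : ℝ≥0}
    {f : ι → ℝ → ℝ} {f₀ : ℝ → ℝ} (hfm : ∀ n, Measurable (f n)) (hf₀ : Integrable f₀)
    (hf₀m : Measurable f₀)
    (hfl : Tendsto (fun n => eLpNorm (fun y => f n y - f₀ y) 1 volume) l (𝓝 0))
    {S : ι → ℝ → ℝ} {S₀ : ℝ → ℝ}
    (hSm : ∀ n, AEMeasurable (S n) (volume.restrict A)) (hS₀m : AEMeasurable S₀ (volume.restrict A))
    (hS : ∀ n, ∀ x ∈ A, ∀ y ∈ A, |x - y| ≤ C * |S n x - S n y|)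
    (hS₀ : ∀ x ∈ A, ∀ y ∈ A, |x - y| ≤ C * |S₀ x - S₀ y|)
    (hSl : ∀ x ∈ A, Tendsto (fun n => S n x) l (𝓝 (S₀ x)))
    {a : ι → ℝ → ℝ} {a₀ : ℝ → ℝ} {M : ℝ≥0}
    (ham : ∀ n, AEStronglyMeasurable (a n) (volume.restrict A))
    (ha₀m : AEStronglyMeasurable a₀ (volume.restrict A))
    (hab : ∀ n, ∀ x ∈ A, |a n x| ≤ M) (hab₀ : ∀ x ∈ A, |a₀ x| ≤ M)
    (hal : ∀ x ∈ A, Tendsto (fun n => a n x) l (𝓝 (a₀ x))) :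
    Tendsto (fun n => eLpNorm (fun x => a n x * f n (S n x) - a₀ x * f₀ (S₀ x)) 1
      (volume.restrict A)) l (𝓝 0) := by
  have h1 := tendsto_eLpNorm_comp hA hfin hfm hf₀ hf₀m hfl hSm hS₀m hS hS₀ hSl
  have mf := (hf₀m.comp_aemeasurable hS₀m).aestronglyMeasurable
  have if₀ : Integrable (fun x => f₀ (S₀ x)) (volume.restrict A) := by
    refine ⟨mf, ?_⟩
    exact (lintegral_comp_le hA hS₀ hS₀m hf₀m.enorm).trans_lt
      (ENNReal.mul_lt_top ENNReal.coe_lt_top hf₀.2)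
  have h2 : Tendsto (fun n => eLpNorm (fun x => a n x * f₀ (S₀ x) - a₀ x * f₀ (S₀ x)) 1
      (volume.restrict A)) l (𝓝 0) := by
    refine tendsto_eLpNorm_one_of_dominated (bound := fun x => (M + M) * |f₀ (S₀ x)|)
      (if₀.abs.const_mul _) (fun n => (ham n).mul mf) (ha₀m.mul mf)
      (Eventually.of_forall fun n => ?_) ?_
    · rw [ae_restrict_iff' hA]
      refine Eventually.of_forall fun x hx => ?_
      rw [← sub_mul, abs_mul]
      gcongr
      exact (abs_sub _ _).trans (add_le_add (hab n x hx) (hab₀ x hx))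
    · rw [ae_restrict_iff' hA]
      exact Eventually.of_forall fun x hx => (hal x hx).mul_const _
  have h3 : Tendsto (fun n => (M : ℝ≥0∞) * eLpNorm (fun x => f n (S n x) - f₀ (S₀ x)) 1
      (volume.restrict A) + eLpNorm (fun x => a n x * f₀ (S₀ x) - a₀ x * f₀ (S₀ x)) 1
      (volume.restrict A)) l (𝓝 0) := by
    have := (ENNReal.Tendsto.const_mul (a := (M : ℝ≥0∞)) h1 (Or.inr ENNReal.coe_ne_top)).add h2
    simpa using this
  refine tendsto_of_tendsto_of_tendsto_of_le_of_le tendsto_const_nhds h3 (fun _ => bot_le)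
    fun n => ?_
  have m1 : AEStronglyMeasurable (fun x => f n (S n x) - f₀ (S₀ x)) (volume.restrict A) :=
    (((hfm n).comp_aemeasurable (hSm n)).aestronglyMeasurable).sub mf
  have hsplit : (fun x => a n x * f n (S n x) - a₀ x * f₀ (S₀ x)) =
      (fun x => a n x * (f n (S n x) - f₀ (S₀ x)))
        + (fun x => a n x * f₀ (S₀ x) - a₀ x * f₀ (S₀ x)) := by
    ext x; simp; ring
  simp only [hsplit]
  refine (eLpNorm_add_le ((ham n).mul m1) (((ham n).mul mf).sub (ha₀m.mul mf)) le_rfl).trans ?_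
  refine add_le_add ?_ le_rfl
  have := eLpNorm_le_nnreal_smul_eLpNorm_of_ae_le_mul (μ := volume.restrict A) (c := M)
    (f := fun x => a n x * (f n (S n x) - f₀ (S₀ x))) (g := fun x => f n (S n x) - f₀ (S₀ x)) ?_ 1
  · exact this
  · rw [ae_restrict_iff' hA]
    refine Eventually.of_forall fun x hx => ?_
    rw [nnnorm_mul]
    gcongr
    exact_mod_cast hab n x hx

/-- Pointwise, `|f|ᵖ ≤ Mᵖ⁻¹ |f|`. This reduces all later convergence in `Lᵖ` to convergence in `L¹`.
-/
theorem eLpNorm_le_of_bounded {α : Type*} [MeasurableSpace α] {μ : Measure α} {f : α → ℝ}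
    {M : ℝ≥0} (hM : ∀ᵐ x ∂μ, |f x| ≤ M) {p : ℝ≥0∞} (hp : 1 ≤ p) (hp' : p ≠ ∞) :
    eLpNorm f p μ ≤ ((M : ℝ≥0∞) ^ (p.toReal - 1) * eLpNorm f 1 μ) ^ (1 / p.toReal) := by
  have hp1 : 1 ≤ p.toReal := by
    have := ENNReal.toReal_mono hp' hp
    simpa using this
  rw [eLpNorm_eq_lintegral_rpow_enorm_toReal (by positivity) hp', eLpNorm_one_eq_lintegral_enorm]
  refine ENNReal.rpow_le_rpow ?_ (by positivity)
  rw [← lintegral_const_mul' _ _ (ENNReal.rpow_ne_top_of_nonneg (by linarith) ENNReal.coe_ne_top)]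
  refine lintegral_mono_ae ?_
  filter_upwards [hM] with x hx
  have h1 : ‖f x‖ₑ ≤ M := by
    rw [enorm_le_coe]
    exact_mod_cast hx
  calc ‖f x‖ₑ ^ p.toReal = ‖f x‖ₑ ^ (p.toReal - 1 + 1) := by ring_nf
    _ = ‖f x‖ₑ ^ (p.toReal - 1) * ‖f x‖ₑ := by
        rw [ENNReal.rpow_add_of_nonneg _ _ (by linarith) zero_le_one, ENNReal.rpow_one]
    _ ≤ _ := by gcongr

theorem tendsto_eLpNorm_of_bounded {α ι : Type*} [MeasurableSpace α] {μ : Measure α} {l : Filter ι}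
    {f : ι → α → ℝ} {M : ℝ≥0} (hM : ∀ᶠ n in l, ∀ᵐ x ∂μ, |f n x| ≤ M) {p : ℝ≥0∞} (hp : 1 ≤ p)
    (hp' : p ≠ ∞) (hf : Tendsto (fun n => eLpNorm (f n) 1 μ) l (𝓝 0)) :
    Tendsto (fun n => eLpNorm (f n) p μ) l (𝓝 0) := by
  have hp1 : 1 ≤ p.toReal := by
    have := ENNReal.toReal_mono hp' hp
    simpa using this
  have h1 : Tendsto (fun n => ((M : ℝ≥0∞) ^ (p.toReal - 1) * eLpNorm (f n) 1 μ) ^ (1 / p.toReal)) l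
      (𝓝 0) := by
    have h2 := ENNReal.Tendsto.const_mul (a := (M : ℝ≥0∞) ^ (p.toReal - 1)) hf
      (Or.inr (ENNReal.rpow_ne_top_of_nonneg (by linarith) ENNReal.coe_ne_top))
    have h3 := (ENNReal.continuous_rpow_const (y := 1 / p.toReal)).tendsto _ |>.comp h2
    simpa [Function.comp_def, ENNReal.zero_rpow_of_pos (show 0 < p.toReal⁻¹ by positivity)] using h3
  refine tendsto_of_tendsto_of_tendsto_of_le_of_le' tendsto_const_nhds h1
    (Eventually.of_forall fun _ => bot_le) ?_
  filter_upwards [hM] with n hn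
  exact eLpNorm_le_of_bounded hn hp hp'

/-! ### Regular velocities and their characteristics -/

/-- A velocity on all of `ℝ × ℝ` that is bounded, bounded away from zero, Lipschitz, independent of
the position for `x ≤ 0`, and continuously differentiable in the position for `0 < x < 1`. -/
structure RegularVelocity (v μ : ℝ → ℝ → ℝ) (c Λ L : ℝ) : Prop where
  pos : 0 < c
  lower : ∀ x w, c ≤ v x w
  upper : ∀ x w, v x w ≤ Λ
  lip : ∀ x w x' w', |v x w - v x' w'| ≤ L * (|x - x'| + |w - w'|)
  left : ∀ x ≤ 0, ∀ w, v x w = v 0 w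
  hasDerivAt : ∀ x ∈ Ioo (0 : ℝ) 1, ∀ w, HasDerivAt (fun z => v z w) (μ x w) x
  cont : Continuous fun q : ℝ × ℝ => μ q.1 q.2
  bound : ∀ x w, |μ x w| ≤ L

/-- Characteristics of the velocity `v` for the total mass `w`. -/
def IsChar (v : ℝ → ℝ → ℝ) (w : ℝ → ℝ) (ξ : ℝ → ℝ) : Prop :=
  ∀ s, HasDerivAt ξ (v (ξ s) (w s)) s

namespace RegularVelocity

variable {v μ : ℝ → ℝ → ℝ} {c Λ L : ℝ}

theorem L_nonneg (h : RegularVelocity v μ c Λ L) : 0 ≤ L := (abs_nonneg _).trans (h.bound 0 0)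

theorem Λ_pos (h : RegularVelocity v μ c Λ L) : 0 < Λ :=
  h.pos.trans_le ((h.lower 0 0).trans (h.upper 0 0))

theorem pos' (h : RegularVelocity v μ c Λ L) (x w : ℝ) : 0 < v x w := h.pos.trans_le (h.lower x w)

theorem continuous_uncurry (h : RegularVelocity v μ c Λ L) :
    Continuous fun q : ℝ × ℝ => v q.1 q.2 := by
  rw [continuous_iff_continuousAt]
  intro q
  rw [ContinuousAt, tendsto_iff_dist_tendsto_zero]
  have h1 : Tendsto (fun p : ℝ × ℝ => L * (|p.1 - q.1| + |p.2 - q.2|)) (𝓝 q) (𝓝 0) := by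
    have : Continuous fun p : ℝ × ℝ => L * (|p.1 - q.1| + |p.2 - q.2|) := by fun_prop
    simpa using this.tendsto q
  exact squeeze_zero (fun _ => dist_nonneg) (fun p => h.lip _ _ _ _) h1

theorem continuous_comp (h : RegularVelocity v μ c Λ L) {α : Type*} [TopologicalSpace α]
    {f g : α → ℝ} (hf : Continuous f) (hg : Continuous g) : Continuous fun a => v (f a) (g a) :=
  h.continuous_uncurry.comp (hf.prodMk hg)

end RegularVelocity

namespace IsChar

variable {v μ : ℝ → ℝ → ℝ} {c Λ L : ℝ} {w ξ : ℝ → ℝ}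

theorem continuous (hξ : IsChar v w ξ) : Continuous ξ :=
  continuous_iff_continuousAt.2 fun s => (hξ s).continuousAt

theorem contDiff (hξ : IsChar v w ξ) (h : RegularVelocity v μ c Λ L) (hw : Continuous w) :
    ContDiff ℝ 1 ξ := by
  rw [contDiff_one_iff_deriv]
  refine ⟨fun s => (hξ s).differentiableAt, ?_⟩
  rw [show deriv ξ = fun s => v (ξ s) (w s) from funext fun s => (hξ s).deriv]
  exact h.continuous_comp hξ.continuous hw

theorem lower (hξ : IsChar v w ξ) (h : RegularVelocity v μ c Λ L) {s t : ℝ} (hst : s ≤ t) :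
    c * (t - s) ≤ ξ t - ξ s :=
  mul_sub_le_image_sub_of_le_deriv (fun s => (hξ s).differentiableAt)
    (fun s => by rw [(hξ s).deriv]; exact h.lower _ _) hst

theorem strictMono (hξ : IsChar v w ξ) (h : RegularVelocity v μ c Λ L) : StrictMono ξ := by
  intro s t hst
  have := hξ.lower h hst.le
  have := mul_pos h.pos (sub_pos.2 hst)
  linarith

theorem abs_sub_le (hξ : IsChar v w ξ) (h : RegularVelocity v μ c Λ L) (s t : ℝ) :
    |ξ t - ξ s| ≤ Λ * |t - s| := by
  have : ∀ s t, s ≤ t → |ξ t - ξ s| ≤ Λ * |t - s| := by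
    intro s t hst
    rw [abs_of_nonneg (sub_nonneg.2 ((hξ.strictMono h).monotone hst)),
      abs_of_nonneg (sub_nonneg.2 hst)]
    exact image_sub_le_mul_sub_of_deriv_le (fun s => (hξ s).differentiableAt)
      (fun s => by rw [(hξ s).deriv]; exact h.upper _ _) hst
  rcases le_total s t with hst | hst
  · exact this s t hst
  · rw [abs_sub_comm, abs_sub_comm t]; exact this t s hst

theorem integral_eq (hξ : IsChar v w ξ) (h : RegularVelocity v μ c Λ L) (hw : Continuous w)
    (s t : ℝ) : ∫ r in s..t, v (ξ r) (w r) = ξ t - ξ s :=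
  intervalIntegral.integral_eq_sub_of_hasDerivAt (fun r _ => hξ r)
    ((h.continuous_comp hξ.continuous hw).intervalIntegrable _ _)

/-- Continuous dependence of characteristics on their starting point and on the total mass. -/
theorem abs_sub_le_exp (h : RegularVelocity v μ c Λ L) {w₁ w₂ ξ₁ ξ₂ : ℝ → ℝ}
    (hw₁ : Continuous w₁) (hw₂ : Continuous w₂) (h₁ : IsChar v w₁ ξ₁) (h₂ : IsChar v w₂ ξ₂)
    (t s : ℝ) :
    |ξ₁ s - ξ₂ s| ≤ (|ξ₁ t - ξ₂ t| + L * |(∫ r in t..s, |w₁ r - w₂ r|)|) * Real.exp (L * |s - t|) := by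
  have hc₁ := h₁.continuous
  have hc₂ := h₂.continuous
  have hL := h.L_nonneg
  refine le_mul_exp_abs_of_le_add_mul_abs_integral (f := fun s => |ξ₁ s - ξ₂ s|) (by fun_prop)
    (fun _ => abs_nonneg _) hL fun r hr => ?_
  -- Integral form of the difference of the two equations; the Lipschitz bound of `v` then gives
  -- Gronwall's hypothesis.
  have e1 : ξ₁ r - ξ₂ r = (ξ₁ t - ξ₂ t) + ∫ q in t..r, (v (ξ₁ q) (w₁ q) - v (ξ₂ q) (w₂ q)) := by
    rw [intervalIntegral.integral_sub ((h.continuous_comp hc₁ hw₁).intervalIntegrable _ _)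
      ((h.continuous_comp hc₂ hw₂).intervalIntegrable _ _), h₁.integral_eq h hw₁,
      h₂.integral_eq h hw₂]
    ring
  have i1 : ∀ a b, IntervalIntegrable (fun q => |ξ₁ q - ξ₂ q|) volume a b := fun a b =>
    Continuous.intervalIntegrable (by fun_prop) _ _
  have i2 : ∀ a b, IntervalIntegrable (fun q => |w₁ q - w₂ q|) volume a b := fun a b =>
    Continuous.intervalIntegrable (by fun_prop) _ _
  have e2 : |∫ q in t..r, (v (ξ₁ q) (w₁ q) - v (ξ₂ q) (w₂ q))|
      ≤ |(∫ q in t..r, L * (|ξ₁ q - ξ₂ q| + |w₁ q - w₂ q|))| := by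
    have := intervalIntegral.norm_integral_le_abs_of_norm_le (μ := volume) (a := t) (b := r)
      (f := fun q => v (ξ₁ q) (w₁ q) - v (ξ₂ q) (w₂ q))
      (g := fun q => L * (|ξ₁ q - ξ₂ q| + |w₁ q - w₂ q|))
      (Eventually.of_forall fun q => h.lip _ _ _ _) (((i1 _ _).add (i2 _ _)).const_mul L)
    exact this
  have e3 : |(∫ q in t..r, L * (|ξ₁ q - ξ₂ q| + |w₁ q - w₂ q|))|
      ≤ L * |(∫ q in t..r, |ξ₁ q - ξ₂ q|)| + L * |(∫ q in t..r, |w₁ q - w₂ q|)| := by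
    rw [intervalIntegral.integral_const_mul, intervalIntegral.integral_add (i1 _ _) (i2 _ _),
      abs_mul, abs_of_nonneg hL, ← mul_add]
    gcongr
    exact abs_add_le _ _
  have e4 : |(∫ q in t..r, |w₁ q - w₂ q|)| ≤ |(∫ q in t..s, |w₁ q - w₂ q|)| :=
    intervalIntegral.abs_integral_mono_interval (uIoc_subset_uIoc_of_uIcc_subset_uIcc
      (uIcc_subset_uIcc_left hr)) (Eventually.of_forall fun q => abs_nonneg _) (i2 _ _)
  have e5 : |ξ₁ r - ξ₂ r| ≤ |ξ₁ t - ξ₂ t| + |∫ q in t..r, (v (ξ₁ q) (w₁ q) - v (ξ₂ q) (w₂ q))| := by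
    rw [e1]; exact abs_add_le _ _
  have := mul_le_mul_of_nonneg_left e4 hL
  linarith

theorem abs_sub_le_exp_same (h : RegularVelocity v μ c Λ L) {ξ₁ ξ₂ : ℝ → ℝ}
    (hw : Continuous w) (h₁ : IsChar v w ξ₁) (h₂ : IsChar v w ξ₂) (t s : ℝ) :
    |ξ₁ s - ξ₂ s| ≤ |ξ₁ t - ξ₂ t| * Real.exp (L * |s - t|) := by
  simpa using abs_sub_le_exp h hw hw h₁ h₂ t s

theorem eq_of_eq (h : RegularVelocity v μ c Λ L) {ξ₁ ξ₂ : ℝ → ℝ}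
    (hw : Continuous w) (h₁ : IsChar v w ξ₁) (h₂ : IsChar v w ξ₂) {t : ℝ} (ht : ξ₁ t = ξ₂ t) :
    ξ₁ = ξ₂ := by
  ext s
  have := abs_sub_le_exp_same h hw h₁ h₂ t s
  rw [ht, sub_self, abs_zero, zero_mul] at this
  exact sub_eq_zero.1 (abs_nonpos_iff.1 this)

/-- Otherwise the two characteristics would meet by the intermediate value theorem, and then
coincide by uniqueness. -/
theorem lt_of_lt (h : RegularVelocity v μ c Λ L) {ξ₁ ξ₂ : ℝ → ℝ}
    (hw : Continuous w) (h₁ : IsChar v w ξ₁) (h₂ : IsChar v w ξ₂) {t : ℝ} (ht : ξ₁ t < ξ₂ t)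
    (s : ℝ) : ξ₁ s < ξ₂ s := by
  by_contra! hs
  have hcont : Continuous fun s => ξ₂ s - ξ₁ s := h₂.continuous.sub h₁.continuous
  have := intermediate_value_uIcc (a := s) (b := t) hcont.continuousOn
  obtain ⟨r, -, hr⟩ := this (show (0 : ℝ) ∈ uIcc _ _ by
    rw [mem_uIcc]; left; constructor <;> linarith)
  have heq := eq_of_eq h hw h₁ h₂ (t := r) (by simp only at hr; linarith)
  rw [heq] at ht
  exact lt_irrefl _ ht

end IsChar

/-- Characteristics exist globally. -/
theorem RegularVelocity.exists_isChar {v μ : ℝ → ℝ → ℝ} {c Λ L : ℝ}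
    (h : RegularVelocity v μ c Λ L) {w : ℝ → ℝ} (hw : Continuous w) (t x : ℝ) :
    ∃ ξ, ξ t = x ∧ IsChar v w ξ := by
  have hL := h.L_nonneg
  have hΛ := h.Λ_pos.le
  have hlip : ∀ s, LipschitzWith L.toNNReal (fun x => v x (w s)) := fun s =>
    LipschitzWith.of_dist_le_mul fun x y => by
      have := h.lip x (w s) y (w s)
      simpa [Real.dist_eq, Real.coe_toNNReal _ hL] using this
  have hloc : ∀ N : ℕ, ∃ ξ : ℝ → ℝ, ξ t = x ∧ ∀ s ∈ Ioo (t - (N + 1)) (t + (N + 1)),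
      HasDerivAt ξ (v (ξ s) (w s)) s := by
    intro N
    have hN : (0 : ℝ) < N + 1 := by positivity
    -- The speed is at most `Λ`, so a ball of radius `Λ * (N + 1)` contains the solution on the
    -- whole time interval: its length needs no restriction.
    have hP : IsPicardLindelof (fun s x => v x (w s)) (tmin := t - (N + 1)) (tmax := t + (N + 1))
        ⟨t, by constructor <;> linarith⟩ x (Λ * (N + 1)).toNNReal 0 Λ.toNNReal L.toNNReal := by
      refine ⟨fun s _ => (hlip s).lipschitzOnWith, fun y _ =>
        (h.continuous_comp continuous_const hw).continuousOn, fun s _ y _ => ?_, ?_⟩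
      · rw [Real.norm_eq_abs, abs_of_pos (h.pos' _ _), Real.coe_toNNReal _ hΛ]
        exact h.upper _ _
      · rw [Real.coe_toNNReal _ hΛ, Real.coe_toNNReal _ (by positivity)]
        simp
    obtain ⟨ξ, h0, hξ⟩ := hP.exists_eq_forall_mem_Icc_hasDerivWithinAt₀
    exact ⟨ξ, h0, fun s hs => (hξ s (Ioo_subset_Icc_self hs)).hasDerivAt (Icc_mem_nhds hs.1 hs.2)⟩
  choose ξ h0 hξ using hloc
  have huniq : ∀ N M : ℕ, N ≤ M → ∀ s ∈ Ioo (t - (N + 1)) (t + (N + 1 : ℝ)), ξ N s = ξ M s := by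
    intro N M hNM
    have hNM' : (N : ℝ) ≤ M := by exact_mod_cast hNM
    have hN : (0 : ℝ) < N + 1 := by positivity
    refine ODE_solution_unique_of_mem_Ioo (v := fun s x => v x (w s)) (s := fun _ => univ)
      (t₀ := t) (K := L.toNNReal) (fun s _ => (hlip s).lipschitzOnWith)
      (by constructor <;> linarith) (fun s hs => ⟨hξ N s hs, mem_univ _⟩)
      (fun s hs => ⟨hξ M s ⟨by linarith [hs.1], by linarith [hs.2]⟩, mem_univ _⟩) ?_
    rw [h0, h0]
  have hmem : ∀ s, s ∈ Ioo (t - ((⌈|s - t|⌉₊ : ℕ) + 1)) (t + ((⌈|s - t|⌉₊ : ℕ) + 1 : ℝ)) := by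
    intro s
    have := Nat.le_ceil (|s - t|)
    have h1 := le_abs_self (s - t)
    have h2 := neg_abs_le (s - t)
    constructor <;> linarith
  -- At time `s`, use a local solution whose interval contains `s`. The index may jump near `s`, but
  -- by `huniq` the local solutions agree there.
  refine ⟨fun s => ξ ⌈|s - t|⌉₊ s, h0 _, fun s => ?_⟩
  set N := ⌈|s - t|⌉₊ with hN
  have key : ∀ᶠ r in 𝓝 s, ξ ⌈|r - t|⌉₊ r = ξ N r := by
    filter_upwards [isOpen_Ioo.mem_nhds (hmem s)] with r hr
    rcases le_total ⌈|r - t|⌉₊ N with hle | hle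
    · exact huniq _ _ hle r (hmem r)
    · exact (huniq _ _ hle r hr).symm
  exact (hξ N s (hmem s)).congr_of_eventuallyEq key

open Classical in
/-- The characteristic through `(t, x)`. -/
noncomputable def flow (v : ℝ → ℝ → ℝ) (w : ℝ → ℝ) (t x : ℝ) : ℝ → ℝ :=
  if h : ∃ ξ : ℝ → ℝ, ξ t = x ∧ IsChar v w ξ then h.choose else fun _ => 0

theorem flow_self {v μ : ℝ → ℝ → ℝ} {c Λ L : ℝ} (h : RegularVelocity v μ c Λ L) {w : ℝ → ℝ}
    (hw : Continuous w) (t x : ℝ) : flow v w t x t = x := by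
  rw [flow, dif_pos (h.exists_isChar hw t x)]
  exact (h.exists_isChar hw t x).choose_spec.1

theorem isChar_flow {v μ : ℝ → ℝ → ℝ} {c Λ L : ℝ} (h : RegularVelocity v μ c Λ L) {w : ℝ → ℝ}
    (hw : Continuous w) (t x : ℝ) : IsChar v w (flow v w t x) := by
  rw [flow, dif_pos (h.exists_isChar hw t x)]
  exact (h.exists_isChar hw t x).choose_spec.2

/-! ### Entry times and feet of characteristics -/

/-- The displacement up to time `s` of a particle that moves with the velocity at `x = 0`. -/
noncomputable def inletShift (v : ℝ → ℝ → ℝ) (w : ℝ → ℝ) (s : ℝ) : ℝ := ∫ r in (0 : ℝ)..s, v 0 (w r)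

/-- The time at which the particle that starts from `σ` at time `0` and moves with the velocity at
`x = 0` reaches `x = 0`. -/
noncomputable def entryTime (v : ℝ → ℝ → ℝ) (w : ℝ → ℝ) (σ : ℝ) : ℝ :=
  Function.invFun (inletShift v w) (-σ)

/-- The position at time `0` of the characteristic through `(t, x)`. -/
noncomputable def foot (v : ℝ → ℝ → ℝ) (w : ℝ → ℝ) (t x : ℝ) : ℝ := flow v w t x 0

/-- The derivative of `foot` with respect to `x`. -/
noncomputable def footDeriv (v μ : ℝ → ℝ → ℝ) (w : ℝ → ℝ) (t x : ℝ) : ℝ :=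
  Real.exp (-∫ s in (0 : ℝ)..t, if 0 < flow v w t x s then μ (flow v w t x s) (w s) else 0)

section

variable {v μ : ℝ → ℝ → ℝ} {c Λ L : ℝ} {w : ℝ → ℝ}

theorem hasDerivAt_inletShift (h : RegularVelocity v μ c Λ L) (hw : Continuous w) (s : ℝ) :
    HasDerivAt (inletShift v w) (v 0 (w s)) s := by
  have hc : Continuous fun r => v 0 (w r) := h.continuous_comp continuous_const hw
  exact intervalIntegral.integral_hasDerivAt_right (hc.intervalIntegrable _ _)
    hc.aestronglyMeasurable.stronglyMeasurableAtFilter hc.continuousAt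

@[simp] theorem inletShift_zero : inletShift v w 0 = 0 := by simp [inletShift]

theorem inletShift_lower (h : RegularVelocity v μ c Λ L) (hw : Continuous w) {s t : ℝ}
    (hst : s ≤ t) : c * (t - s) ≤ inletShift v w t - inletShift v w s :=
  mul_sub_le_image_sub_of_le_deriv (fun s => (hasDerivAt_inletShift h hw s).differentiableAt)
    (fun s => by rw [(hasDerivAt_inletShift h hw s).deriv]; exact h.lower _ _) hst

theorem inletShift_strictMono (h : RegularVelocity v μ c Λ L) (hw : Continuous w) :
    StrictMono (inletShift v w) := by
  intro s t hst
  have := inletShift_lower h hw hst.le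
  have := mul_pos h.pos (sub_pos.2 hst)
  linarith

theorem inletShift_lower_abs (h : RegularVelocity v μ c Λ L) (hw : Continuous w) (s t : ℝ) :
    c * |t - s| ≤ |inletShift v w t - inletShift v w s| := by
  have : ∀ s t, s ≤ t → c * |t - s| ≤ |inletShift v w t - inletShift v w s| := fun s t hst => by
    rw [abs_of_nonneg (sub_nonneg.2 hst)]
    exact (inletShift_lower h hw hst).trans (le_abs_self _)
  rcases le_total s t with hst | hst
  · exact this s t hst
  · rw [abs_sub_comm, abs_sub_comm (inletShift v w t)]; exact this t s hst

theorem inletShift_upper_abs (h : RegularVelocity v μ c Λ L) (hw : Continuous w) (s t : ℝ) :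
    |inletShift v w t - inletShift v w s| ≤ Λ * |t - s| := by
  have : ∀ s t, s ≤ t → |inletShift v w t - inletShift v w s| ≤ Λ * |t - s| := fun s t hst => by
    rw [abs_of_nonneg (sub_nonneg.2 hst),
      abs_of_nonneg (sub_nonneg.2 ((inletShift_strictMono h hw).monotone hst))]
    exact image_sub_le_mul_sub_of_deriv_le
      (fun s => (hasDerivAt_inletShift h hw s).differentiableAt)
      (fun s => by rw [(hasDerivAt_inletShift h hw s).deriv]; exact h.upper _ _) hst
  rcases le_total s t with hst | hst
  · exact this s t hst
  · rw [abs_sub_comm, abs_sub_comm t]; exact this t s hst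

theorem continuous_inletShift (h : RegularVelocity v μ c Λ L) (hw : Continuous w) :
    Continuous (inletShift v w) :=
  continuous_iff_continuousAt.2 fun s => (hasDerivAt_inletShift h hw s).continuousAt

theorem inletShift_surjective (h : RegularVelocity v μ c Λ L) (hw : Continuous w) :
    Function.Surjective (inletShift v w) := by
  refine (continuous_inletShift h hw).surjective ?_ ?_
  · refine tendsto_atTop_mono' _ ?_ (tendsto_id.const_mul_atTop h.pos)
    filter_upwards [eventually_ge_atTop 0] with s hs
    simpa using inletShift_lower h hw hs
  · refine tendsto_atBot_mono' _ ?_ (tendsto_id.const_mul_atBot h.pos)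
    filter_upwards [eventually_le_atBot 0] with s hs
    have := inletShift_lower h hw hs
    simp only [inletShift_zero, id] at this ⊢
    linarith

theorem inletShift_entryTime (h : RegularVelocity v μ c Λ L) (hw : Continuous w) (σ : ℝ) :
    inletShift v w (entryTime v w σ) = -σ :=
  Function.invFun_eq (inletShift_surjective h hw _)

theorem entryTime_lt_iff (h : RegularVelocity v μ c Λ L) (hw : Continuous w) (σ s : ℝ) :
    entryTime v w σ < s ↔ 0 < σ + inletShift v w s := by
  rw [← (inletShift_strictMono h hw).lt_iff_lt, inletShift_entryTime h hw]
  constructor <;> intro <;> linarith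

theorem abs_sub_le_entryTime (h : RegularVelocity v μ c Λ L) (hw : Continuous w) (σ σ' : ℝ) :
    |σ - σ'| ≤ Λ * |entryTime v w σ - entryTime v w σ'| := by
  have := inletShift_upper_abs h hw (entryTime v w σ') (entryTime v w σ)
  rw [inletShift_entryTime h hw, inletShift_entryTime h hw, neg_sub_neg, abs_sub_comm] at this
  exact this

theorem entryTime_sub_le (h : RegularVelocity v μ c Λ L) (hw : Continuous w) (σ σ' : ℝ) :
    c * |entryTime v w σ - entryTime v w σ'| ≤ |σ - σ'| := by
  have := inletShift_lower_abs h hw (entryTime v w σ') (entryTime v w σ)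
  rw [inletShift_entryTime h hw, inletShift_entryTime h hw, neg_sub_neg, abs_sub_comm σ'] at this
  exact this

theorem continuous_entryTime (h : RegularVelocity v μ c Λ L) (hw : Continuous w) :
    Continuous (entryTime v w) := by
  refine (LipschitzWith.of_dist_le_mul (K := (1 / c).toNNReal) fun x y => ?_).continuous
  rw [Real.coe_toNNReal _ (one_div_pos.2 h.pos).le, one_div_mul_eq_div, le_div_iff₀' h.pos]
  exact entryTime_sub_le h hw x y

theorem hasDerivAt_entryTime (h : RegularVelocity v μ c Λ L) (hw : Continuous w) (σ : ℝ) :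
    HasDerivAt (entryTime v w) (-(v 0 (w (entryTime v w σ)))⁻¹) σ := by
  have h1 : HasDerivAt (fun s => -inletShift v w s) (-(v 0 (w (entryTime v w σ))))
      (entryTime v w σ) := (hasDerivAt_inletShift h hw _).neg
  have h2 := h1.of_local_left_inverse (continuous_entryTime h hw).continuousAt
    (neg_ne_zero.2 (h.pos' _ _).ne')
    (Eventually.of_forall fun y => by rw [inletShift_entryTime h hw, neg_neg])
  rwa [inv_neg] at h2

/-- A characteristic enters `x > 0` at its entry time. -/
theorem IsChar.pos_iff {ξ : ℝ → ℝ} (hξ : IsChar v w ξ) (h : RegularVelocity v μ c Λ L)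
    (hw : Continuous w) {s : ℝ} (hs : 0 ≤ s) : 0 < ξ s ↔ entryTime v w (ξ 0) < s := by
  -- Left of `x = 0` the velocity does not depend on the position, so the characteristic is a
  -- translate of `inletShift`.
  have hneg : ∀ r, 0 ≤ r → ξ r ≤ 0 → ξ r = ξ 0 + inletShift v w r := by
    intro r hr hξr
    have := hξ.integral_eq h hw 0 r
    rw [inletShift, ← sub_eq_iff_eq_add', ← this]
    refine intervalIntegral.integral_congr fun q hq => ?_
    rw [uIcc_of_le hr] at hq
    exact h.left _ (((hξ.strictMono h).monotone hq.2).trans hξr) _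
  rw [entryTime_lt_iff h hw]
  constructor
  · intro hpos
    rcases lt_or_ge 0 (ξ 0) with h0 | h0
    · have := (inletShift_strictMono h hw).monotone hs
      rw [inletShift_zero] at this
      linarith
    · obtain ⟨r, hr, hr0⟩ := intermediate_value_Icc hs hξ.continuous.continuousOn
        (show (0 : ℝ) ∈ Icc _ _ from ⟨h0, hpos.le⟩)
      have hrs : r < s := lt_of_le_of_ne hr.2 fun e => by rw [e] at hr0; exact hpos.ne' hr0
      have h1 := hneg r hr.1 hr0.le
      have h2 := inletShift_strictMono h hw hrs
      linarith
  · intro hpos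
    by_contra! hle
    linarith [hneg s hs hle]

theorem entryTime_foot_le (h : RegularVelocity v μ c Λ L) (hw : Continuous w) {t x : ℝ}
    (ht : 0 ≤ t) (hx : 0 ≤ x) : entryTime v w (foot v w t x) ≤ t := by
  by_contra! hlt
  have h1 := (isChar_flow h hw t x).pos_iff h hw (ht.trans hlt.le)
  have h2 := (isChar_flow h hw t x).strictMono h hlt
  rw [flow_self h hw] at h2
  exact lt_irrefl _ (h1.1 (hx.trans_lt h2))

theorem abs_sub_le_foot (h : RegularVelocity v μ c Λ L) (hw : Continuous w) (t x y : ℝ) :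
    |x - y| ≤ Real.exp (L * |t|) * |foot v w t x - foot v w t y| := by
  have := IsChar.abs_sub_le_exp_same h hw (isChar_flow h hw t x) (isChar_flow h hw t y) 0 t
  rw [flow_self h hw, flow_self h hw, sub_zero, mul_comm] at this
  exact this

/-- Take `s ≤ t`. At time `s` the characteristic through `(t, x)` is still at distance at least `c
(t - s)` from `x`, the position of the other one. Going back to time `0` shrinks this gap by at most
the factor `exp (L * T)`. -/
theorem abs_sub_le_foot_time (h : RegularVelocity v μ c Λ L) (hw : Continuous w) {T s t : ℝ} (x : ℝ)
    (hs : s ∈ Icc 0 T) (ht : t ∈ Icc 0 T) :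
    |s - t| ≤ Real.exp (L * T) / c * |foot v w s x - foot v w t x| := by
  have key : ∀ s t, s ∈ Icc 0 T → s ≤ t →
      |s - t| ≤ Real.exp (L * T) / c * |foot v w s x - foot v w t x| := by
    intro s t hs hst
    have h1 := IsChar.abs_sub_le_exp_same h hw (isChar_flow h hw s x) (isChar_flow h hw t x) 0 s
    have h2 := (isChar_flow h hw t x).lower h hst
    rw [flow_self h hw] at h1 h2
    rw [sub_zero] at h1
    have h3 : Real.exp (L * |s|) ≤ Real.exp (L * T) := by
      have := h.L_nonneg
      rw [abs_of_nonneg hs.1]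
      gcongr
      exact hs.2
    rw [abs_sub_comm, abs_of_nonneg (sub_nonneg.2 hst), div_mul_eq_mul_div, le_div_iff₀' h.pos]
    calc c * (t - s) ≤ x - flow v w t x s := h2
      _ ≤ |x - flow v w t x s| := le_abs_self _
      _ ≤ _ := h1
      _ ≤ |foot v w s x - foot v w t x| * Real.exp (L * T) := by
          unfold foot; gcongr
      _ = _ := mul_comm _ _
  rcases le_total s t with hst | hst
  · exact key s t hs hst
  · rw [abs_sub_comm, abs_sub_comm (foot v w s x)]; exact key t s ht hst

/-! ### Continuous dependence of characteristics, entry times and foot derivatives -/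

section limits

variable {ι : Type*} {l : Filter ι} {W : ι → ℝ → ℝ} {D : ι → ℝ}

theorem tendsto_flow (h : RegularVelocity v μ c Λ L) (hw : Continuous w)
    (hW : ∀ n, Continuous (W n)) (hD : ∀ n s, |W n s - w s| ≤ D n) (hD0 : Tendsto D l (𝓝 0))
    {t : ι → ℝ} {t₀ : ℝ} (ht : Tendsto t l (𝓝 t₀)) {x : ι → ℝ} {x₀ : ℝ}
    (hx : Tendsto x l (𝓝 x₀)) (s : ℝ) :
    Tendsto (fun n => flow v (W n) (t n) (x n) s) l (𝓝 (flow v w t₀ x₀ s)) := by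
  have hL := h.L_nonneg
  rw [tendsto_iff_dist_tendsto_zero]
  have hb : Tendsto (fun n => (Λ * |t₀ - t n| + |x n - x₀| + L * (D n * |s - t₀|))
      * Real.exp (L * |s - t₀|)) l (𝓝 0) := by
    have h1 : Tendsto (fun n => |t₀ - t n|) l (𝓝 0) := by
      simpa using (ht.const_sub t₀).abs
    have h2 : Tendsto (fun n => |x n - x₀|) l (𝓝 0) := by
      simpa using (hx.sub_const x₀).abs
    simpa using (((h1.const_mul Λ).add h2).add ((hD0.mul_const |s - t₀|).const_mul L)).mul_const
      (Real.exp (L * |s - t₀|))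
  refine squeeze_zero (fun _ => dist_nonneg) (fun n => ?_) hb
  rw [Real.dist_eq]
  have hc := isChar_flow h (hW n) (t n) (x n)
  refine (IsChar.abs_sub_le_exp h (hW n) hw hc (isChar_flow h hw t₀ x₀) t₀ s).trans ?_
  have h1 := hc.abs_sub_le h (t n) t₀
  rw [flow_self h (hW n)] at h1
  rw [flow_self h hw]
  -- The starting times differ as well; the speed bound `Λ` transfers the starting point from time
  -- `t n` to time `t₀`.
  have h2 : |flow v (W n) (t n) (x n) t₀ - x₀| ≤ Λ * |t₀ - t n| + |x n - x₀| :=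
    (abs_sub_le _ (x n) _).trans (add_le_add_left h1 _)
  have h3 : |(∫ r in t₀..s, |W n r - w r|)| ≤ D n * |s - t₀| := by
    have := intervalIntegral.norm_integral_le_of_norm_le_const (a := t₀) (b := s)
      (f := fun r => |W n r - w r|) (C := D n) (fun r _ => by simpa using hD n r)
    simpa using this
  gcongr

/-- The slope of `inletShift` is at least `c`, so the error of the entry time is at most `1 / c`
times the mismatch of the displacements at the limiting entry time. -/
theorem tendsto_entryTime (h : RegularVelocity v μ c Λ L) (hw : Continuous w)
    (hW : ∀ n, Continuous (W n)) (hD : ∀ n s, |W n s - w s| ≤ D n) (hD0 : Tendsto D l (𝓝 0))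
    {σ : ι → ℝ} {σ₀ : ℝ} (hσ : Tendsto σ l (𝓝 σ₀)) :
    Tendsto (fun n => entryTime v (W n) (σ n)) l (𝓝 (entryTime v w σ₀)) := by
  have hL := h.L_nonneg
  set e := entryTime v w σ₀ with he
  rw [tendsto_iff_dist_tendsto_zero]
  have hb : Tendsto (fun n => (|σ n - σ₀| + L * D n * |e - 0|) / c) l (𝓝 0) := by
    have h2 : Tendsto (fun n => |σ n - σ₀|) l (𝓝 0) := by
      simpa using (hσ.sub_const σ₀).abs
    simpa using (h2.add ((hD0.const_mul L).mul_const |e - 0|)).div_const c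
  refine squeeze_zero (fun _ => dist_nonneg) (fun n => ?_) hb
  rw [Real.dist_eq, le_div_iff₀' h.pos]
  have h1 := inletShift_lower_abs h (hW n) e (entryTime v (W n) (σ n))
  rw [inletShift_entryTime h (hW n)] at h1
  have h2 : inletShift v w e = -σ₀ := inletShift_entryTime h hw σ₀
  have h3 : |inletShift v (W n) e - inletShift v w e| ≤ L * D n * |e - 0| := by
    rw [inletShift, inletShift, ← intervalIntegral.integral_sub
      ((h.continuous_comp continuous_const (hW n)).intervalIntegrable _ _)
      ((h.continuous_comp continuous_const hw).intervalIntegrable _ _)]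
    rw [← Real.norm_eq_abs, ← Real.norm_eq_abs (e - 0)]
    refine intervalIntegral.norm_integral_le_of_norm_le_const fun r _ => ?_
    have := h.lip 0 (W n r) 0 (w r)
    rw [sub_self, abs_zero, zero_add] at this
    exact this.trans (by gcongr; exact hD n r)
  refine h1.trans ?_
  rw [show -σ n - inletShift v (W n) e = (σ₀ - σ n) - (inletShift v (W n) e - inletShift v w e) by
    rw [h2]; ring]
  refine (abs_sub _ _).trans (add_le_add ?_ h3)
  rw [abs_sub_comm]

theorem tendsto_intervalIntegral_of_bounded [l.IsCountablyGenerated] {g : ι → ℝ → ℝ} {g₀ : ℝ → ℝ}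
    (hL : 0 ≤ L) (hg : ∀ n, Measurable (g n)) (hb : ∀ n s, |g n s| ≤ L)
    {t : ι → ℝ} {t₀ : ℝ} (ht₀ : 0 ≤ t₀) (ht : Tendsto t l (𝓝 t₀))
    (hlim : ∀ᵐ s, s ∈ Ioo 0 t₀ → Tendsto (fun n => g n s) l (𝓝 (g₀ s))) :
    Tendsto (fun n => ∫ s in (0 : ℝ)..t n, g n s) l (𝓝 (∫ s in (0 : ℝ)..t₀, g₀ s)) := by
  have hi : ∀ n a b, IntervalIntegrable (g n) volume a b := fun n a b =>
    (intervalIntegrable_const (c := L)).mono_fun (hg n).aestronglyMeasurable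
      (Eventually.of_forall fun s => by
        simpa [abs_of_nonneg hL] using hb n s)
  have h1 : Tendsto (fun n => ∫ s in (0 : ℝ)..t₀, g n s) l (𝓝 (∫ s in (0 : ℝ)..t₀, g₀ s)) := by
    refine intervalIntegral.tendsto_integral_filter_of_dominated_convergence (fun _ => L)
      (Eventually.of_forall fun n => (hg n).aestronglyMeasurable)
      (Eventually.of_forall fun n => Eventually.of_forall fun s _ => hb n s)
      intervalIntegrable_const ?_
    have hne : ∀ᵐ s : ℝ, s ≠ t₀ := by simp [ae_iff]
    filter_upwards [hlim, hne] with s hs hst hmem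
    rw [uIoc_of_le ht₀] at hmem
    exact hs ⟨hmem.1, lt_of_le_of_ne hmem.2 hst⟩
  have h2 : Tendsto (fun n => ∫ s in t₀..t n, g n s) l (𝓝 0) := by
    have h3 : Tendsto (fun n => L * |t n - t₀|) l (𝓝 0) := by
      simpa using ((ht.sub_const t₀).abs).const_mul L
    exact squeeze_zero_norm
      (fun n => intervalIntegral.norm_integral_le_of_norm_le_const fun s _ => hb n s) h3
  have := h1.add h2
  rw [add_zero] at this
  refine this.congr fun n => ?_
  exact intervalIntegral.integral_add_adjacent_intervals (hi n _ _) (hi n _ _)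

theorem IsChar.ae_ne_zero {ξ : ℝ → ℝ} (hξ : IsChar v w ξ) (h : RegularVelocity v μ c Λ L) :
    ∀ᵐ s, ξ s ≠ 0 := by
  rw [ae_iff]
  refine Set.Subsingleton.measure_zero (fun a ha b hb => ?_) _
  simp only [ne_eq, not_not, mem_ofPred_eq] at ha hb
  exact (hξ.strictMono h).injective (ha.trans hb.symm)

theorem measurable_footDeriv_integrand (h : RegularVelocity v μ c Λ L) (hw : Continuous w)
    (t x : ℝ) :
    Measurable fun s => if 0 < flow v w t x s then μ (flow v w t x s) (w s) else 0 := by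
  have hc := (isChar_flow h hw t x).continuous
  exact Measurable.ite (measurableSet_lt measurable_const hc.measurable)
    (h.cont.comp (hc.prodMk hw)).measurable measurable_const

theorem abs_footDeriv_integrand_le (h : RegularVelocity v μ c Λ L) (t x s : ℝ) :
    |if 0 < flow v w t x s then μ (flow v w t x s) (w s) else 0| ≤ L := by
  split_ifs
  · exact h.bound _ _
  · simpa using h.L_nonneg

/-- The integrand jumps only where the limiting characteristic is at `x = 0`, which happens at no
more than one time because characteristics are strictly increasing. -/
theorem tendsto_footDeriv [l.IsCountablyGenerated] (h : RegularVelocity v μ c Λ L)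
    (hw : Continuous w) (hW : ∀ n, Continuous (W n)) (hD : ∀ n s, |W n s - w s| ≤ D n)
    (hD0 : Tendsto D l (𝓝 0)) {t : ι → ℝ} {t₀ : ℝ} (ht₀ : 0 ≤ t₀) (ht : Tendsto t l (𝓝 t₀))
    {x : ι → ℝ} {x₀ : ℝ} (hx : Tendsto x l (𝓝 x₀)) :
    Tendsto (fun n => footDeriv v μ (W n) (t n) (x n)) l (𝓝 (footDeriv v μ w t₀ x₀)) := by
  refine ((Real.continuous_exp.comp continuous_neg).tendsto _).comp ?_
  refine tendsto_intervalIntegral_of_bounded h.L_nonneg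
    (fun n => measurable_footDeriv_integrand h (hW n) _ _)
    (fun n s => abs_footDeriv_integrand_le h _ _ _) ht₀ ht ?_
  filter_upwards [(isChar_flow h hw t₀ x₀).ae_ne_zero h] with s hs _
  have hfl := tendsto_flow h hw hW hD hD0 ht hx s
  have hWs : Tendsto (fun n => W n s) l (𝓝 (w s)) := by
    rw [tendsto_iff_dist_tendsto_zero]
    exact squeeze_zero (fun _ => dist_nonneg) (fun n => hD n s) hD0
  rcases lt_or_gt_of_ne hs with hneg | hpos
  · rw [if_neg hneg.not_gt]
    refine tendsto_const_nhds.congr' ?_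
    filter_upwards [hfl.eventually (gt_mem_nhds hneg)] with n hn
    rw [if_neg hn.not_gt]
  · rw [if_pos hpos]
    refine ((h.cont.tendsto (flow v w t₀ x₀ s, w s)).comp (hfl.prodMk_nhds hWs)).congr' ?_
    filter_upwards [hfl.eventually (lt_mem_nhds hpos)] with n hn
    rw [if_pos hn]; rfl

end limits

/-! ### Differentiability of the foot in the position -/

theorem footDeriv_pos (t x : ℝ) : 0 < footDeriv v μ w t x := Real.exp_pos _

theorem footDeriv_le (h : RegularVelocity v μ c Λ L) {t x : ℝ} (ht : 0 ≤ t) :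
    footDeriv v μ w t x ≤ Real.exp (L * t) := by
  refine Real.exp_le_exp.2 ((neg_le_abs _).trans ?_)
  have := intervalIntegral.norm_integral_le_of_norm_le_const (a := 0) (b := t)
    (f := fun s => if 0 < flow v w t x s then μ (flow v w t x s) (w s) else 0) (C := L)
    (fun s _ => abs_footDeriv_integrand_le h t x s)
  rw [sub_zero, abs_of_nonneg ht] at this
  exact this

/-- The velocity may have a kink at `x = 0`, so the usual theorem on smooth dependence does not
apply. Instead, the difference `δ` of two characteristics solves the linear equation `δ' = b δ` with
`b` the difference quotient of `v`, so the slope of the foot is exactly `exp (-∫ b)`, and `b` is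
bounded by `L` and converges at almost every time. The hypothesis `x ≤ 1` keeps the characteristic
below `1` before time `t`, where `v` is differentiable off the kink. -/
theorem hasDerivAt_foot (h : RegularVelocity v μ c Λ L) (hw : Continuous w) {t x : ℝ}
    (ht : 0 ≤ t) (hx : x ≤ 1) :
    HasDerivAt (fun z => foot v w t z) (footDeriv v μ w t x) x := by
  have hξ := isChar_flow h hw t x
  have hcx := hξ.continuous
  set b : ℝ → ℝ → ℝ := fun y s =>
    (v (flow v w t y s) (w s) - v (flow v w t x s) (w s)) / (flow v w t y s - flow v w t x s) with hb
  have hne : ∀ y, y ≠ x → ∀ s, flow v w t y s - flow v w t x s ≠ 0 := by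
    intro y hy s
    have h1 := flow_self h hw t x
    have h2 := flow_self h hw t y
    rcases lt_or_gt_of_ne hy with hlt | hlt
    · exact (sub_neg.2 (IsChar.lt_of_lt h hw (isChar_flow h hw t y) hξ
        (by rwa [h1, h2]) s)).ne
    · exact (sub_pos.2 (IsChar.lt_of_lt h hw hξ (isChar_flow h hw t y)
        (by rwa [h1, h2]) s)).ne'
  have hbc : ∀ y, y ≠ x → Continuous (b y) := by
    intro y hy
    have hcy := (isChar_flow h hw t y).continuous
    exact ((h.continuous_comp hcy hw).sub (h.continuous_comp hcx hw)).div (hcy.sub hcx) (hne y hy)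
  have hbb : ∀ y s, |b y s| ≤ L := by
    intro y s
    rw [hb]
    simp only
    rw [abs_div]
    refine div_le_of_le_mul₀ (abs_nonneg _) h.L_nonneg ?_
    simpa using h.lip (flow v w t y s) (w s) (flow v w t x s) (w s)
  have hslope : ∀ y, y ≠ x →
      slope (fun z => foot v w t z) x y = Real.exp (-∫ s in (0 : ℝ)..t, b y s) := by
    intro y hy
    -- The difference of the characteristics times the integrating factor is constant in time;
    -- comparing times `0` and `t` gives the slope.
    have hd : ∀ s, HasDerivAt (fun s => (flow v w t y s - flow v w t x s)
        * Real.exp (-∫ r in (0 : ℝ)..s, b y r)) 0 s := by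
      intro s
      have h1 := ((isChar_flow h hw t y) s).sub (hξ s)
      have h2 : HasDerivAt (fun s => ∫ r in (0 : ℝ)..s, b y r) (b y s) s :=
        intervalIntegral.integral_hasDerivAt_right ((hbc y hy).intervalIntegrable _ _)
          (hbc y hy).aestronglyMeasurable.stronglyMeasurableAtFilter (hbc y hy).continuousAt
      refine (h1.mul h2.neg.exp).congr_deriv ?_
      have := hne y hy s
      simp only [hb, Pi.sub_apply]
      field_simp
      ring
    have := is_const_of_deriv_eq_zero (fun s => (hd s).differentiableAt)
      (fun s => (hd s).deriv) 0 t
    simp only [intervalIntegral.integral_same, neg_zero, Real.exp_zero, mul_one,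
      flow_self h hw] at this
    rw [slope_def_field, foot, foot, this, mul_div_cancel_left₀ _ (sub_ne_zero.2 hy)]
  rw [hasDerivAt_iff_tendsto_slope]
  suffices hs : Tendsto (fun y => ∫ s in (0 : ℝ)..t, b y s) (𝓝[≠] x)
      (𝓝 (∫ s in (0 : ℝ)..t, if 0 < flow v w t x s then μ (flow v w t x s) (w s) else 0)) by
    refine (((Real.continuous_exp.comp continuous_neg).tendsto _).comp hs).congr' ?_
    filter_upwards [self_mem_nhdsWithin] with y hy
    rw [hslope y hy]; rfl
  have hfl : ∀ s, Tendsto (fun y => flow v w t y s) (𝓝[≠] x) (𝓝 (flow v w t x s)) := fun s =>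
    tendsto_flow (W := fun _ => w) (D := fun _ => 0) h hw (fun _ => hw) (by simp)
      tendsto_const_nhds tendsto_const_nhds (tendsto_id.mono_left nhdsWithin_le_nhds) s
  refine tendsto_intervalIntegral_of_bounded h.L_nonneg (fun y => ?_) hbb ht tendsto_const_nhds ?_
  · have hcy := (isChar_flow h hw t y).continuous
    exact (((h.continuous_comp hcy hw).sub (h.continuous_comp hcx hw)).measurable).div
      (hcy.sub hcx).measurable
  filter_upwards [hξ.ae_ne_zero h] with s hs0 hs
  rcases lt_or_gt_of_ne hs0 with hneg | hpos
  · rw [if_neg hneg.not_gt]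
    refine tendsto_const_nhds.congr' ?_
    filter_upwards [(hfl s).eventually (gt_mem_nhds hneg)] with y hy
    simp only [hb]
    rw [h.left _ hneg.le, h.left _ hy.le, sub_self, zero_div]
  · rw [if_pos hpos]
    have hlt : flow v w t x s < 1 := by
      have := hξ.strictMono h hs.2
      rw [flow_self h hw] at this
      exact this.trans_le hx
    have hd := (h.hasDerivAt _ ⟨hpos, hlt⟩ (w s)).tendsto_slope
    have h2 : Tendsto (fun y => flow v w t y s) (𝓝[≠] x) (𝓝[≠] (flow v w t x s)) := by
      refine tendsto_nhdsWithin_iff.2 ⟨hfl s, ?_⟩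
      filter_upwards [self_mem_nhdsWithin] with y hy
      exact sub_ne_zero.1 (hne y hy s)
    refine (hd.comp h2).congr fun y => ?_
    simp [hb, slope_def_field]

end

/-! ### Extension of an admissible velocity to the plane -/

/-- An admissible velocity agrees on `[0,1] × [0,R]` with a regular velocity on the plane. -/
theorem IsVelocity.exists_regularVelocity {lam : ℝ → ℝ → ℝ} (hlam : IsVelocity lam) {R : ℝ}
    (hR : 0 ≤ R) : ∃ (v μ : ℝ → ℝ → ℝ) (c Λ L : ℝ), RegularVelocity v μ c Λ L ∧
      ∀ x ∈ Icc (0 : ℝ) 1, ∀ w ∈ Icc (0 : ℝ) R, v x w = lam x w := by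
  set D : Set (ℝ × ℝ) := Icc 0 1 ×ˢ Ici 0 with hD
  set S : Set (ℝ × ℝ) := Icc 0 1 ×ˢ Icc 0 R with hS
  have hSD : S ⊆ D := prod_mono le_rfl Icc_subset_Ici_self
  have hScomp : IsCompact S := isCompact_Icc.prod isCompact_Icc
  set f : ℝ × ℝ → ℝ := fun q => lam q.1 q.2 with hf
  have hud : UniqueDiffOn ℝ D := (uniqueDiffOn_Icc zero_lt_one).prod (uniqueDiffOn_Ici 0)
  have hfc : ContinuousOn f S := hlam.contDiffOn.continuousOn.mono hSD
  have hfdc : ContinuousOn (fderivWithin ℝ f D) D :=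
    hlam.contDiffOn.continuousOn_fderivWithin hud le_rfl
  have hfd : ∀ q ∈ D, HasFDerivWithinAt f (fderivWithin ℝ f D q) D q := fun q hq =>
    (hlam.contDiffOn.differentiableOn one_ne_zero q hq).hasFDerivWithinAt
  have hne : S.Nonempty := ⟨(0, 0), ⟨⟨le_rfl, zero_le_one⟩, ⟨le_rfl, hR⟩⟩⟩
  obtain ⟨qm, hqm, hmin⟩ := hScomp.exists_isMinOn hne hfc
  obtain ⟨qM, hqM, hmax⟩ := hScomp.exists_isMaxOn hne hfc
  obtain ⟨C, hC⟩ := hScomp.exists_bound_of_continuousOn (hfdc.mono hSD)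
  have hlip : ∀ p ∈ S, ∀ q ∈ S, ‖f p - f q‖ ≤ C * ‖p - q‖ := fun p hp q hq =>
    Convex.norm_image_sub_le_of_norm_hasFDerivWithin_le (fun x hx => (hfd x (hSD hx)).mono hSD) hC
      ((convex_Icc 0 1).prod (convex_Icc 0 R)) hq hp
  have hC0 : 0 ≤ C := (norm_nonneg _).trans (hC _ hqm)
  -- The nearest-point projection onto the compact rectangle `S`. Composing with it preserves the
  -- bounds of `f` on `S` and makes the velocity constant in `x` for `x ≤ 0`.
  set P : ℝ × ℝ → ℝ × ℝ := fun q =>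
    ((projIcc 0 1 zero_le_one q.1 : ℝ), (projIcc 0 R hR q.2 : ℝ)) with hP
  have hPS : ∀ q, P q ∈ S := fun q => ⟨(projIcc 0 1 zero_le_one q.1).2, (projIcc 0 R hR q.2).2⟩
  have hPc : Continuous P :=
    ((continuous_subtype_val.comp (continuous_projIcc (h := zero_le_one))).comp
      continuous_fst).prodMk
      ((continuous_subtype_val.comp (continuous_projIcc (h := hR))).comp continuous_snd)
  refine ⟨fun x w => f (P (x, w)), fun x w => fderivWithin ℝ f D (P (x, w)) (1, 0), f qm, f qM, C,
    ⟨hlam.pos _ (hSD hqm).1 _ (hSD hqm).2, fun x w => hmin (hPS _), fun x w => hmax (hPS _),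
      fun x w x' w' => ?_, fun x hx w => ?_, fun x hx w => ?_, ?_, fun x w => ?_⟩,
    fun x hx w hw => ?_⟩
  · refine (hlip _ (hPS _) _ (hPS _)).trans ?_
    gcongr
    rw [Prod.norm_def]
    have h1 : |(projIcc 0 1 zero_le_one x : ℝ) - projIcc 0 1 zero_le_one x'| ≤ |x - x'| := by
      simpa [Real.dist_eq, Subtype.dist_eq] using
        (LipschitzWith.projIcc (zero_le_one (α := ℝ))).dist_le_mul x x'
    have h2 : |(projIcc 0 R hR w : ℝ) - projIcc 0 R hR w'| ≤ |w - w'| := by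
      simpa [Real.dist_eq, Subtype.dist_eq] using (LipschitzWith.projIcc hR).dist_le_mul w w'
    exact max_le (h1.trans (le_add_of_nonneg_right (abs_nonneg _)))
      (h2.trans (le_add_of_nonneg_left (abs_nonneg _)))
  · simp only [hP]
    rw [projIcc_of_le_left _ hx, projIcc_of_le_left _ le_rfl]
  · have hw := (projIcc 0 R hR w).2
    have hPx : ∀ z ∈ Ioo (0 : ℝ) 1, P (z, w) = (z, (projIcc 0 R hR w : ℝ)) := fun z hz => by
      simp only [hP]
      rw [projIcc_of_mem _ (Ioo_subset_Icc_self hz)]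
    have hq : (x, (projIcc 0 R hR w : ℝ)) ∈ D := ⟨Ioo_subset_Icc_self hx, hw.1⟩
    have h1 : HasDerivWithinAt (fun z : ℝ => (z, (projIcc 0 R hR w : ℝ))) ((1 : ℝ), (0 : ℝ))
        (Icc 0 1) x := (hasDerivWithinAt_id _ _).prodMk (hasDerivWithinAt_const _ _ _)
    have h2 := (hfd _ hq).comp_hasDerivWithinAt x h1
      (show MapsTo _ (Icc 0 1) D from fun z hz => ⟨hz, hw.1⟩)
    have h3 := h2.hasDerivAt (Icc_mem_nhds hx.1 hx.2)
    rw [hPx x hx]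
    refine h3.congr_of_eventuallyEq ?_
    filter_upwards [isOpen_Ioo.mem_nhds hx] with z hz
    rw [hPx z hz]; rfl
  · exact ((hfdc.comp_continuous hPc fun q => hSD (hPS q)).clm_apply continuous_const)
  · rw [← Real.norm_eq_abs]
    refine (ContinuousLinearMap.le_opNorm _ _).trans ?_
    have : ‖((1 : ℝ), (0 : ℝ))‖ = 1 := by simp [Prod.norm_def]
    rw [this, mul_one]
    exact hC _ (hPS _)
  · simp only [hP, hf]
    rw [projIcc_of_mem _ hx, projIcc_of_mem _ hw]

/-! ### Integrals over intervals and smooth cut-offs -/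

instance (a : ℝ) : IsFiniteMeasure (volIoo a) := by
  unfold volIoo; infer_instance

theorem integral_volIoo {a : ℝ} (ha : 0 ≤ a) (f : ℝ → ℝ) :
    ∫ x in (0 : ℝ)..a, f x = ∫ x, f x ∂volIoo a := by
  rw [intervalIntegral.integral_of_le ha, integral_Ioc_eq_integral_Ioo, volIoo]

theorem intervalIntegrable_of_integrable_volIoo {a b : ℝ} {f : ℝ → ℝ} (hf : Integrable f (volIoo a))
    (hb : b ∈ Icc 0 a) : IntervalIntegrable f volume 0 b := by
  rw [intervalIntegrable_iff_integrableOn_Ioo_of_le hb.1]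
  exact (show IntegrableOn f (Ioo 0 a) volume from hf).mono_set (Ioo_subset_Ioo_right hb.2)

theorem MemLInftyPlus.integrable {a : ℝ} {f : ℝ → ℝ} (hf : MemLInftyPlus a f) :
    Integrable f (volIoo a) :=
  memLp_one_iff_integrable.1 (hf.memLp.mono_exponent le_top)

/-- Integration by parts for absolutely continuous functions, since `f` is merely integrable. It
turns the weight `τ - t` of the test functions into an iterated integral. -/
theorem integral_sub_mul_eq_integral_integral {f : ℝ → ℝ} {a : ℝ}
    (hf : IntervalIntegrable f volume 0 a) :
    ∫ t in (0 : ℝ)..a, (a - t) * f t = ∫ s in (0 : ℝ)..a, ∫ t in (0 : ℝ)..s, f t := by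
  have hF := hf.absolutelyContinuousOnInterval_intervalIntegral (c := 0) left_mem_uIcc
  have hl : AbsolutelyContinuousOnInterval (fun t => a - t) 0 a :=
    (LipschitzWith.of_dist_le_mul (K := 1) (f := fun t : ℝ => a - t) fun x y => by
      rw [Real.dist_eq, Real.dist_eq, NNReal.coe_one, one_mul, sub_sub_sub_cancel_left,
        abs_sub_comm]).lipschitzOnWith.absolutelyContinuousOnInterval
  have h1 := hl.integral_mul_deriv_eq_deriv_mul hF
  have h2 : ∫ t in (0 : ℝ)..a, (a - t) * deriv (fun s => ∫ t in (0 : ℝ)..s, f t) t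
      = ∫ t in (0 : ℝ)..a, (a - t) * f t := by
    refine intervalIntegral.integral_congr_ae ?_
    filter_upwards [hf.ae_hasDerivAt_integral] with x hx hmem
    rw [(hx (uIoc_subset_uIcc hmem) 0 left_mem_uIcc).deriv]
  rw [h2] at h1
  have hd : ∀ t, deriv (fun t : ℝ => a - t) t = -1 := fun t =>
    ((hasDerivAt_id t).const_sub a).deriv
  simpa [hd] using h1

/-- The left derivative of the primitive at `a` is both `g a` and `0`. -/
theorem eq_zero_of_integral_eq_zero {g : ℝ → ℝ} {a : ℝ} (ha : 0 < a)
    (hg : ContinuousOn g (Icc 0 a)) (h0 : ∀ τ ∈ Icc 0 a, ∫ t in (0 : ℝ)..τ, g t = 0) : g a = 0 := by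
  have h1 : HasDerivWithinAt (fun τ => ∫ t in (0 : ℝ)..τ, g t) (g a) (Icc 0 a) a := by
    have : Fact (a ∈ Icc 0 a) := ⟨right_mem_Icc.2 ha.le⟩
    refine intervalIntegral.integral_hasDerivWithinAt_right
      (hg.intervalIntegrable_of_Icc ha.le) ?_ (hg a (right_mem_Icc.2 ha.le))
    exact hg.stronglyMeasurableAtFilter_nhdsWithin measurableSet_Icc a
  have h2 : HasDerivWithinAt (fun τ => ∫ t in (0 : ℝ)..τ, g t) 0 (Icc 0 a) a :=
    (hasDerivWithinAt_const a (Icc 0 a) (0 : ℝ)).congr h0 (h0 a (right_mem_Icc.2 ha.le))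
  exact (uniqueDiffOn_Icc ha a (right_mem_Icc.2 ha.le)).eq_deriv _ h1 h2

theorem exists_bound_deriv_smoothTransition :
    ∃ C : ℝ, ∀ y, |deriv Real.smoothTransition y| ≤ C ∧
      (y ∉ Icc (0 : ℝ) 1 → deriv Real.smoothTransition y = 0) := by
  have hc : Continuous (deriv Real.smoothTransition) :=
    (Real.smoothTransition.contDiff (n := 1)).continuous_deriv le_rfl
  obtain ⟨C, hC⟩ := (isCompact_Icc (a := (0 : ℝ)) (b := 1)).exists_bound_of_continuousOn
    hc.continuousOn
  have hz : ∀ y ∉ Icc (0 : ℝ) 1, deriv Real.smoothTransition y = 0 := by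
    intro y hy
    rw [mem_Icc, not_and_or, not_le, not_le] at hy
    rcases hy with hy | hy
    · have : Real.smoothTransition =ᶠ[𝓝 y] fun _ => 0 := by
        filter_upwards [gt_mem_nhds hy] with z hz
        exact Real.smoothTransition.zero_of_nonpos hz.le
      rw [this.deriv_eq, deriv_const]
    · have : Real.smoothTransition =ᶠ[𝓝 y] fun _ => 1 := by
        filter_upwards [lt_mem_nhds hy] with z hz
        exact Real.smoothTransition.one_of_one_le hz.le
      rw [this.deriv_eq, deriv_const]
  refine ⟨C, fun y => ⟨?_, hz y⟩⟩
  by_cases hy : y ∈ Icc (0 : ℝ) 1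
  · exact hC y hy
  · rw [hz y hy, abs_zero]
    exact (norm_nonneg _).trans (hC 0 (by simp))

theorem tendsto_smoothTransition_mul (d : ℝ) :
    Tendsto (fun n : ℕ => Real.smoothTransition (d * (n + 1))) atTop
      (𝓝 (if 0 < d then 1 else 0)) := by
  split_ifs with hd
  · refine tendsto_const_nhds.congr' ?_
    have h1 : Tendsto (fun n : ℕ => d * ((n : ℝ) + 1)) atTop atTop :=
      (tendsto_atTop_add_const_right _ _ tendsto_natCast_atTop_atTop).const_mul_atTop hd
    filter_upwards [h1.eventually_ge_atTop 1] with n hn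
    exact (Real.smoothTransition.one_of_one_le hn).symm
  · refine tendsto_const_nhds.congr fun n => ?_
    exact (Real.smoothTransition.zero_of_nonpos
      (mul_nonpos_of_nonpos_of_nonneg (not_lt.1 hd) (by positivity))).symm

/-! ### Mass balance on the left of a characteristic -/

namespace IsWeakSolution

variable {lam : ℝ → ℝ → ℝ} {T : ℝ} {ρ₀ u : ℝ → ℝ} {ρ : ℝ → ℝ → ℝ}

theorem integrable (hs : IsWeakSolution lam T ρ₀ u ρ) {t : ℝ} (ht : t ∈ Icc 0 T) :
    Integrable (ρ t) (volIoo 1) :=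
  memLp_one_iff_integrable.1 (hs.memLp_one t ht)

/-- Write `ρ t ψ t - ρ s ψ s = (ρ t - ρ s) ψ t + ρ s (ψ t - ψ s)`: the first term is small since `ρ`
is continuous into `L¹` and `ψ` is bounded, the second by dominated convergence. -/
theorem continuousOn_integral_mul (hs : IsWeakSolution lam T ρ₀ u ρ) {ψ : ℝ → ℝ → ℝ} {C : ℝ}
    (hψm : ∀ t ∈ Icc 0 T, AEStronglyMeasurable (ψ t) (volIoo 1))
    (hψb : ∀ t ∈ Icc 0 T, ∀ x, |ψ t x| ≤ C)
    (hψc : ∀ s ∈ Icc 0 T, ∀ᵐ x ∂volIoo 1, Tendsto (fun t => ψ t x) (𝓝[Icc 0 T] s) (𝓝 (ψ s x))) :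
    ContinuousOn (fun t => ∫ x, ρ t x * ψ t x ∂volIoo 1) (Icc 0 T) := by
  intro s hsT
  have hprod : ∀ t ∈ Icc 0 T, ∀ r ∈ Icc 0 T, Integrable (fun x => ρ t x * ψ r x) (volIoo 1) :=
    fun t ht r hr => (hs.integrable ht).mul_bdd (c := C) (hψm r hr)
      (Eventually.of_forall fun x => hψb r hr x)
  have h1 : Tendsto (fun t => ∫ x, ρ s x * ψ t x ∂volIoo 1) (𝓝[Icc 0 T] s)
      (𝓝 (∫ x, ρ s x * ψ s x ∂volIoo 1)) := by
    refine tendsto_integral_filter_of_dominated_convergence (fun x => |ρ s x| * C) ?_ ?_ ?_ ?_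
    · filter_upwards [self_mem_nhdsWithin] with t ht
      exact (hprod s hsT t ht).aestronglyMeasurable
    · filter_upwards [self_mem_nhdsWithin] with t ht
      refine Eventually.of_forall fun x => ?_
      rw [norm_mul]
      exact mul_le_mul_of_nonneg_left (hψb t ht x) (abs_nonneg _)
    · exact (hs.integrable hsT).abs.mul_const _
    · filter_upwards [hψc s hsT] with x hx
      exact hx.const_mul _
  have h2 : Tendsto (fun t => ∫ x, (ρ t x - ρ s x) * ψ t x ∂volIoo 1) (𝓝[Icc 0 T] s) (𝓝 0) := by
    have h3 : Tendsto (fun t => C * (eLpNorm (fun x => ρ t x - ρ s x) 1 (volIoo 1)).toReal)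
        (𝓝[Icc 0 T] s) (𝓝 0) := by
      have := (ENNReal.tendsto_toReal ENNReal.zero_ne_top).comp (hs.continuous_L1 s hsT)
      simpa using this.const_mul C
    refine squeeze_zero_norm' ?_ h3
    filter_upwards [self_mem_nhdsWithin] with t ht
    have hint : Integrable (fun x => ρ t x - ρ s x) (volIoo 1) :=
      (hs.integrable ht).sub (hs.integrable hsT)
    have e1 : (eLpNorm (fun x => ρ t x - ρ s x) 1 (volIoo 1)).toReal
        = ∫ x, ‖ρ t x - ρ s x‖ ∂volIoo 1 := by
      rw [eLpNorm_one_eq_lintegral_enorm, integral_norm_eq_lintegral_enorm hint.aestronglyMeasurable]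
    rw [e1, ← integral_const_mul]
    refine norm_integral_le_of_norm_le (hint.norm.const_mul C) (Eventually.of_forall fun x => ?_)
    rw [norm_mul, mul_comm]
    exact mul_le_mul_of_nonneg_right (hψb t ht x) (norm_nonneg _)
  have h4 := h2.add h1
  rw [zero_add] at h4
  refine h4.congr' ?_
  filter_upwards [self_mem_nhdsWithin] with t ht
  rw [← integral_add]
  · refine integral_congr_ae (Eventually.of_forall fun x => ?_)
    simp only
    ring
  · refine ((hprod t ht t ht).sub (hprod s hsT t ht)).congr (Eventually.of_forall fun x => ?_)
    simp only [Pi.sub_apply, sub_mul]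
  · exact hprod s hsT t ht

theorem continuousOn_totalMass (hs : IsWeakSolution lam T ρ₀ u ρ) :
    ContinuousOn (totalMass ρ) (Icc 0 T) := by
  have := hs.continuousOn_integral_mul (ψ := fun _ _ => 1) (C := 1)
    (fun _ _ => aestronglyMeasurable_const) (by simp) (fun _ _ => Eventually.of_forall fun _ => tendsto_const_nhds)
  refine this.congr fun t _ => ?_
  simp [totalMass, integral_volIoo zero_le_one]

variable {v μ : ℝ → ℝ → ℝ} {c Λ L : ℝ} {w ξ : ℝ → ℝ}

/-- The weak formulation for a smoothed indicator function of the region on the left of a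
characteristic, times `τ - t`. -/
theorem weak_smoothed (hs : IsWeakSolution lam T ρ₀ u ρ) (h : RegularVelocity v μ c Λ L)
    (hw : Continuous w) (hvl : ∀ t ∈ Icc 0 T, ∀ x ∈ Icc (0 : ℝ) 1, v x (w t) = lam x (totalMass ρ t))
    (hξ : IsChar v w ξ) {τ : ℝ} (hτ : τ ∈ Ioc 0 T) (hξτ : ξ τ ≤ 1) {k : ℝ} (hk : 0 < k) :
    (∫ t in (0 : ℝ)..τ, ∫ x, ρ t x * (-Real.smoothTransition ((ξ t - x) * k)
        + (τ - t) * (deriv Real.smoothTransition ((ξ t - x) * k) * k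
            * (v (ξ t) (w t) - v x (w t)))) ∂volIoo 1)
      + (∫ t in (0 : ℝ)..τ, u t * ((τ - t) * Real.smoothTransition (ξ t * k)))
      + (∫ x, ρ₀ x * (τ * Real.smoothTransition ((ξ 0 - x) * k)) ∂volIoo 1) = 0 := by
  have hS : ∀ y, HasDerivAt Real.smoothTransition (deriv Real.smoothTransition y) y := fun y =>
    ((Real.smoothTransition.contDiff (n := 1)).differentiable one_ne_zero y).hasDerivAt
  -- The factor `τ - t` makes the function vanish at the final time. It vanishes at `x = 1` because
  -- `ξ t ≤ ξ τ ≤ 1`.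
  have htest : IsTestFunction τ (fun t x => (τ - t) * Real.smoothTransition ((ξ t - x) * k)) := by
    refine ⟨ContDiff.contDiffOn ?_, fun x _ => by simp, fun t ht => ?_⟩
    · have h1 : ContDiff ℝ 1 Real.smoothTransition := Real.smoothTransition.contDiff (n := 1)
      have h2 : ContDiff ℝ 1 ξ := hξ.contDiff h hw
      exact (contDiff_const.sub contDiff_fst).mul
        (h1.comp (((h2.comp contDiff_fst).sub contDiff_snd).mul contDiff_const))
    · rw [Real.smoothTransition.zero_of_nonpos, mul_zero]
      have := (hξ.strictMono h).monotone ht.2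
      exact mul_nonpos_of_nonpos_of_nonneg (by linarith) hk.le
  have key := hs.weak τ (Ioc_subset_Icc_self hτ) _ htest
  simp only [sub_zero] at key
  rw [← integral_volIoo zero_le_one]
  refine Eq.trans ?_ key
  refine congrArg₂ _ (congrArg₂ _ ?_ rfl) rfl
  refine intervalIntegral.integral_congr fun t ht => ?_
  rw [uIcc_of_le hτ.1.le] at ht
  rw [← integral_volIoo zero_le_one]
  refine intervalIntegral.integral_congr fun x hx => ?_
  rw [uIcc_of_le zero_le_one] at hx
  rw [← hvl t ⟨ht.1, ht.2.trans hτ.2⟩ x hx]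
  have d1 : HasDerivAt (fun s => (τ - s) * Real.smoothTransition ((ξ s - x) * k))
      ((-1) * Real.smoothTransition ((ξ t - x) * k)
        + (τ - t) * (deriv Real.smoothTransition ((ξ t - x) * k) * (v (ξ t) (w t) * k))) t :=
    ((hasDerivAt_id t).const_sub τ).mul
      (HasDerivAt.comp (h₂ := Real.smoothTransition) t (hS ((ξ t - x) * k))
        (((hξ t).sub_const x).mul_const k))
  have d2 : HasDerivAt (fun z => (τ - t) * Real.smoothTransition ((ξ t - z) * k))
      ((τ - t) * (deriv Real.smoothTransition ((ξ t - x) * k) * (-1 * k))) x :=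
    (HasDerivAt.comp (h₂ := Real.smoothTransition) x (hS ((ξ t - x) * k))
      (((hasDerivAt_id x).const_sub (ξ t)).mul_const k)).const_mul _
  rw [d1.hasDerivWithinAt.derivWithin (uniqueDiffOn_Icc hτ.1 t ht),
    d2.hasDerivWithinAt.derivWithin (uniqueDiffOn_Icc zero_lt_one x hx)]
  ring

theorem aestronglyMeasurable_ite_lt (a b d : ℝ) (ν : Measure ℝ) :
    AEStronglyMeasurable (fun x : ℝ => if x < a then b else d) ν :=
  (Measurable.ite measurableSet_Iio measurable_const measurable_const).aestronglyMeasurable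

/-- As the cut-off sharpens, its derivative contributes only through `v (ξ t) - v x`, because the
cut-off moves with the characteristic. The Lipschitz bound compensates the factor `n + 1`, so this
term stays bounded and vanishes in the limit. -/
theorem weak_indicator (hs : IsWeakSolution lam T ρ₀ u ρ) (h : RegularVelocity v μ c Λ L)
    (hw : Continuous w) (hvl : ∀ t ∈ Icc 0 T, ∀ x ∈ Icc (0 : ℝ) 1, v x (w t) = lam x (totalMass ρ t))
    (hρ₀ : Integrable ρ₀ (volIoo 1)) (hu : Integrable u (volIoo T))
    (hξ : IsChar v w ξ) {τ : ℝ} (hτ : τ ∈ Ioc 0 T) (hξτ : ξ τ ≤ 1) :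
    (∫ t in (0 : ℝ)..τ, ∫ x, ρ t x * (if x < ξ t then -1 else 0) ∂volIoo 1)
      + (∫ t in (0 : ℝ)..τ, u t * ((τ - t) * if 0 < ξ t then 1 else 0))
      + (∫ x, ρ₀ x * (τ * if x < ξ 0 then 1 else 0) ∂volIoo 1) = 0 := by
  obtain ⟨C, hC⟩ := exists_bound_deriv_smoothTransition
  have hC0 : 0 ≤ C := (abs_nonneg _).trans (hC 0).1
  have hL := h.L_nonneg
  have hcξ := hξ.continuous
  have hSc := Real.smoothTransition.continuous
  have hS'c : Continuous (deriv Real.smoothTransition) :=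
    (Real.smoothTransition.contDiff (n := 1)).continuous_deriv le_rfl
  have hS1 : ∀ y, |Real.smoothTransition y| ≤ 1 := fun y => by
    rw [abs_of_nonneg (Real.smoothTransition.nonneg y)]; exact Real.smoothTransition.le_one y
  set ψ : ℕ → ℝ → ℝ → ℝ := fun n t x => -Real.smoothTransition ((ξ t - x) * (n + 1))
    + (τ - t) * (deriv Real.smoothTransition ((ξ t - x) * (n + 1)) * (n + 1)
      * (v (ξ t) (w t) - v x (w t))) with hψ
  have hψc : ∀ n, Continuous fun q : ℝ × ℝ => ψ n q.1 q.2 := by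
    intro n
    have h1 : Continuous fun q : ℝ × ℝ => v (ξ q.1) (w q.1) :=
      h.continuous_comp (by fun_prop) (by fun_prop)
    have h2 : Continuous fun q : ℝ × ℝ => v q.2 (w q.1) :=
      h.continuous_comp (by fun_prop) (by fun_prop)
    exact (hSc.comp (by fun_prop)).neg.add ((by fun_prop : Continuous fun q : ℝ × ℝ => τ - q.1).mul
      (((hS'c.comp (by fun_prop)).mul continuous_const).mul (h1.sub h2)))
  have hψb : ∀ n, ∀ t ∈ Icc 0 T, ∀ x, |ψ n t x| ≤ 1 + T * (C * L) := by
    intro n t ht x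
    have hn : (0 : ℝ) < n + 1 := by positivity
    -- Where the derivative does not vanish, `|ξ t - x| ≤ 1 / (n + 1)`.
    have e1 : |deriv Real.smoothTransition ((ξ t - x) * (n + 1)) * (n + 1)
        * (v (ξ t) (w t) - v x (w t))| ≤ C * L := by
      by_cases hmem : (ξ t - x) * (n + 1) ∈ Icc (0 : ℝ) 1
      · have e2 : |v (ξ t) (w t) - v x (w t)| ≤ L * |ξ t - x| := by
          simpa using h.lip (ξ t) (w t) x (w t)
        have e3 : |ξ t - x| * (n + 1) ≤ 1 := by
          rw [← abs_of_pos hn, ← abs_mul, abs_of_nonneg hmem.1]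
          exact hmem.2
        rw [abs_mul, abs_mul, abs_of_pos hn]
        calc _ ≤ C * (n + 1) * (L * |ξ t - x|) := by gcongr; exact (hC _).1
          _ = C * L * (|ξ t - x| * (n + 1)) := by ring
          _ ≤ C * L * 1 := by gcongr
          _ = C * L := mul_one _
      · rw [(hC _).2 hmem, zero_mul, zero_mul, abs_zero]
        positivity
    refine (abs_add_le _ _).trans (add_le_add (by rw [abs_neg]; exact hS1 _) ?_)
    rw [abs_mul]
    have e4 : |τ - t| ≤ T := by
      rw [abs_le]; constructor <;> linarith [ht.1, ht.2, hτ.1, hτ.2]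
    exact mul_le_mul e4 e1 (abs_nonneg _) (hτ.1.le.trans hτ.2)
  have hψl : ∀ t x, Tendsto (fun n => ψ n t x) atTop (𝓝 (if x < ξ t then -1 else 0)) := by
    intro t x
    have e1 := (tendsto_smoothTransition_mul (ξ t - x)).neg
    have e2 : Tendsto (fun n : ℕ => (τ - t) * (deriv Real.smoothTransition ((ξ t - x) * (n + 1))
        * (n + 1) * (v (ξ t) (w t) - v x (w t)))) atTop (𝓝 0) := by
      refine tendsto_const_nhds.congr' ?_
      -- Off the characteristic the derivative of the cut-off eventually vanishes; on it the two
      -- velocities coincide.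
      rcases lt_trichotomy (ξ t - x) 0 with hd | hd | hd
      · refine Eventually.of_forall fun n => ?_
        simp only
        rw [(hC _).2, zero_mul, zero_mul, mul_zero]
        intro hmem
        have : (ξ t - x) * (n + 1) < 0 := mul_neg_of_neg_of_pos hd (by positivity)
        exact absurd hmem.1 (not_le.2 this)
      · refine Eventually.of_forall fun n => ?_
        simp only
        rw [sub_eq_zero.1 hd, sub_self, sub_self, mul_zero, mul_zero]
      · have h1 : Tendsto (fun n : ℕ => (ξ t - x) * ((n : ℝ) + 1)) atTop atTop :=
          (tendsto_atTop_add_const_right _ _ tendsto_natCast_atTop_atTop).const_mul_atTop hd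
        filter_upwards [h1.eventually_gt_atTop 1] with n hn
        rw [(hC _).2 (fun hmem => absurd hmem.2 (not_le.2 hn)), zero_mul, zero_mul, mul_zero]
    have := e1.add e2
    rw [add_zero] at this
    convert this using 2
    simp only [sub_pos]
    split_ifs <;> simp
  have hψm : ∀ n t, AEStronglyMeasurable (ψ n t) (volIoo 1) := fun n t =>
    ((hψc n).comp (by fun_prop : Continuous fun x : ℝ => (t, x))).aestronglyMeasurable
  have hsub : Ioc 0 τ ⊆ Icc 0 T := fun t ht => ⟨ht.1.le, ht.2.trans hτ.2⟩
  have hcont : ∀ n, ContinuousOn (fun t => ∫ x, ρ t x * ψ n t x ∂volIoo 1) (Icc 0 T) := fun n =>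
    hs.continuousOn_integral_mul (fun t _ => hψm n t) (hψb n) fun s _ =>
      Eventually.of_forall fun x =>
        (((hψc n).comp (by fun_prop : Continuous fun t : ℝ => (t, x))).tendsto s).mono_left
          nhdsWithin_le_nhds
  have habs : ContinuousOn (fun t => ∫ x, ‖ρ t x‖ ∂volIoo 1) (Icc 0 T) := by
    intro s hsT
    have h3 := (ENNReal.tendsto_toReal ENNReal.zero_ne_top).comp (hs.continuous_L1 s hsT)
    rw [ContinuousWithinAt, tendsto_iff_dist_tendsto_zero]
    refine squeeze_zero' (Eventually.of_forall fun _ => dist_nonneg) ?_ h3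
    filter_upwards [self_mem_nhdsWithin] with t ht
    have hint : Integrable (fun x => ρ t x - ρ s x) (volIoo 1) :=
      (hs.integrable ht).sub (hs.integrable hsT)
    simp only [Function.comp]
    rw [eLpNorm_one_eq_lintegral_enorm,
      show (∫⁻ x, ‖ρ t x - ρ s x‖ₑ ∂volIoo 1).toReal = ∫ x, ‖ρ t x - ρ s x‖ ∂volIoo 1 from
        (integral_norm_eq_lintegral_enorm hint.aestronglyMeasurable).symm, Real.dist_eq,
      ← integral_sub (hs.integrable ht).norm (hs.integrable hsT).norm]
    exact norm_integral_le_of_norm_le (f := fun x => ‖ρ t x‖ - ‖ρ s x‖) hint.norm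
      (Eventually.of_forall fun x => abs_norm_sub_norm_le (ρ t x) (ρ s x))
  have l1 : Tendsto (fun n => ∫ t in (0 : ℝ)..τ, ∫ x, ρ t x * ψ n t x ∂volIoo 1) atTop
      (𝓝 (∫ t in (0 : ℝ)..τ, ∫ x, ρ t x * (if x < ξ t then -1 else 0) ∂volIoo 1)) := by
    refine intervalIntegral.tendsto_integral_filter_of_dominated_convergence
      (fun t => (∫ x, ‖ρ t x‖ ∂volIoo 1) * (1 + T * (C * L))) ?_ ?_ ?_ ?_
    · refine Eventually.of_forall fun n => ?_
      rw [uIoc_of_le hτ.1.le]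
      exact ((hcont n).mono hsub).aestronglyMeasurable measurableSet_Ioc
    · refine Eventually.of_forall fun n => Eventually.of_forall fun t ht => ?_
      rw [uIoc_of_le hτ.1.le] at ht
      rw [← integral_mul_const]
      refine norm_integral_le_of_norm_le ((hs.integrable (hsub ht)).norm.mul_const _)
        (Eventually.of_forall fun x => ?_)
      rw [norm_mul]
      exact mul_le_mul_of_nonneg_left (hψb n t (hsub ht) x) (norm_nonneg _)
    · refine ContinuousOn.intervalIntegrable_of_Icc hτ.1.le ?_
      exact (habs.mono (Icc_subset_Icc_right hτ.2)).mul continuousOn_const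
    · refine Eventually.of_forall fun t ht => ?_
      rw [uIoc_of_le hτ.1.le] at ht
      refine tendsto_integral_of_dominated_convergence (fun x => ‖ρ t x‖ * (1 + T * (C * L)))
        (fun n => (hs.integrable (hsub ht)).aestronglyMeasurable.mul (hψm n t))
        ((hs.integrable (hsub ht)).norm.mul_const _) (fun n => Eventually.of_forall fun x => ?_)
        (Eventually.of_forall fun x => (hψl t x).const_mul _)
      rw [norm_mul]
      exact mul_le_mul_of_nonneg_left (hψb n t (hsub ht) x) (norm_nonneg _)
  have hui := intervalIntegrable_of_integrable_volIoo hu (Ioc_subset_Icc_self hτ)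
  have l2 : Tendsto (fun n : ℕ => ∫ t in (0 : ℝ)..τ,
      u t * ((τ - t) * Real.smoothTransition (ξ t * (n + 1)))) atTop
      (𝓝 (∫ t in (0 : ℝ)..τ, u t * ((τ - t) * if 0 < ξ t then 1 else 0))) := by
    refine intervalIntegral.tendsto_integral_filter_of_dominated_convergence
      (fun t => ‖u t‖ * τ) ?_ ?_ (hui.norm.mul_const _) ?_
    · refine Eventually.of_forall fun n => ?_
      refine (hui.def'.aestronglyMeasurable).mul ?_
      exact Continuous.aestronglyMeasurable (by fun_prop)
    · refine Eventually.of_forall fun n => Eventually.of_forall fun t ht => ?_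
      rw [uIoc_of_le hτ.1.le] at ht
      rw [norm_mul, norm_mul]
      refine mul_le_mul_of_nonneg_left ?_ (norm_nonneg _)
      have e1 : ‖τ - t‖ ≤ τ := by
        rw [Real.norm_eq_abs, abs_le]; constructor <;> linarith [ht.1, ht.2]
      simpa using mul_le_mul e1 (hS1 (ξ t * (n + 1))) (abs_nonneg _) hτ.1.le
    · exact Eventually.of_forall fun t _ =>
        ((tendsto_smoothTransition_mul (ξ t)).const_mul _).const_mul _
  have l3 : Tendsto (fun n : ℕ => ∫ x,
      ρ₀ x * (τ * Real.smoothTransition ((ξ 0 - x) * (n + 1))) ∂volIoo 1) atTop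
      (𝓝 (∫ x, ρ₀ x * (τ * if x < ξ 0 then 1 else 0) ∂volIoo 1)) := by
    refine tendsto_integral_of_dominated_convergence (fun x => ‖ρ₀ x‖ * τ) (fun n => ?_)
      (hρ₀.norm.mul_const _) (fun n => Eventually.of_forall fun x => ?_)
      (Eventually.of_forall fun x => ?_)
    · refine hρ₀.aestronglyMeasurable.mul ?_
      exact Continuous.aestronglyMeasurable (by fun_prop)
    · rw [norm_mul, norm_mul]
      refine mul_le_mul_of_nonneg_left ?_ (norm_nonneg _)
      rw [Real.norm_of_nonneg hτ.1.le]
      exact mul_le_of_le_one_right hτ.1.le (hS1 _)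
    · have := tendsto_smoothTransition_mul (ξ 0 - x)
      simp only [sub_pos] at this
      exact (this.const_mul _).const_mul _
  have hlim := (l1.add l2).add l3
  refine tendsto_nhds_unique hlim (tendsto_const_nhds.congr fun n => ?_)
  exact (hs.weak_smoothed h hw hvl hξ hτ hξτ (k := n + 1) (by positivity)).symm

/-- Mass balance on the left of a characteristic. -/
theorem mass_left_of_char (hs : IsWeakSolution lam T ρ₀ u ρ) (h : RegularVelocity v μ c Λ L)
    (hw : Continuous w) (hvl : ∀ t ∈ Icc 0 T, ∀ x ∈ Icc (0 : ℝ) 1, v x (w t) = lam x (totalMass ρ t))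
    (hρ₀ : Integrable ρ₀ (volIoo 1)) (hu : Integrable u (volIoo T))
    (hξ : IsChar v w ξ) {t : ℝ} (ht : t ∈ Ioc 0 T) (hξt : ξ t ≤ 1) :
    ∫ x, ρ t x * (if x < ξ t then 1 else 0) ∂volIoo 1
      = (∫ x, ρ₀ x * (if x < ξ 0 then 1 else 0) ∂volIoo 1)
        + ∫ s in (0 : ℝ)..t, u s * if 0 < ξ s then 1 else 0 := by
  have hcξ := hξ.continuous
  have hu' : Integrable (fun s => u s * if 0 < ξ s then (1 : ℝ) else 0) (volIoo T) := by
    refine hu.mul_bdd (c := 1) (Measurable.aestronglyMeasurable ?_)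
      (Eventually.of_forall fun s => by split_ifs <;> simp)
    exact Measurable.ite (measurableSet_lt measurable_const hcξ.measurable) measurable_const
      measurable_const
  have hui := fun τ (hτ : τ ∈ Icc 0 t) => intervalIntegrable_of_integrable_volIoo hu'
    (b := τ) ⟨hτ.1, hτ.2.trans ht.2⟩
  have hA : ContinuousOn (fun t => ∫ x, ρ t x * (if x < ξ t then 1 else 0) ∂volIoo 1)
      (Icc 0 T) := by
    refine hs.continuousOn_integral_mul (C := 1)
      (fun t _ => aestronglyMeasurable_ite_lt _ _ _ _)
      (fun t _ x => by split_ifs <;> simp) fun s _ => ?_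
    have hne : ∀ᵐ x ∂volIoo 1, x ≠ ξ s := by
      refine ae_restrict_of_ae ?_
      simp [ae_iff]
    filter_upwards [hne] with x hx
    refine tendsto_const_nhds.congr' ?_
    rcases lt_or_gt_of_ne hx with hlt | hlt
    · filter_upwards [mem_nhdsWithin_of_mem_nhds (hcξ.continuousAt.eventually (lt_mem_nhds hlt))]
        with t ht
      rw [if_pos hlt, if_pos ht]
    · filter_upwards [mem_nhdsWithin_of_mem_nhds (hcξ.continuousAt.eventually (gt_mem_nhds hlt))]
        with t ht
      rw [if_neg (not_lt.2 hlt.le), if_neg (not_lt.2 (le_of_lt ht))]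
  set c₀ := ∫ x, ρ₀ x * (if x < ξ 0 then 1 else 0) ∂volIoo 1 with hc₀
  have hAt := hA.mono (Icc_subset_Icc_right ht.2)
  have hH : ContinuousOn (fun τ => ∫ s in (0 : ℝ)..τ, u s * if 0 < ξ s then 1 else 0)
      (Icc 0 t) := by
    have := (hui t (right_mem_Icc.2 ht.1.le)).absolutelyContinuousOnInterval_intervalIntegral
      (c := 0) left_mem_uIcc
    simpa [uIcc_of_le ht.1.le] using this.continuousOn
  -- `weak_indicator` says that the defect in the mass balance has zero integral over every `[0,
  -- τ]`; being continuous, the defect vanishes at `t`.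
  have := eq_zero_of_integral_eq_zero (g := fun τ => c₀
      + (∫ s in (0 : ℝ)..τ, u s * if 0 < ξ s then 1 else 0)
      - ∫ x, ρ τ x * (if x < ξ τ then 1 else 0) ∂volIoo 1) ht.1
      ((continuousOn_const.add hH).sub hAt) ?_
  · linarith
  intro τ hτ
  rcases hτ.1.eq_or_lt with h0 | hpos
  · rw [← h0, intervalIntegral.integral_same]
  have key := hs.weak_indicator h hw hvl hρ₀ hu hξ ⟨hpos, hτ.2.trans ht.2⟩
    (((hξ.strictMono h).monotone hτ.2).trans hξt)
  have i1 : IntervalIntegrable (fun τ => ∫ x, ρ τ x * (if x < ξ τ then 1 else 0) ∂volIoo 1)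
      volume 0 τ := (hAt.mono (Icc_subset_Icc_right hτ.2)).intervalIntegrable_of_Icc hpos.le
  have i2 : IntervalIntegrable (fun τ => ∫ s in (0 : ℝ)..τ, u s * if 0 < ξ s then 1 else 0)
      volume 0 τ := (hH.mono (Icc_subset_Icc_right hτ.2)).intervalIntegrable_of_Icc hpos.le
  rw [intervalIntegral.integral_sub (intervalIntegrable_const.add i2) i1,
    intervalIntegral.integral_add intervalIntegrable_const i2,
    ← integral_sub_mul_eq_integral_integral (hui τ hτ), intervalIntegral.integral_const]
  have e1 : ∫ t in (0 : ℝ)..τ, ∫ x, ρ t x * (if x < ξ t then -1 else 0) ∂volIoo 1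
      = -∫ t in (0 : ℝ)..τ, ∫ x, ρ t x * (if x < ξ t then 1 else 0) ∂volIoo 1 := by
    rw [← intervalIntegral.integral_neg]
    congr 1; ext t
    rw [← integral_neg]
    congr 1; ext x
    split_ifs <;> simp
  have e2 : ∫ t in (0 : ℝ)..τ, u t * ((τ - t) * if 0 < ξ t then 1 else 0)
      = ∫ t in (0 : ℝ)..τ, (τ - t) * (u t * if 0 < ξ t then 1 else 0) := by
    congr 1; ext t; ring
  have e3 : ∫ x, ρ₀ x * (τ * if x < ξ 0 then 1 else 0) ∂volIoo 1 = τ * c₀ := by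
    rw [hc₀, ← integral_const_mul]
    congr 1; ext x; ring
  rw [e1, e2, e3] at key
  rw [sub_zero, smul_eq_mul]
  linarith

end IsWeakSolution

/-! ### Bounded representatives of the data and their primitives -/

/-- `g` is a measurable representative of `f` on `(0,a)`, bounded by `K` and zero outside `(0,a)`. -/
structure IsBoundedRep (a K : ℝ) (f g : ℝ → ℝ) : Prop where
  measurable : Measurable g
  bound : ∀ x, |g x| ≤ K
  zero : ∀ x ∉ Ioo 0 a, g x = 0
  ae_eq : f =ᵐ[volIoo a] g

theorem exists_isBoundedRep {a : ℝ} {f : ℝ → ℝ} (hf : MemLInftyPlus a f) {K : ℝ≥0}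
    (hK : eLpNorm f ∞ (volIoo a) ≤ K) : ∃ g, IsBoundedRep a K f g := by
  set m := hf.memLp.aestronglyMeasurable.mk f with hm
  have hmm : Measurable m := hf.memLp.aestronglyMeasurable.stronglyMeasurable_mk.measurable
  -- Truncation at `±K` changes the function only on a null set and makes the bound hold everywhere.
  refine ⟨(Ioo 0 a).indicator fun x => max (-K) (min K (m x)),
    (measurable_const.max (measurable_const.min hmm)).indicator measurableSet_Ioo, fun x => ?_,
    fun x hx => indicator_of_notMem hx _, ?_⟩
  · rw [indicator_apply]
    split_ifs
    · exact abs_le.2 ⟨le_max_left _ _, max_le (by linarith [K.2]) (min_le_left _ _)⟩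
    · simp
  · have h1 := hf.memLp.aestronglyMeasurable.ae_eq_mk
    have h2 := ae_le_eLpNormEssSup (f := f) (μ := volIoo a)
    have h3 : ∀ᵐ x ∂volIoo a, x ∈ Ioo 0 a := ae_restrict_mem measurableSet_Ioo
    filter_upwards [h1, h2, h3] with x h1 h2 h3
    rw [← eLpNorm_exponent_top] at h2
    have h4 : |f x| ≤ K := by
      have := h2.trans hK
      rw [enorm_le_coe] at this
      exact_mod_cast this
    rw [abs_le] at h4
    have h5 : f x = m x := h1
    rw [indicator_of_mem h3, ← h5, min_eq_right h4.2, max_eq_right h4.1]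

namespace IsBoundedRep

variable {a K : ℝ} {f g f' g' : ℝ → ℝ}

theorem integrable (h : IsBoundedRep a K f g) : Integrable g := by
  have h1 : Integrable g (volIoo a) :=
    (integrable_const K).mono' h.measurable.aestronglyMeasurable (Eventually.of_forall h.bound)
  exact IntegrableOn.integrable_of_forall_notMem_eq_zero h1 h.zero

theorem integral_abs_le (h : IsBoundedRep a K f g) (ha : 0 ≤ a) : ∫ x, |g x| ≤ K * a := by
  rw [← setIntegral_eq_integral_of_forall_compl_eq_zero (s := Ioo 0 a)
    (fun x hx => by rw [h.zero x hx, abs_zero])]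
  have := norm_setIntegral_le_of_norm_le_const (μ := volume) (s := Ioo 0 a) (f := fun x => |g x|)
    (C := K) (by simp) (fun x _ => by simpa using h.bound x)
  simp only [Measure.real, Real.volume_Ioo, sub_zero, ENNReal.toReal_ofReal ha] at this
  exact (le_abs_self _).trans this

theorem eLpNorm_sub_eq (h : IsBoundedRep a K f g) (h' : IsBoundedRep a K f' g') :
    eLpNorm (fun x => g' x - g x) 1 volume = eLpNorm (fun x => f' x - f x) 1 (volIoo a) := by
  have h1 : eLpNorm (fun x => f' x - f x) 1 (volIoo a)
      = eLpNorm (fun x => g' x - g x) 1 (volIoo a) := by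
    refine eLpNorm_congr_ae ?_
    filter_upwards [h.ae_eq, h'.ae_eq] with x hx hx'
    rw [hx, hx']
  rw [h1, volIoo, ← eLpNorm_indicator_eq_eLpNorm_restrict measurableSet_Ioo]
  congr 1
  ext x
  by_cases hx : x ∈ Ioo 0 a
  · rw [indicator_of_mem hx]
  · rw [indicator_of_notMem hx, h.zero x hx, h'.zero x hx, sub_self]

end IsBoundedRep

/-- The primitive that vanishes at `-∞`. -/
noncomputable def primitive (g : ℝ → ℝ) (s : ℝ) : ℝ := ∫ x in Iic s, g x

theorem primitive_sub {g : ℝ → ℝ} (hg : Integrable g) (s t : ℝ) :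
    primitive g t - primitive g s = ∫ x in s..t, g x :=
  intervalIntegral.integral_Iic_sub_Iic hg.integrableOn hg.integrableOn

theorem abs_primitive_sub_le {g : ℝ → ℝ} (hg : Integrable g) {K : ℝ} (hK : ∀ x, |g x| ≤ K)
    (s t : ℝ) : |primitive g t - primitive g s| ≤ K * |t - s| := by
  rw [primitive_sub hg, ← Real.norm_eq_abs]
  exact intervalIntegral.norm_integral_le_of_norm_le_const fun x _ => hK x

theorem abs_primitive_sub_le_integral {g g' : ℝ → ℝ} (hg : Integrable g) (hg' : Integrable g')
    (s : ℝ) : |primitive g' s - primitive g s| ≤ ∫ x, |g' x - g x| := by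
  rw [primitive, primitive, ← integral_sub hg'.integrableOn hg.integrableOn,
    ← Real.norm_eq_abs]
  refine (norm_integral_le_integral_norm _).trans ?_
  exact setIntegral_le_integral (hg'.sub hg).norm (Eventually.of_forall fun _ => norm_nonneg _)

theorem abs_primitive_sub_le_integral_abs {g : ℝ → ℝ} (hg : Integrable g) (s t : ℝ) :
    |primitive g t - primitive g s| ≤ ∫ x, |g x| := by
  rw [primitive_sub hg, ← Real.norm_eq_abs]
  refine (intervalIntegral.norm_integral_le_integral_norm_uIoc).trans ?_
  exact setIntegral_le_integral hg.norm (Eventually.of_forall fun _ => norm_nonneg _)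

theorem IsBoundedRep.primitive_eq_zero {a K : ℝ} {f g : ℝ → ℝ} (h : IsBoundedRep a K f g) {s : ℝ}
    (hs : s ≤ 0) : primitive g s = 0 := by
  rw [primitive, setIntegral_eq_zero_of_forall_eq_zero]
  intro x hx
  exact h.zero x fun hx' => absurd (hx.trans hs) (not_le.2 hx'.1)

theorem ae_hasDerivAt_primitive {g : ℝ → ℝ} (hg : Integrable g) :
    ∀ᵐ s, HasDerivAt (primitive g) (g s) s := by
  filter_upwards [LocallyIntegrable.ae_hasDerivAt_integral hg.locallyIntegrable] with s hs
  have h1 := (hs 0).const_add (primitive g 0)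
  refine h1.congr_of_eventuallyEq (Eventually.of_forall fun t => ?_)
  simp only
  rw [← primitive_sub hg, add_sub_cancel]

theorem primitive_eq_integral_ite (g : ℝ → ℝ) (s : ℝ) :
    primitive g s = ∫ x, g x * if x < s then 1 else 0 := by
  rw [primitive, integral_Iic_eq_integral_Iio, ← integral_indicator measurableSet_Iio]
  congr 1
  ext x
  simp [indicator_apply]

/-! ### The solution formula and its continuity -/

/-- The representative of the solution that is given by the characteristics. -/
noncomputable def charRep (v μ : ℝ → ℝ → ℝ) (w g₀ gu : ℝ → ℝ) (t x : ℝ) : ℝ :=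
  footDeriv v μ w t x * g₀ (foot v w t x)
    + footDeriv v μ w t x / v 0 (w (entryTime v w (foot v w t x)))
      * gu (entryTime v w (foot v w t x))

section charRep

variable {v μ : ℝ → ℝ → ℝ} {c Λ L : ℝ} {w : ℝ → ℝ}

theorem continuous_foot (h : RegularVelocity v μ c Λ L) (hw : Continuous w) :
    Continuous fun q : ℝ × ℝ => foot v w q.1 q.2 := by
  rw [continuous_iff_continuousAt]
  intro q
  exact tendsto_flow (W := fun _ => w) (D := fun _ => 0) h hw (fun _ => hw) (by simp)
    tendsto_const_nhds (continuous_fst.tendsto q) (continuous_snd.tendsto q) 0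

theorem continuousOn_footDeriv (h : RegularVelocity v μ c Λ L) (hw : Continuous w) :
    ContinuousOn (fun q : ℝ × ℝ => footDeriv v μ w q.1 q.2) (Ici 0 ×ˢ univ) := by
  intro q hq
  exact tendsto_footDeriv (W := fun _ => w) (D := fun _ => 0) h hw (fun _ => hw) (by simp)
    tendsto_const_nhds hq.1 ((continuous_fst.tendsto q).mono_left nhdsWithin_le_nhds)
    ((continuous_snd.tendsto q).mono_left nhdsWithin_le_nhds)

theorem abs_charRep_le (h : RegularVelocity v μ c Λ L) {K T : ℝ} {g₀ gu : ℝ → ℝ}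
    (hg₀ : ∀ x, |g₀ x| ≤ K) (hgu : ∀ x, |gu x| ≤ K) {t x : ℝ} (ht : t ∈ Icc 0 T) :
    |charRep v μ w g₀ gu t x| ≤ Real.exp (L * T) * K + Real.exp (L * T) / c * K := by
  have hc := h.pos
  have hL := h.L_nonneg
  have h1 : |footDeriv v μ w t x| ≤ Real.exp (L * T) := by
    rw [abs_of_pos (footDeriv_pos t x)]
    refine (footDeriv_le h ht.1).trans ?_
    gcongr
    exact ht.2
  refine (abs_add_le _ _).trans (add_le_add ?_ ?_)
  · rw [abs_mul]
    exact mul_le_mul h1 (hg₀ _) (abs_nonneg _) (Real.exp_pos _).le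
  · rw [abs_mul, abs_div, abs_of_pos (h.pos' _ _)]
    refine mul_le_mul ?_ (hgu _) (abs_nonneg _) (by positivity)
    exact div_le_div₀ (Real.exp_pos _).le h1 hc (h.lower _ _)

theorem aestronglyMeasurable_charRep (h : RegularVelocity v μ c Λ L) (hw : Continuous w)
    {g₀ gu : ℝ → ℝ} (hg₀ : Measurable g₀) (hgu : Measurable gu) (T : ℝ) :
    AEStronglyMeasurable (fun q : ℝ × ℝ => charRep v μ w g₀ gu q.1 q.2)
      (volume.restrict (Ioo 0 T ×ˢ Ioo 0 1)) := by
  have h1 : AEStronglyMeasurable (fun q : ℝ × ℝ => footDeriv v μ w q.1 q.2)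
      (volume.restrict (Ioo 0 T ×ˢ Ioo 0 1)) :=
    ((continuousOn_footDeriv h hw).mono (prod_mono (fun t ht => ht.1.le)
      (subset_univ _))).aestronglyMeasurable (measurableSet_Ioo.prod measurableSet_Ioo)
  have h2 := continuous_foot h hw
  have h3 := (continuous_entryTime h hw).comp h2
  have h4 : Continuous fun q : ℝ × ℝ => v 0 (w (entryTime v w (foot v w q.1 q.2))) :=
    h.continuous_comp continuous_const (hw.comp h3)
  exact (h1.mul (hg₀.comp h2.measurable).aestronglyMeasurable).add
    ((h1.aemeasurable.div h4.aemeasurable).aestronglyMeasurable.mul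
      (hgu.comp h3.measurable).aestronglyMeasurable)

theorem continuousOn_footDeriv_time (h : RegularVelocity v μ c Λ L) (hw : Continuous w)
    (T x : ℝ) : ContinuousOn (fun t => footDeriv v μ w t x) (Ioo 0 T) :=
  (continuousOn_footDeriv h hw).comp (f := fun t : ℝ => (t, x)) (by fun_prop)
    (fun _ ht => ⟨ht.1.le, mem_univ _⟩)

theorem continuous_foot_time (h : RegularVelocity v μ c Λ L) (hw : Continuous w)
    (x : ℝ) : Continuous fun t => foot v w t x :=
  (continuous_foot h hw).comp (by fun_prop : Continuous fun t : ℝ => (t, x))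

theorem aestronglyMeasurable_charRep_time (h : RegularVelocity v μ c Λ L) (hw : Continuous w)
    {g₀ gu : ℝ → ℝ} (hg₀ : Measurable g₀) (hgu : Measurable gu) (T x : ℝ) :
    AEStronglyMeasurable (fun t => charRep v μ w g₀ gu t x) (volIoo T) := by
  have h1 : AEStronglyMeasurable (fun t => footDeriv v μ w t x) (volIoo T) :=
    (continuousOn_footDeriv_time h hw T x).aestronglyMeasurable measurableSet_Ioo
  have h2 := continuous_foot_time h hw x
  have h3 := (continuous_entryTime h hw).comp h2
  have h4 : Continuous fun t => v 0 (w (entryTime v w (foot v w t x))) :=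
    h.continuous_comp continuous_const (hw.comp h3)
  exact (h1.mul (hg₀.comp h2.measurable).aestronglyMeasurable).add
    ((h1.aemeasurable.div h4.aemeasurable).aestronglyMeasurable.mul
      (hgu.comp h3.measurable).aestronglyMeasurable)

/-- Continuity in `L¹(0,T)` of the representative with respect to the position, the total mass and
the data. -/
theorem tendsto_charRep {ι : Type*} {l : Filter ι} [l.IsCountablyGenerated]
    {W : ι → ℝ → ℝ} {D : ι → ℝ} (h : RegularVelocity v μ c Λ L) (hw : Continuous w)
    (hW : ∀ n, Continuous (W n)) (hD : ∀ n s, |W n s - w s| ≤ D n) (hD0 : Tendsto D l (𝓝 0))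
    {x : ι → ℝ} {x₀ : ℝ} (hx : Tendsto x l (𝓝 x₀)) {g₀ gu : ℝ → ℝ} {G₀ Gu : ι → ℝ → ℝ}
    (hg₀m : Measurable g₀) (hgum : Measurable gu) (hg₀ : Integrable g₀) (hgu : Integrable gu)
    (hG₀m : ∀ n, Measurable (G₀ n)) (hGum : ∀ n, Measurable (Gu n))
    (hG₀ : Tendsto (fun n => eLpNorm (fun y => G₀ n y - g₀ y) 1 volume) l (𝓝 0))
    (hGu : Tendsto (fun n => eLpNorm (fun y => Gu n y - gu y) 1 volume) l (𝓝 0)) (T : ℝ) :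
    Tendsto (fun n => eLpNorm (fun t => charRep v μ (W n) (G₀ n) (Gu n) t (x n)
      - charRep v μ w g₀ gu t x₀) 1 (volIoo T)) l (𝓝 0) := by
  have hc := h.pos
  have hL := h.L_nonneg
  have hΛ := h.Λ_pos
  -- `C₁` is the anti-Lipschitz constant of `t ↦ foot` and also bounds the second coefficient of
  -- `charRep`; `C₂` is the constant after composition with `entryTime`; `M₁` bounds `footDeriv`.
  -- None depends on the mass or on `n`.
  obtain ⟨C₁, hC₁⟩ : ∃ C : ℝ≥0, (C : ℝ) = Real.exp (L * T) / c := ⟨_, Real.coe_toNNReal _ (by positivity)⟩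
  obtain ⟨C₂, hC₂⟩ : ∃ C : ℝ≥0, (C : ℝ) = C₁ * Λ := ⟨_, Real.coe_toNNReal _ (by positivity)⟩
  obtain ⟨M₁, hM₁⟩ : ∃ C : ℝ≥0, (C : ℝ) = Real.exp (L * T) := ⟨_, Real.coe_toNNReal _ (by positivity)⟩
  have hsub : ∀ t ∈ Ioo 0 T, t ∈ Icc 0 T := fun t ht => Ioo_subset_Icc_self ht
  have hfa : ∀ {w : ℝ → ℝ}, Continuous w → ∀ x, ∀ s ∈ Ioo 0 T, ∀ t ∈ Ioo 0 T,
      |s - t| ≤ C₁ * |foot v w s x - foot v w t x| := fun hw x s hs t ht => hC₁ ▸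
    abs_sub_le_foot_time h hw x (hsub s hs) (hsub t ht)
  have hea : ∀ {w : ℝ → ℝ}, Continuous w → ∀ x, ∀ s ∈ Ioo 0 T, ∀ t ∈ Ioo 0 T,
      |s - t| ≤ C₂ * |entryTime v w (foot v w s x) - entryTime v w (foot v w t x)| :=
    fun hw x s hs t ht => by
      refine (hfa hw x s hs t ht).trans ?_
      rw [hC₂, mul_assoc]
      exact mul_le_mul_of_nonneg_left (abs_sub_le_entryTime h hw _ _) C₁.2
  have hfd : ∀ {w : ℝ → ℝ} (x : ℝ), ∀ t ∈ Ioo 0 T, |footDeriv v μ w t x| ≤ M₁ := fun x t ht => by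
    rw [abs_of_pos (footDeriv_pos t x)]
    refine (footDeriv_le h ht.1.le).trans ?_
    rw [hM₁]
    gcongr
    exact ht.2.le
  have hfm : ∀ {w : ℝ → ℝ}, Continuous w → ∀ x,
      AEStronglyMeasurable (fun t => footDeriv v μ w t x) (volume.restrict (Ioo 0 T)) :=
    fun hw x => (continuousOn_footDeriv_time h hw T x).aestronglyMeasurable measurableSet_Ioo
  have hvc : ∀ {w : ℝ → ℝ}, Continuous w → ∀ x,
      Continuous fun t => v 0 (w (entryTime v w (foot v w t x))) := fun hw x =>
    h.continuous_comp continuous_const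
      (hw.comp ((continuous_entryTime h hw).comp (continuous_foot_time h hw x)))
  have hdm : ∀ {w : ℝ → ℝ}, Continuous w → ∀ x, AEStronglyMeasurable
      (fun t => footDeriv v μ w t x / v 0 (w (entryTime v w (foot v w t x))))
      (volume.restrict (Ioo 0 T)) :=
    fun hw x => ((hfm hw x).aemeasurable.div (hvc hw x).aemeasurable).aestronglyMeasurable
  have hdb : ∀ {w : ℝ → ℝ} (x : ℝ), ∀ t ∈ Ioo 0 T,
      |footDeriv v μ w t x / v 0 (w (entryTime v w (foot v w t x)))| ≤ C₁ := fun x t ht => by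
    rw [abs_div, abs_of_pos (h.pos' _ _)]
    rw [hC₁, ← hM₁]
    exact div_le_div₀ M₁.2 (hfd x t ht) hc (h.lower _ _)
  have hfl : ∀ t, Tendsto (fun n => foot v (W n) t (x n)) l (𝓝 (foot v w t x₀)) := fun t =>
    tendsto_flow h hw hW hD hD0 tendsto_const_nhds hx 0
  have hel : ∀ t, Tendsto (fun n => entryTime v (W n) (foot v (W n) t (x n))) l
      (𝓝 (entryTime v w (foot v w t x₀))) := fun t => tendsto_entryTime h hw hW hD hD0 (hfl t)
  have hdl : ∀ t ∈ Ioo 0 T, Tendsto (fun n => footDeriv v μ (W n) t (x n)) l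
      (𝓝 (footDeriv v μ w t x₀)) := fun t ht =>
    tendsto_footDeriv h hw hW hD hD0 ht.1.le tendsto_const_nhds hx
  have hWl : ∀ {s : ι → ℝ} {s₀ : ℝ}, Tendsto s l (𝓝 s₀) →
      Tendsto (fun n => W n (s n)) l (𝓝 (w s₀)) := by
    intro s s₀ hs
    have h1 : Tendsto (fun n => W n (s n) - w (s n)) l (𝓝 0) :=
      squeeze_zero_norm (fun n => hD n (s n)) hD0
    simpa using h1.add ((hw.tendsto s₀).comp hs)
  have hvl : ∀ t, Tendsto (fun n => v 0 (W n (entryTime v (W n) (foot v (W n) t (x n))))) l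
      (𝓝 (v 0 (w (entryTime v w (foot v w t x₀))))) := fun t =>
    (h.continuous_uncurry.tendsto (0, w (entryTime v w (foot v w t x₀)))).comp
      (tendsto_const_nhds.prodMk_nhds (hWl (hel t)))
  have l1 := tendsto_eLpNorm_mul_comp (A := Ioo 0 T) measurableSet_Ioo (by simp) (C := C₁) hG₀m hg₀
    hg₀m hG₀ (S := fun n t => foot v (W n) t (x n)) (S₀ := fun t => foot v w t x₀)
    (fun n => (continuous_foot_time h (hW n) _).aemeasurable)
    (continuous_foot_time h hw _).aemeasurable (fun n => hfa (hW n) _) (hfa hw _)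
    (fun t _ => hfl t) (a := fun n t => footDeriv v μ (W n) t (x n))
    (a₀ := fun t => footDeriv v μ w t x₀) (M := M₁) (fun n => hfm (hW n) _) (hfm hw _)
    (fun n => hfd _) (hfd _) hdl
  have l2 := tendsto_eLpNorm_mul_comp (A := Ioo 0 T) measurableSet_Ioo (by simp) (C := C₂) hGum hgu
    hgum hGu (S := fun n t => entryTime v (W n) (foot v (W n) t (x n)))
    (S₀ := fun t => entryTime v w (foot v w t x₀))
    (fun n => ((continuous_entryTime h (hW n)).comp (continuous_foot_time h (hW n) _)).aemeasurable)
    ((continuous_entryTime h hw).comp (continuous_foot_time h hw _)).aemeasurable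
    (fun n => hea (hW n) _) (hea hw _) (fun t _ => hel t)
    (a := fun n t => footDeriv v μ (W n) t (x n)
      / v 0 (W n (entryTime v (W n) (foot v (W n) t (x n)))))
    (a₀ := fun t => footDeriv v μ w t x₀ / v 0 (w (entryTime v w (foot v w t x₀)))) (M := C₁)
    (fun n => hdm (hW n) _) (hdm hw _) (fun n => hdb _) (hdb _)
    (fun t ht => (hdl t ht).div (hvl t) (h.pos' _ _).ne')
  have l3 := l1.add l2
  rw [add_zero] at l3
  refine tendsto_of_tendsto_of_tendsto_of_le_of_le tendsto_const_nhds l3 (fun _ => bot_le)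
    fun n => ?_
  have hsplit : (fun t => charRep v μ (W n) (G₀ n) (Gu n) t (x n) - charRep v μ w g₀ gu t x₀)
      = (fun t => footDeriv v μ (W n) t (x n) * G₀ n (foot v (W n) t (x n))
          - footDeriv v μ w t x₀ * g₀ (foot v w t x₀))
        + (fun t => footDeriv v μ (W n) t (x n)
            / v 0 (W n (entryTime v (W n) (foot v (W n) t (x n))))
            * Gu n (entryTime v (W n) (foot v (W n) t (x n)))
          - footDeriv v μ w t x₀ / v 0 (w (entryTime v w (foot v w t x₀)))
            * gu (entryTime v w (foot v w t x₀))) := by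
    ext t
    simp only [charRep, Pi.add_apply]
    ring
  simp only [hsplit]
  refine eLpNorm_add_le ?_ ?_ le_rfl
  · exact ((hfm (hW n) _).mul ((hG₀m n).comp
      (continuous_foot_time h (hW n) _).measurable).aestronglyMeasurable).sub
      ((hfm hw _).mul (hg₀m.comp (continuous_foot_time h hw _).measurable).aestronglyMeasurable)
  · exact ((hdm (hW n) _).mul ((hGum n).comp ((continuous_entryTime h (hW n)).comp
      (continuous_foot_time h (hW n) _)).measurable).aestronglyMeasurable).sub
      ((hdm hw _).mul (hgum.comp ((continuous_entryTime h hw).comp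
        (continuous_foot_time h hw _)).measurable).aestronglyMeasurable)

end charRep

/-! ### Identification of weak solutions with the formula -/

/-- The total mass, extended to all times by its values at `0` and `T`. -/
noncomputable def extendedMass (T : ℝ) (ρ : ℝ → ℝ → ℝ) (s : ℝ) : ℝ :=
  totalMass ρ (max 0 (min T s))

theorem extendedMass_of_mem {T : ℝ} {ρ : ℝ → ℝ → ℝ} {s : ℝ} (hs : s ∈ Icc 0 T) :
    extendedMass T ρ s = totalMass ρ s := by
  rw [extendedMass, min_eq_right hs.2, max_eq_right hs.1]

theorem clamp_mem_Icc {T : ℝ} (hT : 0 ≤ T) (s : ℝ) : max 0 (min T s) ∈ Icc 0 T :=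
  ⟨le_max_left _ _, max_le hT (min_le_left _ _)⟩

theorem IsWeakSolution.continuous_extendedMass {lam : ℝ → ℝ → ℝ} {T : ℝ} {ρ₀ u : ℝ → ℝ}
    {ρ : ℝ → ℝ → ℝ} (hs : IsWeakSolution lam T ρ₀ u ρ) (hT : 0 ≤ T) :
    Continuous (extendedMass T ρ) :=
  hs.continuousOn_totalMass.comp_continuous (by fun_prop) (clamp_mem_Icc hT)

/-- Fubini's criterion for null sets needs a measurable set, hence the passage to measurable
modifications. -/
theorem ae_eq_prod_of_ae_ae_eq {α β : Type*} [MeasurableSpace α] [MeasurableSpace β]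
    {μ : Measure α} {ν : Measure β} [SFinite μ] [SFinite ν] {f g : α × β → ℝ}
    (hf : AEStronglyMeasurable f (μ.prod ν)) (hg : AEStronglyMeasurable g (μ.prod ν))
    (h : ∀ᵐ a ∂μ, ∀ᵐ b ∂ν, f (a, b) = g (a, b)) : f =ᵐ[μ.prod ν] g := by
  have hmk : hf.mk f =ᵐ[μ.prod ν] hg.mk g := by
    refine (Measure.ae_prod_iff_ae_ae (measurableSet_eq_fun
      hf.stronglyMeasurable_mk.measurable hg.stronglyMeasurable_mk.measurable)).2 ?_
    filter_upwards [h, Measure.ae_ae_of_ae_prod hf.ae_eq_mk, Measure.ae_ae_of_ae_prod hg.ae_eq_mk]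
      with a h1 h2 h3
    filter_upwards [h1, h2, h3] with b h1 h2 h3
    rw [← h2, ← h3, h1]
  exact hf.ae_eq_mk.trans (hmk.trans hg.ae_eq_mk.symm)

theorem volume_restrict_eq_prod (T : ℝ) :
    (volume.restrict (Ioo 0 T ×ˢ Ioo 0 1) : Measure (ℝ × ℝ)) = (volIoo T).prod (volIoo 1) := by
  rw [volIoo, volIoo, Measure.prod_restrict, Measure.volume_eq_prod]

namespace IsWeakSolution

variable {lam : ℝ → ℝ → ℝ} {T K : ℝ} {ρ₀ u : ℝ → ℝ} {ρ : ℝ → ℝ → ℝ}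
  {v μ : ℝ → ℝ → ℝ} {c Λ L : ℝ} {w g₀ gu : ℝ → ℝ}

/-- The mass in `[0,x]` at time `t`, expressed through the data. -/
theorem integral_eq_primitive (hs : IsWeakSolution lam T ρ₀ u ρ) (h : RegularVelocity v μ c Λ L)
    (hw : Continuous w) (hvl : ∀ t ∈ Icc 0 T, ∀ x ∈ Icc (0 : ℝ) 1, v x (w t) = lam x (totalMass ρ t))
    (hρ₀ : MemLInftyPlus 1 ρ₀) (hu : MemLInftyPlus T u)
    (hg₀ : IsBoundedRep 1 K ρ₀ g₀) (hgu : IsBoundedRep T K u gu)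
    {t x : ℝ} (ht : t ∈ Ioc 0 T) (hx : x ∈ Icc (0 : ℝ) 1) :
    ∫ z in (0 : ℝ)..x, ρ t z = primitive g₀ (foot v w t x)
      + (primitive gu t - primitive gu (entryTime v w (foot v w t x))) := by
  set ξ := flow v w t x with hξdef
  have hξ : IsChar v w ξ := isChar_flow h hw t x
  have hξt : ξ t = x := flow_self h hw t x
  set e := entryTime v w (foot v w t x) with he
  have het : e ≤ t := entryTime_foot_le h hw ht.1.le hx.1
  have key := hs.mass_left_of_char h hw hvl hρ₀.integrable hu.integrable hξ ht
    (by rw [hξt]; exact hx.2)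
  have e1 : ∫ z, ρ t z * (if z < ξ t then 1 else 0) ∂volIoo 1 = ∫ z in (0 : ℝ)..x, ρ t z := by
    have : (fun z => ρ t z * (if z < ξ t then (1 : ℝ) else 0)) = (Iio x).indicator (ρ t) := by
      ext z
      simp [indicator_apply, hξt]
    rw [this, integral_indicator measurableSet_Iio, volIoo, Measure.restrict_restrict
      measurableSet_Iio, intervalIntegral.integral_of_le hx.1, integral_Ioc_eq_integral_Ioo]
    congr 2
    ext z
    simp only [mem_inter_iff, mem_Iio, mem_Ioo]
    constructor
    · rintro ⟨h1, h2, h3⟩; exact ⟨h2, h1⟩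
    · rintro ⟨h1, h2⟩; exact ⟨h2, h1, h2.trans_le hx.2⟩
  have e2 : ∫ z, ρ₀ z * (if z < ξ 0 then 1 else 0) ∂volIoo 1 = primitive g₀ (foot v w t x) := by
    rw [primitive_eq_integral_ite]
    have : ∫ z, ρ₀ z * (if z < ξ 0 then 1 else 0) ∂volIoo 1
        = ∫ z, g₀ z * (if z < ξ 0 then 1 else 0) ∂volIoo 1 := by
      refine integral_congr_ae ?_
      filter_upwards [hg₀.ae_eq] with z hz
      rw [hz]
    rw [this, volIoo, setIntegral_eq_integral_of_forall_compl_eq_zero]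
    · rfl
    · intro z hz
      rw [hg₀.zero z hz, zero_mul]
  have e3 : ∫ s in (0 : ℝ)..t, u s * (if 0 < ξ s then 1 else 0)
      = primitive gu t - primitive gu e := by
    have i1 : ∀ a : ℝ, Integrable fun s => gu s * (if s < a then (1 : ℝ) else 0) := fun a =>
      hgu.integrable.mul_bdd (c := 1) (aestronglyMeasurable_ite_lt _ _ _ _)
        (Eventually.of_forall fun s => by split_ifs <;> simp)
    rw [primitive_eq_integral_ite, primitive_eq_integral_ite, ← integral_sub (i1 _) (i1 _),
      intervalIntegral.integral_of_le ht.1.le, ← integral_indicator measurableSet_Ioc]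
    have hae : ∀ᵐ s, s ∈ Ioo 0 T → u s = gu s := by
      have := hgu.ae_eq
      rw [volIoo, EventuallyEq, ae_restrict_iff' measurableSet_Ioo] at this
      exact this
    -- Discarding `s = t` and `s = e` makes strict and weak inequalities interchangeable.
    have hne : ∀ a : ℝ, ∀ᵐ s, s ≠ a := fun a => by simp [ae_iff]
    refine integral_congr_ae ?_
    filter_upwards [hae, hne t, hne e] with s hs1 hst hse
    by_cases hs0 : 0 < s
    · rcases lt_or_gt_of_ne hst with hlt | hlt
      · rw [indicator_of_mem (show s ∈ Ioc 0 t from ⟨hs0, hlt.le⟩), hs1 ⟨hs0, hlt.trans_le ht.2⟩, if_pos hlt]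
        have hpos := hξ.pos_iff h hw hs0.le
        change 0 < ξ s ↔ e < s at hpos
        rcases lt_or_gt_of_ne hse with hl | hl
        · rw [if_neg (fun hp => absurd (hpos.1 hp) (not_lt.2 hl.le)), if_pos hl]; ring
        · rw [if_pos (hpos.2 hl), if_neg (not_lt.2 hl.le)]; ring
      · rw [indicator_of_notMem (fun hm => absurd hm.2 (not_le.2 hlt)), if_neg (not_lt.2 hlt.le),
          if_neg (not_lt.2 (het.trans hlt.le))]
        simp
    · rw [indicator_of_notMem (fun hm => hs0 hm.1), hgu.zero s (fun hm => hs0 hm.1)]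
      simp
  rw [← e1, key, e2, e3]

/-- Both sides of `integral_eq_primitive` are differentiated in `x`. The primitives of the data are
differentiable only almost everywhere, but the maps to the foot and to the entry time are
anti-Lipschitz, so they pull null sets back to null sets and the chain rule holds for almost every
`x`. -/
theorem ae_eq_charRep_slice (hs : IsWeakSolution lam T ρ₀ u ρ) (h : RegularVelocity v μ c Λ L)
    (hw : Continuous w) (hvl : ∀ t ∈ Icc 0 T, ∀ x ∈ Icc (0 : ℝ) 1, v x (w t) = lam x (totalMass ρ t))
    (hρ₀ : MemLInftyPlus 1 ρ₀) (hu : MemLInftyPlus T u)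
    (hg₀ : IsBoundedRep 1 K ρ₀ g₀) (hgu : IsBoundedRep T K u gu) {t : ℝ} (ht : t ∈ Ioc 0 T) :
    ∀ᵐ x ∂volIoo 1, charRep v μ w g₀ gu t x = ρ t x := by
  have hΛ := h.Λ_pos
  obtain ⟨C₁, hC₁⟩ : ∃ C : ℝ≥0, (C : ℝ) = Real.exp (L * |t|) := ⟨_, Real.coe_toNNReal _ (by positivity)⟩
  obtain ⟨C₂, hC₂⟩ : ∃ C : ℝ≥0, (C : ℝ) = C₁ * Λ := ⟨_, Real.coe_toNNReal _ (by positivity)⟩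
  have a1 : ∀ x ∈ Ioo (0 : ℝ) 1, ∀ y ∈ Ioo (0 : ℝ) 1, |x - y| ≤ C₁ * |foot v w t x - foot v w t y| :=
    fun x _ y _ => hC₁ ▸ abs_sub_le_foot h hw t x y
  have a2 : ∀ x ∈ Ioo (0 : ℝ) 1, ∀ y ∈ Ioo (0 : ℝ) 1, |x - y|
      ≤ C₂ * |entryTime v w (foot v w t x) - entryTime v w (foot v w t y)| := fun x hx y hy => by
    refine (a1 x hx y hy).trans ?_
    rw [hC₂, mul_assoc]
    exact mul_le_mul_of_nonneg_left (abs_sub_le_entryTime h hw _ _) C₁.2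
  have d1 := ae_comp_of_antilipschitz measurableSet_Ioo a1 (ae_hasDerivAt_primitive hg₀.integrable)
  have d2 := ae_comp_of_antilipschitz measurableSet_Ioo a2 (ae_hasDerivAt_primitive hgu.integrable)
  have d3 := (intervalIntegrable_of_integrable_volIoo (hs.integrable (Ioc_subset_Icc_self ht))
    (right_mem_Icc.2 zero_le_one)).ae_hasDerivAt_integral
  have d4 : ∀ᵐ x ∂volIoo 1, x ∈ Ioo (0 : ℝ) 1 := ae_restrict_mem measurableSet_Ioo
  filter_upwards [d1, d2, ae_restrict_of_ae d3, d4] with x h1 h2 h3 hx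
  have hfx := hasDerivAt_foot h hw ht.1.le hx.2.le
  have e1 := h3 (by rw [uIcc_of_le zero_le_one]; exact Ioo_subset_Icc_self hx) 0 left_mem_uIcc
  have e2 := (HasDerivAt.comp x h1 hfx).add ((HasDerivAt.comp x h2
    (HasDerivAt.comp x (hasDerivAt_entryTime h hw (foot v w t x)) hfx)).const_sub (primitive gu t))
  have e3 := e2.congr_of_eventuallyEq (f₁ := fun x => ∫ z in (0 : ℝ)..x, ρ t z) (by
    filter_upwards [isOpen_Ioo.mem_nhds hx] with y hy
    exact hs.integral_eq_primitive h hw hvl hρ₀ hu hg₀ hgu ht (Ioo_subset_Icc_self hy))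
  rw [e1.unique e3, charRep]
  ring

/-- Continuity in `L¹` is `tendsto_charRep` with fixed mass and data; the uniform bound `M` gives
every finite exponent. -/
theorem isSpaceContinuousRep_charRep (hs : IsWeakSolution lam T ρ₀ u ρ)
    (h : RegularVelocity v μ c Λ L)
    (hw : Continuous w) (hvl : ∀ t ∈ Icc 0 T, ∀ x ∈ Icc (0 : ℝ) 1, v x (w t) = lam x (totalMass ρ t))
    (hρ₀ : MemLInftyPlus 1 ρ₀) (hu : MemLInftyPlus T u)
    (hg₀ : IsBoundedRep 1 K ρ₀ g₀) (hgu : IsBoundedRep T K u gu) :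
    IsSpaceContinuousRep T ρ (charRep v μ w g₀ gu) := by
  have hK : 0 ≤ K := (abs_nonneg _).trans (hg₀.bound 0)
  have hc := h.pos
  obtain ⟨M, hM⟩ : ∃ M : ℝ≥0, (M : ℝ) = Real.exp (L * T) * K + Real.exp (L * T) / c * K :=
    ⟨_, Real.coe_toNNReal _ (by positivity)⟩
  have hmem : ∀ᵐ t ∂volIoo T, t ∈ Ioo 0 T := ae_restrict_mem measurableSet_Ioo
  have hbd : ∀ x, ∀ᵐ t ∂volIoo T, |charRep v μ w g₀ gu t x| ≤ M := fun x => by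
    filter_upwards [hmem] with t ht
    rw [hM]
    exact abs_charRep_le h hg₀.bound hgu.bound (Ioo_subset_Icc_self ht)
  have hm := aestronglyMeasurable_charRep_time h hw hg₀.measurable hgu.measurable T
  refine ⟨?_, fun p _ _ x _ => MemLp.of_bound (hm x) M (hbd x), fun p hp hp' x hx => ?_⟩
  · have h1 := aestronglyMeasurable_charRep h hw hg₀.measurable hgu.measurable T
    have h2 := hs.memLp_top.aestronglyMeasurable
    rw [volume_restrict_eq_prod] at h1 h2 ⊢
    refine ae_eq_prod_of_ae_ae_eq h1 h2 ?_
    filter_upwards [hmem] with t ht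
    exact hs.ae_eq_charRep_slice h hw hvl hρ₀ hu hg₀ hgu ⟨ht.1, ht.2.le⟩
  · refine tendsto_eLpNorm_of_bounded (M := M + M) ?_ hp hp' ?_
    · refine Eventually.of_forall fun z => ?_
      filter_upwards [hbd z, hbd x] with t h1 h2
      exact (abs_sub _ _).trans (by push_cast; exact add_le_add h1 h2)
    · exact tendsto_charRep (W := fun _ => w) (D := fun _ => 0) (G₀ := fun _ => g₀)
        (Gu := fun _ => gu) h hw (fun _ => hw) (by simp) tendsto_const_nhds
        (tendsto_id.mono_left nhdsWithin_le_nhds) hg₀.measurable hgu.measurable hg₀.integrable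
        hgu.integrable (fun _ => hg₀.measurable) (fun _ => hgu.measurable) 
        (by simpa using tendsto_const_nhds) (by simpa using tendsto_const_nhds) T

end IsWeakSolution

/-! ### Uniqueness of the trace at `x = 1` -/

theorem frequently_nhdsWithin_of_ae {P : ℝ → Prop} (hP : ∀ᵐ x ∂volIoo 1, P x) :
    ∃ᶠ x in 𝓝[Icc 0 1] (1 : ℝ), P x := by
  intro hnot
  have h1 : ∀ᶠ x in 𝓝[<] (1 : ℝ), ¬ P x := by
    refine Eventually.filter_mono ?_ hnot
    rw [← nhdsWithin_Ioo_eq_nhdsLT (zero_lt_one (α := ℝ))]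
    exact nhdsWithin_mono _ Ioo_subset_Icc_self
  obtain ⟨a, ha, hsub⟩ := mem_nhdsLT_iff_exists_Ioo_subset.1 h1
  rw [volIoo, ae_restrict_iff' measurableSet_Ioo] at hP
  have hlt : max a 0 < 1 := max_lt ha zero_lt_one
  have h2 : volume (Ioo (max a 0) 1) = 0 := by
    refine measure_mono_null (fun x hx => ?_) (ae_iff.1 hP)
    have hx' : x ∈ Ioo a 1 := ⟨(le_max_left _ _).trans_lt hx.1, hx.2⟩
    exact fun himp => hsub hx' (himp ⟨(le_max_right _ _).trans_lt hx.1, hx.2⟩)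
  rw [Real.volume_Ioo, ENNReal.ofReal_eq_zero] at h2
  linarith

/-- The trace at `x = 1` does not depend on the representative. -/
theorem IsSpaceContinuousRep.ae_eq_right {T : ℝ} {ρ r r' : ℝ → ℝ → ℝ}
    (h : IsSpaceContinuousRep T ρ r) (h' : IsSpaceContinuousRep T ρ r') :
    ∀ᵐ t ∂volIoo T, r t 1 = r' t 1 := by
  have h1m : (1 : ℝ) ∈ Icc (0 : ℝ) 1 := right_mem_Icc.2 zero_le_one
  have hae : ∀ᵐ x ∂volIoo 1, ∀ᵐ t ∂volIoo T, r t x = r' t x := by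
    have h1 := h.ae_eq.trans h'.ae_eq.symm
    rw [volume_restrict_eq_prod] at h1
    have h2 := (Measure.measurePreserving_swap (μ := volIoo 1)
      (ν := volIoo T)).quasiMeasurePreserving.ae h1
    exact Measure.ae_ae_of_ae_prod h2
  have hlim := (h.continuous_Lp 1 le_rfl ENNReal.one_ne_top 1 h1m).add
    (h'.continuous_Lp 1 le_rfl ENNReal.one_ne_top 1 h1m)
  rw [add_zero] at hlim
  have m := fun x hx => (h.memLp 1 le_rfl ENNReal.one_ne_top x hx).aestronglyMeasurable
  have m' := fun x hx => (h'.memLp 1 le_rfl ENNReal.one_ne_top x hx).aestronglyMeasurable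
  have hle : eLpNorm (fun t => r t 1 - r' t 1) 1 (volIoo T) ≤ 0 := by
    -- Points `x` where the two representatives agree for almost every `t` accumulate at `1`, so the
    -- bound is needed only along these.
    refine ge_of_tendsto_of_frequently hlim ?_
    have hfr := (frequently_nhdsWithin_of_ae hae).and_eventually self_mem_nhdsWithin
    refine hfr.mono fun x hx => ?_
    have hx01 : x ∈ Icc (0 : ℝ) 1 := hx.2
    have : (fun t => r t 1 - r' t 1) =ᵐ[volIoo T]
        (fun t => r' t x - r' t 1) - (fun t => r t x - r t 1) := by
      filter_upwards [hx.1] with t ht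
      simp only [Pi.sub_apply]
      rw [ht]; ring
    rw [eLpNorm_congr_ae this, add_comm]
    exact eLpNorm_sub_le ((m' x hx01).sub (m' 1 h1m)) ((m x hx01).sub (m 1 h1m)) le_rfl
  have h0 := (eLpNorm_eq_zero_iff ((m 1 h1m).sub (m' 1 h1m)) one_ne_zero).1 (nonpos_iff_eq_zero.1 hle)
  filter_upwards [h0] with t ht
  exact sub_eq_zero.1 ht

/-! ### Bound and stability of the total mass -/

/-- Adds the time `0`, which the mass balance along characteristics leaves out. -/
theorem le_of_le_on_Ioc {f : ℝ → ℝ} {T B : ℝ} (hT : 0 < T) (hf : ContinuousOn f (Icc 0 T))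
    (h : ∀ t ∈ Ioc 0 T, f t ≤ B) : ∀ t ∈ Icc 0 T, f t ≤ B := by
  intro t ht
  have hcl : closure (Ioc 0 T) = Icc 0 T := closure_Ioc hT.ne
  exact le_on_closure h (by rwa [hcl]) continuousOn_const (by rwa [hcl])

namespace IsWeakSolution

variable {lam : ℝ → ℝ → ℝ} {T : ℝ} {ρ₀ u : ℝ → ℝ} {ρ : ℝ → ℝ → ℝ}

/-- The total mass is bounded in terms of the bound of the data. -/
theorem totalMass_le (hs : IsWeakSolution lam T ρ₀ u ρ) (hlam : IsVelocity lam) (hT : 0 < T)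
    (hρ₀ : MemLInftyPlus 1 ρ₀) (hu : MemLInftyPlus T u) {K : ℝ} {g₀ gu : ℝ → ℝ}
    (hg₀ : IsBoundedRep 1 K ρ₀ g₀) (hgu : IsBoundedRep T K u gu) {t : ℝ} (ht : t ∈ Icc 0 T) :
    totalMass ρ t ≤ K * (1 + T) := by
  refine le_of_le_on_Ioc hT hs.continuousOn_totalMass (fun t ht => ?_) t ht
  -- This `R` depends on the solution and serves only to make the mass balance available. The
  -- resulting bound does not depend on it, so that afterwards one regular velocity serves all data
  -- bounded by `K`.
  obtain ⟨R, hR⟩ := isCompact_Icc.exists_bound_of_continuousOn hs.continuousOn_totalMass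
  have hR0 : 0 ≤ R := (norm_nonneg _).trans (hR 0 ⟨le_rfl, hT.le⟩)
  obtain ⟨v, μ, c, Λ, L, h, hv⟩ := hlam.exists_regularVelocity hR0
  have hw := hs.continuous_extendedMass hT.le
  have hvl : ∀ t ∈ Icc 0 T, ∀ x ∈ Icc (0 : ℝ) 1,
      v x (extendedMass T ρ t) = lam x (totalMass ρ t) := fun t ht x hx => by
    rw [extendedMass_of_mem ht]
    exact hv x hx _ ⟨hs.mass_nonneg t ht, (le_abs_self _).trans (hR t ht)⟩
  have key := hs.integral_eq_primitive h hw hvl hρ₀ hu hg₀ hgu ht (right_mem_Icc.2 zero_le_one)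
  rw [totalMass, key]
  set σ := foot v (extendedMass T ρ) t 1
  have h1 : primitive g₀ σ ≤ K * 1 := by
    -- The foot may have either sign; `min σ 0` is a point where the primitive vanishes.
    have e0 := hg₀.primitive_eq_zero (min_le_right σ 0)
    have e1 := abs_primitive_sub_le_integral_abs hg₀.integrable (min σ 0) σ
    rw [e0, sub_zero] at e1
    exact (le_abs_self _).trans (e1.trans (hg₀.integral_abs_le zero_le_one))
  have h2 := (le_abs_self _).trans ((abs_primitive_sub_le_integral_abs hgu.integrable
    (entryTime v (extendedMass T ρ) σ) t).trans (hgu.integral_abs_le hT.le))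
  linarith

end IsWeakSolution

/-- The displacements are compared at an entry time that lies in `[0, t]`. Hence only the masses on
`[0, t]` enter, as Gronwall's inequality requires. -/
theorem entryTime_sub_le_of_nonneg {v μ : ℝ → ℝ → ℝ} {c Λ L : ℝ} (h : RegularVelocity v μ c Λ L)
    {w w' : ℝ → ℝ} (hw : Continuous w) (hw' : Continuous w') {σ t : ℝ} (σ' : ℝ)
    (he : entryTime v w σ ∈ Icc 0 t) :
    c * |entryTime v w σ - entryTime v w' σ'| ≤ |σ - σ'| + L * ∫ s in (0 : ℝ)..t, |w s - w' s| := by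
  set e := entryTime v w σ with hedef
  have h1 := inletShift_lower_abs h hw' (entryTime v w' σ') e
  rw [inletShift_entryTime h hw'] at h1
  have h2 : inletShift v w e = -σ := inletShift_entryTime h hw σ
  have hint : ∀ a b, IntervalIntegrable (fun s => |w s - w' s|) volume a b := fun a b =>
    (hw.sub hw').abs.intervalIntegrable a b
  have h3 : |inletShift v w' e - inletShift v w e| ≤ L * ∫ s in (0 : ℝ)..t, |w s - w' s| := by
    rw [inletShift, inletShift, ← intervalIntegral.integral_sub
      ((h.continuous_comp continuous_const hw').intervalIntegrable _ _)
      ((h.continuous_comp continuous_const hw).intervalIntegrable _ _), ← Real.norm_eq_abs]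
    refine (intervalIntegral.norm_integral_le_of_norm_le (g := fun s => L * |w s - w' s|) he.1
      (Eventually.of_forall fun s _ => ?_) ((hint _ _).const_mul L)).trans ?_
    · have := h.lip 0 (w' s) 0 (w s)
      rwa [sub_self, abs_zero, zero_add, abs_sub_comm (w' s)] at this
    · rw [intervalIntegral.integral_const_mul]
      refine mul_le_mul_of_nonneg_left ?_ h.L_nonneg
      exact intervalIntegral.integral_mono_interval le_rfl he.1 he.2
        (Eventually.of_forall fun s => abs_nonneg _) (hint _ _)
  refine h1.trans ?_
  rw [show inletShift v w' e - -σ' = (inletShift v w' e - inletShift v w e) + (σ' - σ) by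
    rw [h2]; ring]
  refine (abs_add_le _ _).trans ?_
  rw [abs_sub_comm σ', add_comm]
  exact add_le_add le_rfl h3

/-- Stability of the total mass with respect to the data in `L¹`. -/
theorem abs_totalMass_sub_le {lam : ℝ → ℝ → ℝ} {T K : ℝ} (hT : 0 < T)
    {v μ : ℝ → ℝ → ℝ} {c Λ L : ℝ} (h : RegularVelocity v μ c Λ L)
    {ρ₀ u ρ₀' u' : ℝ → ℝ} {ρ ρ' : ℝ → ℝ → ℝ}
    (hs : IsWeakSolution lam T ρ₀ u ρ) (hs' : IsWeakSolution lam T ρ₀' u' ρ')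
    (hvl : ∀ t ∈ Icc 0 T, ∀ x ∈ Icc (0 : ℝ) 1, v x (extendedMass T ρ t) = lam x (totalMass ρ t))
    (hvl' : ∀ t ∈ Icc 0 T, ∀ x ∈ Icc (0 : ℝ) 1, v x (extendedMass T ρ' t) = lam x (totalMass ρ' t))
    (hρ₀ : MemLInftyPlus 1 ρ₀) (hu : MemLInftyPlus T u)
    (hρ₀' : MemLInftyPlus 1 ρ₀') (hu' : MemLInftyPlus T u') {g₀ gu g₀' gu' : ℝ → ℝ}
    (hg₀ : IsBoundedRep 1 K ρ₀ g₀) (hgu : IsBoundedRep T K u gu)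
    (hg₀' : IsBoundedRep 1 K ρ₀' g₀') (hgu' : IsBoundedRep T K u' gu') (s : ℝ) :
    |extendedMass T ρ' s - extendedMass T ρ s|
      ≤ 2 * ((∫ x, |g₀' x - g₀ x|) + ∫ x, |gu' x - gu x|)
        * Real.exp ((K * (L * Real.exp (L * T)) + K / c * (L * Real.exp (L * T) + L)) * T) := by
  have hK : 0 ≤ K := (abs_nonneg _).trans (hg₀.bound 0)
  have hc := h.pos
  have hL := h.L_nonneg
  have hw := hs.continuous_extendedMass hT.le
  have hw' := hs'.continuous_extendedMass hT.le
  set w := extendedMass T ρ with hwdef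
  set w' := extendedMass T ρ' with hwdef'
  set E₀ := ∫ x, |g₀' x - g₀ x| with hE₀
  set Eu := ∫ x, |gu' x - gu x| with hEu
  have hE₀0 : 0 ≤ E₀ := integral_nonneg fun _ => abs_nonneg _
  have hEu0 : 0 ≤ Eu := integral_nonneg fun _ => abs_nonneg _
  set C₁ := K * (L * Real.exp (L * T)) + K / c * (L * Real.exp (L * T) + L) with hC₁
  have hC₁0 : 0 ≤ C₁ := by positivity
  have hfc : Continuous fun s => |w' s - w s| := by fun_prop
  set J : ℝ → ℝ := fun t => ∫ s in (0 : ℝ)..t, |w' s - w s| with hJ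
  have hJc : Continuous J := intervalIntegral.continuous_primitive
    (fun a b => hfc.intervalIntegrable a b) 0
  have hbound : ∀ t ∈ Icc 0 T, |w' t - w t| - C₁ * J t ≤ 2 * (E₀ + Eu) := by
    refine le_of_le_on_Ioc hT (by fun_prop) fun t ht => ?_
    have htT := Ioc_subset_Icc_self ht
    have hJ0 : 0 ≤ J t := intervalIntegral.integral_nonneg ht.1.le fun _ _ => abs_nonneg _
    have hJ' : ∫ s in (0 : ℝ)..t, |w s - w' s| = J t := by
      simp only [hJ, abs_sub_comm (w' _)]
    have one := right_mem_Icc.2 (zero_le_one (α := ℝ))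
    have k1 := hs.integral_eq_primitive h hw hvl hρ₀ hu hg₀ hgu ht one
    have k2 := hs'.integral_eq_primitive h hw' hvl' hρ₀' hu' hg₀' hgu' ht one
    have e1 : w t = ∫ z in (0 : ℝ)..1, ρ t z := extendedMass_of_mem htT
    have e2 : w' t = ∫ z in (0 : ℝ)..1, ρ' t z := extendedMass_of_mem htT
    set σ := foot v w t 1 with hσ
    set σ' := foot v w' t 1 with hσ'
    set e := entryTime v w σ with he
    set e' := entryTime v w' σ' with he'
    have het : e ≤ t := entryTime_foot_le h hw ht.1.le zero_le_one
    have het' : e' ≤ t := entryTime_foot_le h hw' ht.1.le zero_le_one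
    -- Both characteristics pass through `(t, 1)`, so their feet differ only because the masses do.
    have hσσ : |σ' - σ| ≤ L * Real.exp (L * T) * J t := by
      have := IsChar.abs_sub_le_exp h hw' hw (isChar_flow h hw' t 1) (isChar_flow h hw t 1) t 0
      rw [flow_self h hw, flow_self h hw', sub_self, abs_zero, zero_add,
        intervalIntegral.integral_symm, abs_neg, zero_sub, abs_neg, abs_of_pos ht.1] at this
      change |σ' - σ| ≤ L * |J t| * _ at this
      rw [abs_of_nonneg hJ0] at this
      have hexp : Real.exp (L * t) ≤ Real.exp (L * T) := by gcongr; exact ht.2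
      calc |σ' - σ| ≤ L * J t * Real.exp (L * t) := this
        _ ≤ L * J t * Real.exp (L * T) := by gcongr
        _ = _ := by ring
    have hp₀ : |primitive g₀' σ' - primitive g₀ σ| ≤ E₀ + K * |σ' - σ| := by
      have a1 := abs_primitive_sub_le_integral hg₀.integrable hg₀'.integrable σ'
      have a2 := abs_primitive_sub_le hg₀.integrable hg₀.bound σ σ'
      calc _ ≤ |primitive g₀' σ' - primitive g₀ σ'| + |primitive g₀ σ' - primitive g₀ σ| :=
            abs_sub_le _ _ _
        _ ≤ _ := add_le_add a1 a2
    have hpt := abs_primitive_sub_le_integral hgu.integrable hgu'.integrable t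
    have hpe : |primitive gu' e' - primitive gu e|
        ≤ Eu + K / c * ((L * Real.exp (L * T) + L) * J t) := by
      -- One entry time in `[0, t]` is enough, since the comparison may start from either solution.
      -- If both are negative, the primitives of the boundary data vanish there.
      have hee : 0 ≤ e ∨ 0 ≤ e' →
          |e' - e| ≤ (L * Real.exp (L * T) + L) * J t / c := by
        intro hor
        rw [le_div_iff₀' hc, add_mul]
        rcases hor with h0 | h0
        · have a1 := entryTime_sub_le_of_nonneg h hw hw' σ' ⟨h0, het⟩
          rw [hJ', abs_sub_comm, abs_sub_comm σ] at a1
          exact a1.trans (add_le_add hσσ le_rfl)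
        · exact (entryTime_sub_le_of_nonneg h hw' hw σ ⟨h0, het'⟩).trans (add_le_add hσσ le_rfl)
      by_cases hor : 0 ≤ e ∨ 0 ≤ e'
      · have a1 := abs_primitive_sub_le_integral hgu.integrable hgu'.integrable e'
        have a2 := abs_primitive_sub_le hgu.integrable hgu.bound e e'
        have a3 : K * |e' - e| ≤ K / c * ((L * Real.exp (L * T) + L) * J t) := by
          rw [div_mul_eq_mul_div, mul_div_assoc]
          exact mul_le_mul_of_nonneg_left (hee hor) hK
        calc _ ≤ |primitive gu' e' - primitive gu e'| + |primitive gu e' - primitive gu e| :=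
              abs_sub_le _ _ _
          _ ≤ _ := add_le_add a1 (a2.trans a3)
      · rw [not_or, not_le, not_le] at hor
        rw [hgu.primitive_eq_zero hor.1.le, hgu'.primitive_eq_zero hor.2.le, sub_zero, abs_zero]
        positivity
    have hsplit : w' t - w t = (primitive g₀' σ' - primitive g₀ σ)
        + ((primitive gu' t - primitive gu t) - (primitive gu' e' - primitive gu e)) := by
      rw [e1, e2, k1, k2]; ring
    have htri : |w' t - w t| ≤ |primitive g₀' σ' - primitive g₀ σ|
        + (|primitive gu' t - primitive gu t| + |primitive gu' e' - primitive gu e|) := by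
      rw [hsplit]
      exact (abs_add_le _ _).trans (add_le_add le_rfl (abs_sub _ _))
    have hKσ := mul_le_mul_of_nonneg_left hσσ hK
    -- `E₀` occurs once and `Eu` twice, at the times `t` and `e'`; this is the source of the factor
    -- `2`.
    rw [hC₁]
    linarith
  have hfin : ∀ t ∈ Icc 0 T, |w' t - w t| ≤ 2 * (E₀ + Eu) * Real.exp (C₁ * T) := by
    intro t ht
    have := le_mul_exp_of_le_add_mul_integral hfc hC₁0 ht.1 (A := 2 * (E₀ + Eu)) fun r hr => by
      have := hbound r ⟨hr.1, hr.2.trans ht.2⟩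
      simp only [hJ] at this
      linarith
    rw [sub_zero] at this
    refine this.trans ?_
    gcongr
    exact ht.2
  have hcl := clamp_mem_Icc hT.le s
  have := hfin _ hcl
  rw [hwdef, hwdef', extendedMass_of_mem hcl, extendedMass_of_mem hcl] at this
  exact this

/-! ### Continuity of the out-flux in the data -/

/-- The out-flux computed from the representative given by the characteristics. -/
noncomputable def charOutflux (v μ : ℝ → ℝ → ℝ) (w g₀ gu : ℝ → ℝ) (t : ℝ) : ℝ :=
  charRep v μ w g₀ gu t 1 * v 1 (w t)

theorem tendsto_charOutflux {v μ : ℝ → ℝ → ℝ} {c Λ L : ℝ} {w : ℝ → ℝ}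
    {ι : Type*} {l : Filter ι} [l.IsCountablyGenerated]
    {W : ι → ℝ → ℝ} {D : ι → ℝ} (h : RegularVelocity v μ c Λ L) (hw : Continuous w)
    (hW : ∀ n, Continuous (W n)) (hD : ∀ n s, |W n s - w s| ≤ D n) (hD0 : Tendsto D l (𝓝 0))
    {g₀ gu : ℝ → ℝ} {G₀ Gu : ι → ℝ → ℝ} {K T : ℝ}
    (hg₀m : Measurable g₀) (hgum : Measurable gu) (hg₀ : Integrable g₀) (hgu : Integrable gu)
    (hg₀b : ∀ x, |g₀ x| ≤ K) (hgub : ∀ x, |gu x| ≤ K)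
    (hG₀m : ∀ n, Measurable (G₀ n)) (hGum : ∀ n, Measurable (Gu n))
    (hG₀b : ∀ n x, |G₀ n x| ≤ K) (hGub : ∀ n x, |Gu n x| ≤ K)
    (hG₀ : Tendsto (fun n => eLpNorm (fun y => G₀ n y - g₀ y) 1 volume) l (𝓝 0))
    (hGu : Tendsto (fun n => eLpNorm (fun y => Gu n y - gu y) 1 volume) l (𝓝 0))
    {p : ℝ≥0∞} (hp : 1 ≤ p) (hp' : p ≠ ∞) :
    Tendsto (fun n => eLpNorm (fun t => charOutflux v μ (W n) (G₀ n) (Gu n) t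
      - charOutflux v μ w g₀ gu t) p (volIoo T)) l (𝓝 0) := by
  have hK : 0 ≤ K := (abs_nonneg _).trans (hg₀b 0)
  have hc := h.pos
  have hΛ := h.Λ_pos
  obtain ⟨M, hM⟩ : ∃ M : ℝ≥0, (M : ℝ) = Real.exp (L * T) * K + Real.exp (L * T) / c * K :=
    ⟨_, Real.coe_toNNReal _ (by positivity)⟩
  obtain ⟨N, hN⟩ : ∃ N : ℝ≥0, (N : ℝ) = Λ := ⟨_, Real.coe_toNNReal _ hΛ.le⟩
  have hmem : ∀ᵐ t ∂volIoo T, t ∈ Ioo 0 T := ae_restrict_mem measurableSet_Ioo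
  have hb : ∀ {w g₀ gu : ℝ → ℝ}, (∀ x, |g₀ x| ≤ K) → (∀ x, |gu x| ≤ K) → ∀ t ∈ Ioo 0 T,
      |charRep v μ w g₀ gu t 1| ≤ M := fun h1 h2 t ht => by
    rw [hM]
    exact abs_charRep_le h h1 h2 (Ioo_subset_Icc_self ht)
  have hv : ∀ w : ℝ, |v 1 w| ≤ N := fun w => by
    rw [abs_of_pos (h.pos' _ _), hN]
    exact h.upper _ _
  have hb' : ∀ {w g₀ gu : ℝ → ℝ}, (∀ x, |g₀ x| ≤ K) → (∀ x, |gu x| ≤ K) → ∀ t ∈ Ioo 0 T,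
      |charOutflux v μ w g₀ gu t| ≤ M * N := fun h1 h2 t ht => by
    rw [charOutflux, abs_mul]
    exact mul_le_mul (hb h1 h2 t ht) (hv _) (abs_nonneg _) M.2
  refine tendsto_eLpNorm_of_bounded (M := M * N + M * N) ?_ hp hp' ?_
  · refine Eventually.of_forall fun n => ?_
    filter_upwards [hmem] with t ht
    exact (abs_sub _ _).trans (by
      push_cast
      exact add_le_add (hb' (hG₀b n) (hGub n) t ht) (hb' hg₀b hgub t ht))
  have l1 := tendsto_charRep h hw hW hD hD0 (x := fun _ => 1) tendsto_const_nhds hg₀m hgum hg₀ hgu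
    hG₀m hGum hG₀ hGu T
  have hm := fun n => aestronglyMeasurable_charRep_time h (hW n) (hG₀m n) (hGum n) T 1
  have hm₀ := aestronglyMeasurable_charRep_time h hw hg₀m hgum T 1
  have hvm : ∀ {w : ℝ → ℝ}, Continuous w → AEStronglyMeasurable (fun t => v 1 (w t)) (volIoo T) :=
    fun hw => (h.continuous_comp continuous_const hw).aestronglyMeasurable
  have l2 : Tendsto (fun n => eLpNorm (fun t => charRep v μ w g₀ gu t 1 * v 1 (W n t)
      - charRep v μ w g₀ gu t 1 * v 1 (w t)) 1 (volIoo T)) l (𝓝 0) := by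
    refine tendsto_eLpNorm_one_of_dominated (bound := fun _ => M * N + M * N) (integrable_const _)
      (fun n => hm₀.mul (hvm (hW n))) (hm₀.mul (hvm hw)) ?_ ?_
    · refine Eventually.of_forall fun n => ?_
      filter_upwards [hmem] with t ht
      have hbt := hb (w := w) hg₀b hgub t ht
      refine (abs_sub _ _).trans (add_le_add ?_ ?_)
      · rw [abs_mul]; exact mul_le_mul hbt (hv _) (abs_nonneg _) M.2
      · rw [abs_mul]; exact mul_le_mul hbt (hv _) (abs_nonneg _) M.2
    · refine Eventually.of_forall fun t => Tendsto.const_mul _ ?_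
      have hWt : Tendsto (fun n => W n t) l (𝓝 (w t)) := by
        rw [tendsto_iff_dist_tendsto_zero]
        exact squeeze_zero (fun _ => dist_nonneg) (fun n => hD n t) hD0
      exact (h.continuous_uncurry.tendsto (1, w t)).comp (tendsto_const_nhds.prodMk_nhds hWt)
  have l3 := (ENNReal.Tendsto.const_mul (a := (N : ℝ≥0∞)) l1 (Or.inr ENNReal.coe_ne_top)).add l2
  rw [mul_zero, add_zero] at l3
  refine tendsto_of_tendsto_of_tendsto_of_le_of_le tendsto_const_nhds l3 (fun _ => bot_le)
    fun n => ?_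
  -- The change of the trace is multiplied by a velocity at most `Λ`; the change of the velocity
  -- multiplies a fixed bounded trace.
  have hsplit : (fun t => charOutflux v μ (W n) (G₀ n) (Gu n) t - charOutflux v μ w g₀ gu t)
      = (fun t => (charRep v μ (W n) (G₀ n) (Gu n) t 1 - charRep v μ w g₀ gu t 1) * v 1 (W n t))
        + (fun t => charRep v μ w g₀ gu t 1 * v 1 (W n t)
          - charRep v μ w g₀ gu t 1 * v 1 (w t)) := by
    ext t
    simp only [charOutflux, Pi.add_apply]
    ring
  simp only [hsplit]
  refine (eLpNorm_add_le (((hm n).sub hm₀).mul (hvm (hW n)))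
    ((hm₀.mul (hvm (hW n))).sub (hm₀.mul (hvm hw))) le_rfl).trans (add_le_add ?_ le_rfl)
  refine eLpNorm_le_nnreal_smul_eLpNorm_of_ae_le_mul (c := N) (Eventually.of_forall fun t => ?_) 1
  simp only [Pi.mul_apply, Pi.sub_apply]
  rw [nnnorm_mul, mul_comm]
  gcongr
  exact_mod_cast hv _

theorem tendsto_integral_abs_of_eLpNorm {ι : Type*} {l : Filter ι} {f : ι → ℝ → ℝ}
    (hf : ∀ n, Integrable (f n))
    (h : Tendsto (fun n => eLpNorm (f n) 1 volume) l (𝓝 0)) :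
    Tendsto (fun n => ∫ x, |f n x|) l (𝓝 0) := by
  have h1 := (ENNReal.tendsto_toReal ENNReal.zero_ne_top).comp h
  refine h1.congr fun n => ?_
  simp only [Function.comp]
  rw [eLpNorm_one_eq_lintegral_enorm, ← integral_norm_eq_lintegral_enorm (hf n).aestronglyMeasurable]
  rfl

theorem tendsto_eLpNorm_one_volIoo {ι : Type*} {l : Filter ι} {a : ℝ} {f : ι → ℝ → ℝ}
    (hm : ∀ n, AEStronglyMeasurable (f n) (volIoo a)) {p : ℝ≥0∞} (hp : 1 ≤ p)
    (h : Tendsto (fun n => eLpNorm (f n) p (volIoo a)) l (𝓝 0)) :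
    Tendsto (fun n => eLpNorm (f n) 1 (volIoo a)) l (𝓝 0) := by
  have hne : volIoo a univ ^ (1 / (1 : ℝ≥0∞).toReal - 1 / p.toReal) ≠ ∞ := by
    refine ENNReal.rpow_ne_top_of_nonneg ?_ (measure_ne_top _ _)
    rcases eq_or_ne p ∞ with rfl | hp'
    · simp
    · have hp1 : 1 ≤ p.toReal := by
        have := ENNReal.toReal_mono hp' hp
        simpa using this
      rw [ENNReal.toReal_one, sub_nonneg]
      gcongr
  have h1 := ENNReal.Tendsto.mul_const (b := volIoo a univ ^ (1 / (1 : ℝ≥0∞).toReal - 1 / p.toReal))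
    h (Or.inr hne)
  rw [zero_mul] at h1
  exact tendsto_of_tendsto_of_tendsto_of_le_of_le tendsto_const_nhds h1 (fun _ => bot_le)
    fun n => eLpNorm_le_eLpNorm_mul_rpow_measure_univ hp (hm n)

theorem IsWeakSolution.velocity_eq {lam : ℝ → ℝ → ℝ} (hlam : IsVelocity lam) {T : ℝ} (hT : 0 < T)
    {ρ₀ u g₀ gu : ℝ → ℝ} {ρ : ℝ → ℝ → ℝ} {K : ℝ} (hs : IsWeakSolution lam T ρ₀ u ρ)
    (hρ₀ : MemLInftyPlus 1 ρ₀) (hu : MemLInftyPlus T u)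
    (hg₀ : IsBoundedRep 1 K ρ₀ g₀) (hgu : IsBoundedRep T K u gu) {v : ℝ → ℝ → ℝ}
    (hv : ∀ x ∈ Icc (0 : ℝ) 1, ∀ w ∈ Icc (0 : ℝ) (K * (1 + T)), v x w = lam x w) :
    ∀ t ∈ Icc 0 T, ∀ x ∈ Icc (0 : ℝ) 1, v x (extendedMass T ρ t) = lam x (totalMass ρ t) :=
  fun t ht x hx => by
    rw [extendedMass_of_mem ht]
    exact hv x hx _ ⟨hs.mass_nonneg t ht, hs.totalMass_le hlam hT hρ₀ hu hg₀ hgu ht⟩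

theorem IsSpaceContinuousRep.isOutflux_charOutflux {lam v μ : ℝ → ℝ → ℝ} {T : ℝ}
    {ρ : ℝ → ℝ → ℝ} {g₀ gu : ℝ → ℝ}
    (hr : IsSpaceContinuousRep T ρ (charRep v μ (extendedMass T ρ) g₀ gu))
    (hvl : ∀ t ∈ Icc 0 T, ∀ x ∈ Icc (0 : ℝ) 1, v x (extendedMass T ρ t) = lam x (totalMass ρ t)) :
    IsOutflux lam T ρ (charOutflux v μ (extendedMass T ρ) g₀ gu) := by
  refine ⟨_, hr, ?_⟩
  have hmem : ∀ᵐ t ∂volIoo T, t ∈ Ioo 0 T := ae_restrict_mem measurableSet_Ioo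
  filter_upwards [hmem] with t ht
  rw [charOutflux, hvl t (Ioo_subset_Icc_self ht) 1 (right_mem_Icc.2 zero_le_one)]

theorem IsOutflux.ae_eq {lam : ℝ → ℝ → ℝ} {T : ℝ} {ρ : ℝ → ℝ → ℝ} {y y' : ℝ → ℝ}
    (h : IsOutflux lam T ρ y) (h' : IsOutflux lam T ρ y') : y =ᵐ[volIoo T] y' := by
  obtain ⟨r, hr, hy⟩ := h
  obtain ⟨r', hr', hy'⟩ := h'
  filter_upwards [hr.ae_eq_right hr', hy, hy'] with t h1 h2 h3
  rw [h2, h3, h1]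

theorem exists_isOutflux {lam : ℝ → ℝ → ℝ} (hlam : IsVelocity lam) {T : ℝ} (hT : 0 < T)
    {ρ₀ u : ℝ → ℝ} {ρ : ℝ → ℝ → ℝ} {K : ℝ≥0} (hs : IsWeakSolution lam T ρ₀ u ρ)
    (hρ₀ : MemLInftyPlus 1 ρ₀) (hu : MemLInftyPlus T u)
    (hK₀ : eLpNorm ρ₀ ∞ (volIoo 1) ≤ K) (hKu : eLpNorm u ∞ (volIoo T) ≤ K) :
    ∃ y, IsOutflux lam T ρ y := by
  obtain ⟨g₀, hg₀⟩ := exists_isBoundedRep hρ₀ hK₀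
  obtain ⟨gu, hgu⟩ := exists_isBoundedRep hu hKu
  obtain ⟨v, μ, c, Λ, L, h, hv⟩ := hlam.exists_regularVelocity
    (R := K * (1 + T)) (by positivity)
  have hvl := hs.velocity_eq hlam hT hρ₀ hu hg₀ hgu hv
  exact ⟨_, (hs.isSpaceContinuousRep_charRep h (hs.continuous_extendedMass hT.le) hvl hρ₀ hu hg₀
    hgu).isOutflux_charOutflux hvl⟩

/-- Sequential continuity of the out-flux with respect to the data. -/
theorem tendsto_eLpNorm_outflux {lam : ℝ → ℝ → ℝ} (hlam : IsVelocity lam) {T : ℝ} (hT : 0 < T)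
    {ρ₀ u : ℝ → ℝ} {ρ : ℝ → ℝ → ℝ} {K : ℝ≥0} (hs : IsWeakSolution lam T ρ₀ u ρ)
    (hρ₀ : MemLInftyPlus 1 ρ₀) (hu : MemLInftyPlus T u)
    (hK₀ : eLpNorm ρ₀ ∞ (volIoo 1) ≤ K) (hKu : eLpNorm u ∞ (volIoo T) ≤ K)
    {ι : Type*} {l : Filter ι} [l.IsCountablyGenerated] {P₀ U : ι → ℝ → ℝ} {P : ι → ℝ → ℝ → ℝ}
    (hS : ∀ n, IsWeakSolution lam T (P₀ n) (U n) (P n))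
    (hP₀ : ∀ n, MemLInftyPlus 1 (P₀ n)) (hU : ∀ n, MemLInftyPlus T (U n))
    (hKP : ∀ n, eLpNorm (P₀ n) ∞ (volIoo 1) ≤ K) (hKU : ∀ n, eLpNorm (U n) ∞ (volIoo T) ≤ K)
    {p : ℝ≥0∞} (hp : 1 ≤ p) (hp' : p ≠ ∞)
    (hlP : Tendsto (fun n => eLpNorm (fun x => P₀ n x - ρ₀ x) p (volIoo 1)) l (𝓝 0))
    (hlU : Tendsto (fun n => eLpNorm (fun t => U n t - u t) p (volIoo T)) l (𝓝 0))
    {y : ℝ → ℝ} {Y : ι → ℝ → ℝ} (hy : IsOutflux lam T ρ y) (hY : ∀ n, IsOutflux lam T (P n) (Y n)) :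
    Tendsto (fun n => eLpNorm (fun t => Y n t - y t) p (volIoo T)) l (𝓝 0) := by
  obtain ⟨v, μ, c, Λ, L, h, hv⟩ := hlam.exists_regularVelocity
    (R := K * (1 + T)) (by positivity)
  obtain ⟨g₀, hg₀⟩ := exists_isBoundedRep hρ₀ hK₀
  obtain ⟨gu, hgu⟩ := exists_isBoundedRep hu hKu
  choose G₀ hG₀ using fun n => exists_isBoundedRep (hP₀ n) (hKP n)
  choose Gu hGu using fun n => exists_isBoundedRep (hU n) (hKU n)
  have hvl := hs.velocity_eq hlam hT hρ₀ hu hg₀ hgu hv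
  have hvL := fun n => (hS n).velocity_eq hlam hT (hP₀ n) (hU n) (hG₀ n) (hGu n) hv
  have hw := hs.continuous_extendedMass hT.le
  have hW := fun n => (hS n).continuous_extendedMass hT.le
  have hy' := hy.ae_eq ((hs.isSpaceContinuousRep_charRep h hw hvl hρ₀ hu hg₀
    hgu).isOutflux_charOutflux hvl)
  have hY' := fun n => (hY n).ae_eq (((hS n).isSpaceContinuousRep_charRep h (hW n) (hvL n) (hP₀ n)
    (hU n) (hG₀ n) (hGu n)).isOutflux_charOutflux (hvL n))
  have hlP1 := tendsto_eLpNorm_one_volIoo (fun n =>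
    (hP₀ n).memLp.aestronglyMeasurable.sub hρ₀.memLp.aestronglyMeasurable) hp hlP
  have hlU1 := tendsto_eLpNorm_one_volIoo (fun n =>
    (hU n).memLp.aestronglyMeasurable.sub hu.memLp.aestronglyMeasurable) hp hlU
  have hlG₀ : Tendsto (fun n => eLpNorm (fun x => G₀ n x - g₀ x) 1 volume) l (𝓝 0) :=
    hlP1.congr fun n => (hg₀.eLpNorm_sub_eq (hG₀ n)).symm
  have hlGu : Tendsto (fun n => eLpNorm (fun x => Gu n x - gu x) 1 volume) l (𝓝 0) :=
    hlU1.congr fun n => (hgu.eLpNorm_sub_eq (hGu n)).symm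
  have i₀ := tendsto_integral_abs_of_eLpNorm
    (fun n => (hG₀ n).integrable.sub hg₀.integrable) hlG₀
  have iu := tendsto_integral_abs_of_eLpNorm
    (fun n => (hGu n).integrable.sub hgu.integrable) hlGu
  have hD0 := ((i₀.add iu).const_mul 2).mul_const
    (Real.exp ((K * (L * Real.exp (L * T)) + K / c * (L * Real.exp (L * T) + L)) * T))
  rw [add_zero, mul_zero, zero_mul] at hD0
  -- Convergence of the data in `L¹` forces uniform convergence of the masses, which is what the
  -- continuity of the formula needs.
  have hD := fun n s => abs_totalMass_sub_le hT h hs (hS n) hvl (hvL n) hρ₀ hu (hP₀ n) (hU n) hg₀ hgu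
    (hG₀ n) (hGu n) s
  have key := tendsto_charOutflux h hw hW hD hD0 hg₀.measurable hgu.measurable hg₀.integrable
    hgu.integrable hg₀.bound hgu.bound (fun n => (hG₀ n).measurable) (fun n => (hGu n).measurable)
    (fun n => (hG₀ n).bound) (fun n => (hGu n).bound) hlG₀ hlGu (T := T) hp hp'
  refine key.congr fun n => eLpNorm_congr_ae ?_
  filter_upwards [hy', hY' n] with t h1 h2
  rw [h1, h2]

/-- If no `η` worked, the choices `η = 1 / (n + 1)` would give data converging to `(ρ₀, u)` whose
out-fluxes stay at distance at least `ε`, against sequential continuity. -/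
theorem exists_pos_forall_eLpNorm_outflux_lt {lam : ℝ → ℝ → ℝ} (hlam : IsVelocity lam) {T : ℝ}
    (hT : 0 < T) {ρ₀ u : ℝ → ℝ} {ρ : ℝ → ℝ → ℝ} {K : ℝ≥0} (hs : IsWeakSolution lam T ρ₀ u ρ)
    (hρ₀ : MemLInftyPlus 1 ρ₀) (hu : MemLInftyPlus T u)
    (hK : eLpNorm ρ₀ ∞ (volIoo 1) + eLpNorm u ∞ (volIoo T) ≤ K)
    {p : ℝ≥0∞} (hp : 1 ≤ p) (hp' : p ≠ ∞) {y : ℝ → ℝ} (hy : IsOutflux lam T ρ y)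
    {ε : ℝ≥0∞} (hε : 0 < ε) :
    ∃ η : ℝ, 0 < η ∧ ∀ (ρ₀' u' : ℝ → ℝ), MemLInftyPlus 1 ρ₀' → MemLInftyPlus T u' →
      eLpNorm ρ₀' ∞ (volIoo 1) + eLpNorm u' ∞ (volIoo T) ≤ K →
      eLpNorm (fun x => ρ₀' x - ρ₀ x) p (volIoo 1)
        + eLpNorm (fun t => u' t - u t) p (volIoo T) < ENNReal.ofReal η →
      ∀ (ρ' : ℝ → ℝ → ℝ) (y' : ℝ → ℝ), IsWeakSolution lam T ρ₀' u' ρ' → IsOutflux lam T ρ' y' →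
        eLpNorm (fun t => y' t - y t) p (volIoo T) < ε := by
  by_contra! hcon
  choose P₀ U hP₀ hU hKU hdist P Y hS hY hge using fun n : ℕ =>
    hcon (1 / ((n : ℝ) + 1)) (by positivity)
  have h0 : Tendsto (fun n : ℕ => ENNReal.ofReal (1 / ((n : ℝ) + 1))) atTop (𝓝 0) := by
    have := ENNReal.tendsto_ofReal (tendsto_one_div_add_atTop_nhds_zero_nat (𝕜 := ℝ))
    rwa [ENNReal.ofReal_zero] at this
  have hlP := tendsto_of_tendsto_of_tendsto_of_le_of_le tendsto_const_nhds h0 (fun _ => bot_le)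
    fun n => le_self_add.trans (hdist n).le
  have hlU := tendsto_of_tendsto_of_tendsto_of_le_of_le tendsto_const_nhds h0 (fun _ => bot_le)
    fun n => le_add_self.trans (hdist n).le
  have key := tendsto_eLpNorm_outflux hlam hT hs hρ₀ hu (le_self_add.trans hK)
    (le_add_self.trans hK) hS hP₀ hU (fun n => le_self_add.trans (hKU n))
    (fun n => le_add_self.trans (hKU n)) hp hp' hlP hlU hy hY
  exact absurd (ge_of_tendsto' key hge) (not_le.2 hε)

theorem IsOutflux.aestronglyMeasurable {lam : ℝ → ℝ → ℝ} (hlam : IsVelocity lam) {T : ℝ}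
    {ρ₀ u : ℝ → ℝ} {ρ : ℝ → ℝ → ℝ} (hs : IsWeakSolution lam T ρ₀ u ρ) {y : ℝ → ℝ}
    (hy : IsOutflux lam T ρ y) : AEStronglyMeasurable y (volIoo T) := by
  obtain ⟨r, hr, hyr⟩ := hy
  have h1 := (hr.memLp 1 le_rfl ENNReal.one_ne_top 1
    (right_mem_Icc.2 zero_le_one)).aestronglyMeasurable
  have h2 : ContinuousOn (fun t => lam 1 (totalMass ρ t)) (Icc 0 T) :=
    hlam.contDiffOn.continuousOn.comp (f := fun t => ((1 : ℝ), totalMass ρ t))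
      (continuousOn_const.prodMk hs.continuousOn_totalMass)
      fun t ht => ⟨right_mem_Icc.2 zero_le_one, hs.mass_nonneg t ht⟩
  exact (h1.mul ((h2.mono Ioo_subset_Icc_self).aestronglyMeasurable measurableSet_Ioo)).congr
    (EventuallyEq.symm hyr)

theorem mainTheorem3
    (lam : ℝ → ℝ → ℝ) (hlam : IsVelocity lam) (T : ℝ) (hT : 0 < T)
    (ρ₀ u : ℝ → ℝ) (hρ₀ : MemLInftyPlus 1 ρ₀) (hu : MemLInftyPlus T u)
    (ε : ℝ) (hε : 0 < ε) (p : ℝ≥0∞) (hp : 1 ≤ p) (hp' : p ≠ ∞) (K : ℝ≥0)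
    (hK : eLpNorm ρ₀ ∞ (volIoo 1) + eLpNorm u ∞ (volIoo T) ≤ K) :
    ∃ η : ℝ, 0 < η ∧
      ∀ ρ₀' u' : ℝ → ℝ, MemLInftyPlus 1 ρ₀' → MemLInftyPlus T u' →
        eLpNorm ρ₀' ∞ (volIoo 1) + eLpNorm u' ∞ (volIoo T) ≤ K →
        eLpNorm (fun x => ρ₀' x - ρ₀ x) p (volIoo 1)
          + eLpNorm (fun t => u' t - u t) p (volIoo T) < ENNReal.ofReal η →
        ∀ ρ ρ' : ℝ → ℝ → ℝ, IsWeakSolution lam T ρ₀ u ρ → IsWeakSolution lam T ρ₀' u' ρ' →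
          (∃ y, IsOutflux lam T ρ y) ∧ (∃ y', IsOutflux lam T ρ' y') ∧
          ∀ y y' : ℝ → ℝ, IsOutflux lam T ρ y → IsOutflux lam T ρ' y' →
            eLpNorm (fun t => y' t - y t) p (volIoo T) < ENNReal.ofReal ε := by
  -- `η` must be chosen before `ρ`, so a reference solution `r` is fixed here. If there is none, the
  -- claim is vacuous and any `η` will do.
  by_cases hex : ∃ r, IsWeakSolution lam T ρ₀ u r
  swap
  · exact ⟨1, one_pos, fun _ _ _ _ _ _ ρ _ hs _ => absurd ⟨ρ, hs⟩ hex⟩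
  obtain ⟨r, hr⟩ := hex
  obtain ⟨z, hz⟩ := exists_isOutflux hlam hT hr hρ₀ hu (le_self_add.trans hK)
    (le_add_self.trans hK)
  have hε2 : 0 < ENNReal.ofReal ε / 2 := ENNReal.half_pos (by simpa using hε)
  obtain ⟨η, hη, H⟩ := exists_pos_forall_eLpNorm_outflux_lt hlam hT hr hρ₀ hu hK hp hp' hz hε2
  refine ⟨η, hη, fun ρ₀' u' hρ₀' hu' hK' hdist ρ ρ' hs hs' => ?_⟩
  refine ⟨exists_isOutflux hlam hT hs hρ₀ hu (le_self_add.trans hK) (le_add_self.trans hK),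
    exists_isOutflux hlam hT hs' hρ₀' hu' (le_self_add.trans hK') (le_add_self.trans hK'),
    fun y y' hy hy' => ?_⟩
  -- The given `ρ` need not be `r`; it is treated as a solution for data at distance zero, which
  -- costs the other half of `ε`.
  have h1 := H ρ₀ u hρ₀ hu hK (by simpa using hη) ρ y hs hy
  have h2 := H ρ₀' u' hρ₀' hu' hK' hdist ρ' y' hs' hy'
  have hm := hy.aestronglyMeasurable hlam hs
  have hm' := hy'.aestronglyMeasurable hlam hs'
  have hmz := hz.aestronglyMeasurable hlam hr
  have hsplit : (fun t => y' t - y t) = (fun t => y' t - z t) - fun t => y t - z t := by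
    ext t
    simp
  rw [hsplit]
  calc _ ≤ eLpNorm (fun t => y' t - z t) p (volIoo T) + eLpNorm (fun t => y t - z t) p (volIoo T) :=
        eLpNorm_sub_le (hm'.sub hmz) (hm.sub hmz) hp
    _ < ENNReal.ofReal ε / 2 + ENNReal.ofReal ε / 2 := ENNReal.add_lt_add h2 h1
    _ = ENNReal.ofReal ε := ENNReal.add_halves _
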